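/- Let $(M,\langle\cdot,\cdot\rangle)$ be a smooth oriented Riemannian $7$-manifold with a $G_2$-structure, i.e. a three-form $\varphi$ for which there are, around each point, smooth positive orthonormal frames $e_0,\dots,e_6$ (Cayley frames) with $\varphi=\sum_{i\in\mathbb Z_7}e_i^*\wedge e_{i+1}^*\wedge e_{i+3}^*$. Let $\star$ be the Hodge star for $\mathrm{Vol}=e_0^*\wedge\dots\wedge e_6^*$, $(\alpha,\beta)=\frac1{p!}\sum\alpha(e_{i_1},\dots,e_{i_p})\beta(e_{i_1},\dots,e_{i_p})$ the inner product of $p$-forms, $d$ the exterior derivative (with $d\eta(X,Y)=X\eta(Y)-Y\eta(X)-\eta([X,Y])$ for one-forms), and $\langle X\times Y,Z\rangle=\varphi(X,Y,Z)$. For an endomorphism $a$ put $a_{ij}=\langle e_i,a(e_j)\rangle$ and $$p(a)=\sum_{i\in\mathbb Z_7}(a_{i+1\,i+3}-a_{i+3\,i+1}+a_{i+4\,i+5}-a_{i+5\,i+4}+a_{i+2\,i+6}-a_{i+6\,i+2})\,e_i ,\qquad A_v(u)=u\times v .$$ Endomorphisms of a tangent space split uniquely as $a=a_{(1)}+a_{(2)}+a_{(3)}+a_{(4)}$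 along $\mathfrak X_1=\mathbb R\,\mathrm{Id}$, $\mathfrak X_2=\mathfrak g_2$ (skew, $a_{i+1\,i+3}+a_{i+4\,i+5}+a_{i+2\,i+6}=0$), $\mathfrak X_3$ (symmetric, traceless), $\mathfrak X_4=\mathfrak g_2^\perp$ (skew, $a_{i+1\,i+3}=a_{i+4\,i+5}=a_{i+2\,i+6}$). Let $\nabla$ be the Levi-Civita connection, $\nabla^{G_2}$ the minimal connection, i.e. the connection with $\nabla^{G_2}\varphi=0$ for which $\xi_X=\nabla^{G_2}_X-\nabla_X\in\mathfrak g_2^\perp$ for all $X$; $\xi$ is the intrinsic torsion. Then there is a unique endomorphism $T$ with $\xi_XY=Y\times T(X)$. Let $\xi_{(i)}$ be the components of $\xi$ along the spaces $\{(X,Y)\mapsto Y\times a(X) : a\in\mathfrak X_i\}$; this splitting of $\xi$ is unique. Put $pd^\star\varphi=\star(\star d\varphi\wedge\varphi)$. At each point and for each Cayley basis $e_0,\dots,e_6$ at it the following holds. 1. $T_{(1)}=\frac1{84}(d\varphi,\star\varphi)\,\mathrm{Id}$ and $\xi_{(1)X}Y=\frac1{84}(d\varphi,\star\varphi)\,Y\times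 X$. 2. $\xi_{(2)X}Y=Y\times T_{(2)}(X)$ with $$T_{(2)}=\tfrac1{12}\sum_{i\ne j}\Big(d\star\varphi+\tfrac13\,pd^\star\varphi\wedge\star\varphi,\ \star(e_i^*\wedge e_j^*)\Big)\,(e_i\otimes e_j^*-e_j\otimes e_i^*).$$ 3. $\xi_{(3)X}Y=Y\times T_{(3)}(X)$ with $$T_{(3)}=\tfrac16\sum_i\Big(d\varphi,\ e_i^*\wedge(e_i\lrcorner\star\varphi)-\tfrac47\star\varphi\Big)e_i\otimes e_i^*+\tfrac1{24}\sum_{i\ne j}\Big(d\varphi,\ e_i^*\wedge(e_j\lrcorner\star\varphi)+e_j^*\wedge(e_i\lrcorner\star\varphi)\Big)(e_i\otimes e_j^*+e_j\otimes e_i^*).$$ 4. $pd^\star\varphi=-\star(\star d\star\varphi\wedge\star\varphi)$, $(pd^\star\varphi)^\sharp=6\,p(T)$, $T_{(4)}=\frac1{36}A_{(pd^\star\varphi)^\sharp}$ and $\xi_{(4)X}Y=\frac1{36}\,Y\times\big(X\times(pd^\star\varphi)^\sharp\big)$. Moreover, for every $i\in\mathbb Z_7$ and each pair $(a,b)\in\{(1,3),(4,5),(2,6)\}$,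 $\langle e_i,(pd^\star\varphi)^\sharp\rangle=-\big(d\varphi,\ e_{i+a}^*\wedge(e_{i+b}\lrcorner\star\varphi)-e_{i+b}^*\wedge(e_{i+a}\lrcorner\star\varphi)\big)$. 5. Let $\mathsf k(a)=\sum_{i,j}a_{ij}\,e_i^*\wedge(e_j\lrcorner\star\varphi)$ and $\mathsf m(a)=\sum_{i,j}a_{ij}\star(e_i^*\wedge e_j^*)$. Four-forms split uniquely along $\mathbb R\star\varphi$ (index $1$), $\{\alpha\wedge\varphi:\alpha\in\Lambda^1\}$ (index $4$) and the orthogonal complement of these two (index $3$); five-forms split uniquely along $\{\alpha\wedge\star\varphi:\alpha\in\Lambda^1\}$ (index $4$) and its orthogonal complement (index $2$). With the corresponding components, $$(d\varphi)_{(1)}=3\,\mathsf k(T_{(1)}),\quad (d\varphi)_{(3)}=3\,\mathsf k(T_{(3)}),\quad (d\varphi)_{(4)}=-3\,\mathsf k(T_{(4)}),\quad \mathsf k(T_{(2)})=0,$$ $$(d\star\varphi)_{(2)}=3\,\mathsf m(T_{(2)}),\quad (d\star\varphi)_{(4)}=-6\,\mathsf m(T_{(4)}),\quad \mathsf m(T_{(1)})=\mathsf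 m(T_{(3)})=0.$$ All sums over $i\ne j$ run over ordered pairs. -/

import Mathlib

open Bundle Manifold
open scoped ContDiff

noncomputable section

namespace G2

/-! ### Exterior algebra of an oriented Euclidean space, in an orthonormal basis

Indices run through `Fin 7`, whose addition is addition modulo seven. -/

section Algebra

variable {V : Type*} [NormedAddCommGroup V] [InnerProductSpace ℝ V]

/-- The wedge product, as the sum over shuffles:
`(α ∧ β)(v₁, …) = (1 / (p! q!)) ∑ sgn σ · α(v_{σ 1}, …) β(v_{σ (p+1)}, …)`. -/
def wedge {p q : ℕ} (α : V [⋀^Fin p]→ₗ[ℝ] ℝ) (β : V [⋀^Fin q]→ₗ[ℝ] ℝ) :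
    V [⋀^Fin (p + q)]→ₗ[ℝ] ℝ :=
  ((LinearMap.mul' ℝ ℝ).compAlternatingMap (α.domCoprod β)).domDomCongr finSumFinEquiv

/-- The one-form `⟨v, ·⟩`. In particular `flat (e i)` is the dual one-form `eᵢ*` of a member of an
orthonormal basis. -/
def flat (v : V) : V [⋀^Fin 1]→ₗ[ℝ] ℝ :=
  AlternatingMap.ofSubsingleton ℝ V ℝ (0 : Fin 1) (innerₛₗ ℝ v)

/-- The interior product `v ⌟ α = α(v, ·, …, ·)`. -/
def interiorProd {p : ℕ} (v : V) (α : V [⋀^Fin (p + 1)]→ₗ[ℝ] ℝ) : V [⋀^Fin p]→ₗ[ℝ] ℝ :=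
  α.curryLeft v

variable (e : OrthonormalBasis (Fin 7) ℝ V)

/-- The vector `α♯` with `⟨α♯, x⟩ = α(x)`. -/
def sharp (α : V [⋀^Fin 1]→ₗ[ℝ] ℝ) : V := ∑ i, α (fun _ => e i) • e i

/-- The inner product `(α, β) = (1 / p!) ∑ α(e_{i₁}, …, e_{iₚ}) β(e_{i₁}, …, e_{iₚ})` of `p`-forms.
It does not depend on the orthonormal basis. -/
def formInner {p : ℕ} (α β : V [⋀^Fin p]→ₗ[ℝ] ℝ) : ℝ :=
  ((p.factorial : ℝ))⁻¹ *
    ∑ f : Fin p → Fin 7, α (fun k => e (f k)) * β (fun k => e (f k))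

theorem append_update {X : Type*} {p q : ℕ} (w : Fin p → X) (v : Fin q → X) (i : Fin q) (x : X) :
    Fin.append w (Function.update v i x)
      = Function.update (Fin.append w v) (Fin.natAdd p i) x := by
  funext k
  refine Fin.addCases (fun l => ?_) (fun l => ?_) k
  · rw [Fin.append_left, Function.update_of_ne, Fin.append_left]
    intro h
    have := congrArg Fin.val h
    simp at this
    omega
  · by_cases h : l = i
    · subst h; simp
    · rw [Fin.append_right, Function.update_of_ne h, Function.update_of_ne, Fin.append_right]
      intro h'
      exact h (Fin.natAdd_injective _ _ h')

/-- Insertion of the vectors `w` in the first `p` arguments of an alternating form. -/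
def insertFirst {n p q : ℕ} (h : p + q = n) (w : Fin p → V) (η : V [⋀^Fin n]→ₗ[ℝ] ℝ) :
    V [⋀^Fin q]→ₗ[ℝ] ℝ where
  toFun v := η.domDomCongr (finCongr h.symm) (Fin.append w v)
  map_update_add' v i x y := by
    classical
    rename_i inst
    obtain rfl : inst = instDecidableEqFin q := Subsingleton.elim _ _
    simp only [append_update]
    exact AlternatingMap.map_update_add _ _ _ _ _
  map_update_smul' v i c x := by
    classical
    rename_i inst
    obtain rfl : inst = instDecidableEqFin q := Subsingleton.elim _ _
    simp only [append_update]
    exact AlternatingMap.map_update_smul _ _ _ _ _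
  map_eq_zero_of_eq' v i j hv hij :=
    AlternatingMap.map_eq_zero_of_eq _ _ (i := Fin.natAdd p i) (j := Fin.natAdd p j)
      (by simpa using hv) (fun h' => hij (Fin.natAdd_injective _ _ h'))

/-- The Hodge star operator of the metric and of the volume form `Vol = e₀* ∧ ⋯ ∧ e₆*`, that is
`e.toBasis.det`:
`(⋆α)(v₁, …) = (1 / p!) ∑ α(e_{i₁}, …, e_{iₚ}) Vol(e_{i₁}, …, e_{iₚ}, v₁, …)`.
It satisfies `β ∧ ⋆α = (β, α) Vol` and depends only on the orientation of the orthonormal basis. -/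
def hodge {p q : ℕ} (h : p + q = 7) (α : V [⋀^Fin p]→ₗ[ℝ] ℝ) : V [⋀^Fin q]→ₗ[ℝ] ℝ :=
  ((p.factorial : ℝ))⁻¹ • ∑ f : Fin p → Fin 7,
    α (fun k => e (f k)) • insertFirst h (fun k => e (f k)) e.toBasis.det

/-- The three-form `∑ᵢ eᵢ* ∧ eᵢ₊₁* ∧ eᵢ₊₃*`. -/
def cayleyForm : V [⋀^Fin 3]→ₗ[ℝ] ℝ :=
  ∑ i : Fin 7, wedge (wedge (flat (e i)) (flat (e (i + 1)))) (flat (e (i + 3)))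

/-- The four-form `⋆φ`. -/
def cayleyFourForm : V [⋀^Fin 4]→ₗ[ℝ] ℝ := hodge e (by norm_num) (cayleyForm e)

theorem update_second {X : Type*} (u v w v' : X) :
    Function.update ![u, v, w] 1 v' = ![u, v', w] := by
  funext k
  fin_cases k <;> rfl

/-- The vector cross product `u × v = ∑ᵢ φ(u, v, eᵢ) eᵢ`, as a bilinear map. -/
def cross : V →ₗ[ℝ] V →ₗ[ℝ] V :=
  LinearMap.mk₂ ℝ (fun u v => ∑ i, cayleyForm e ![u, v, e i] • e i)
    (fun u u' v => by
      rw [← Finset.sum_add_distrib]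
      refine Finset.sum_congr rfl fun i _ => ?_
      rw [← add_smul]
      congr 1
      exact (cayleyForm e).map_vecCons_add _ _ _)
    (fun c u v => by
      rw [Finset.smul_sum]
      refine Finset.sum_congr rfl fun i _ => ?_
      rw [smul_smul]
      congr 1
      exact (cayleyForm e).map_vecCons_smul _ _ _)
    (fun u v v' => by
      rw [← Finset.sum_add_distrib]
      refine Finset.sum_congr rfl fun i _ => ?_
      rw [← add_smul]
      congr 1
      have h := (cayleyForm e).map_update_add ![u, v, e i] 1 v v'
      simpa only [update_second] using h)
    (fun c u v => by
      rw [Finset.smul_sum]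
      refine Finset.sum_congr rfl fun i _ => ?_
      rw [smul_smul]
      congr 1
      have h := (cayleyForm e).map_update_smul ![u, v, e i] 1 c v
      simpa only [update_second, smul_eq_mul] using h)

/-! ### Endomorphisms -/

/-- The endomorphism `x ⊗ y*`, `u ↦ ⟨y, u⟩ x`. -/
def tensor (x y : V) : V →ₗ[ℝ] V := (innerₛₗ ℝ y).smulRight x

/-- The entries `a_{ij} = ⟨eᵢ, a(eⱼ)⟩`, for which `a = ∑ a_{ij} eᵢ ⊗ eⱼ*`. -/
def entry (a : V →ₗ[ℝ] V) (i j : Fin 7) : ℝ := inner ℝ (e i) (a (e j))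

/-- The endomorphism `A_v`, `u ↦ u × v`. -/
def crossRight (v : V) : V →ₗ[ℝ] V := (cross e).flip v

/-- The vector `p(a)`. -/
def pVector (a : V →ₗ[ℝ] V) : V :=
  ∑ i : Fin 7,
    (entry e a (i + 1) (i + 3) - entry e a (i + 3) (i + 1)
      + entry e a (i + 4) (i + 5) - entry e a (i + 5) (i + 4)
      + entry e a (i + 2) (i + 6) - entry e a (i + 6) (i + 2)) • e i

/-- The multiples of the identity. -/
def scalars : Submodule ℝ (V →ₗ[ℝ] V) := Submodule.span ℝ {LinearMap.id}

/-- The Lie algebra `𝔤₂` of the stabiliser of `φ`, described by linear equations in a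
Cayley basis. -/
def lieG2 : Submodule ℝ (V →ₗ[ℝ] V) where
  carrier := {a | (∀ i j, entry e a i j = - entry e a j i) ∧
    ∀ i : Fin 7,
      entry e a (i + 1) (i + 3) + entry e a (i + 4) (i + 5) + entry e a (i + 2) (i + 6) = 0}
  zero_mem' := by simp [entry]
  add_mem' := by
    rintro a b ⟨ha, ha'⟩ ⟨hb, hb'⟩
    simp only [entry] at *
    refine ⟨fun i j => ?_, fun i => ?_⟩
    · simp only [LinearMap.add_apply, inner_add_right]; linarith [ha i j, hb i j]
    · simp only [LinearMap.add_apply, inner_add_right]; linarith [ha' i, hb' i]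
  smul_mem' := by
    rintro c a ⟨ha, ha'⟩
    simp only [entry] at *
    refine ⟨fun i j => ?_, fun i => ?_⟩
    · simp only [LinearMap.smul_apply, inner_smul_right]; rw [ha i j]; ring
    · simp only [LinearMap.smul_apply, inner_smul_right]; rw [← mul_add, ← mul_add, ha' i, mul_zero]

/-- The traceless symmetric endomorphisms. -/
def tracelessSymmetric : Submodule ℝ (V →ₗ[ℝ] V) where
  carrier := {a | (∀ i j, entry e a i j = entry e a j i) ∧ ∑ i, entry e a i i = 0}
  zero_mem' := by simp [entry]
  add_mem' := by
    rintro a b ⟨ha, ha'⟩ ⟨hb, hb'⟩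
    simp only [entry] at *
    refine ⟨fun i j => ?_, ?_⟩
    · simp only [LinearMap.add_apply, inner_add_right]; linarith [ha i j, hb i j]
    · simp only [LinearMap.add_apply, inner_add_right, Finset.sum_add_distrib]; linarith
  smul_mem' := by
    rintro c a ⟨ha, ha'⟩
    simp only [entry] at *
    refine ⟨fun i j => ?_, ?_⟩
    · simp only [LinearMap.smul_apply, inner_smul_right]; rw [ha i j]
    · simp only [LinearMap.smul_apply, inner_smul_right, ← Finset.mul_sum, ha', mul_zero]

/-- The orthogonal complement `𝔤₂^⊥` of `𝔤₂` in the skew-symmetric endomorphisms. -/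
def lieG2Perp : Submodule ℝ (V →ₗ[ℝ] V) where
  carrier := {a | (∀ i j, entry e a i j = - entry e a j i) ∧
    ∀ i : Fin 7, entry e a (i + 1) (i + 3) = entry e a (i + 4) (i + 5) ∧
      entry e a (i + 4) (i + 5) = entry e a (i + 2) (i + 6)}
  zero_mem' := by simp [entry]
  add_mem' := by
    rintro a b ⟨ha, ha'⟩ ⟨hb, hb'⟩
    simp only [entry] at *
    refine ⟨fun i j => ?_, fun i => ⟨?_, ?_⟩⟩
    · simp only [LinearMap.add_apply, inner_add_right]; linarith [ha i j, hb i j]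
    · simp only [LinearMap.add_apply, inner_add_right]; linarith [(ha' i).1, (hb' i).1]
    · simp only [LinearMap.add_apply, inner_add_right]; linarith [(ha' i).2, (hb' i).2]
  smul_mem' := by
    rintro c a ⟨ha, ha'⟩
    simp only [entry] at *
    refine ⟨fun i j => ?_, fun i => ⟨?_, ?_⟩⟩
    · simp only [LinearMap.smul_apply, inner_smul_right]; rw [ha i j]; ring
    · simp only [LinearMap.smul_apply, inner_smul_right]; rw [(ha' i).1]
    · simp only [LinearMap.smul_apply, inner_smul_right]; rw [(ha' i).2]

/-! ### The `G₂`-modules and components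

The four families below are indexed by `Fin 4`; the index `i` stands for the module `𝔛ᵢ₊₁`. -/

/-- `𝔛₁ = ℝ Id`, `𝔛₂ = 𝔤₂`, `𝔛₃ = S₀²`, `𝔛₄ = 𝔤₂^⊥` in the endomorphisms of `V`. -/
def endModule : Fin 4 → Submodule ℝ (V →ₗ[ℝ] V) :=
  ![scalars, lieG2 e, tracelessSymmetric e, lieG2Perp e]

/-- The tensor `ξ` with `ξ_X Y = Y × a(X)`, for an endomorphism `a`; here `ξ_X Y` is written
`ξ X Y`. -/
def torsionOf : (V →ₗ[ℝ] V) →ₗ[ℝ] (V →ₗ[ℝ] V →ₗ[ℝ] V) where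
  toFun a := (cross e).flip.comp a
  map_add' _ _ := LinearMap.comp_add _ _ _
  map_smul' _ _ := LinearMap.comp_smul _ _ _

/-- The four modules of intrinsic torsions: `𝔛ᵢ` consists of the `ξ` with `ξ_X Y = Y × a(X)`
for some `a` in the module `𝔛ᵢ` of endomorphisms. -/
def torsionModule (i : Fin 4) : Submodule ℝ (V →ₗ[ℝ] V →ₗ[ℝ] V) :=
  (endModule e i).map (torsionOf e)

/-- The four-forms orthogonal to `⋆φ` and to all `α ∧ φ`, for one-forms `α`. -/
def fourForms27 : Submodule ℝ (V [⋀^Fin 4]→ₗ[ℝ] ℝ) where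
  carrier := {β | formInner e β (cayleyFourForm e) = 0 ∧
    ∀ v : V, formInner e β (wedge (flat v) (cayleyForm e)) = 0}
  zero_mem' := by simp [formInner]
  add_mem' := by
    rintro a b ⟨ha, ha'⟩ ⟨hb, hb'⟩
    simp only [formInner] at *
    refine ⟨?_, fun v => ?_⟩
    · simp only [AlternatingMap.add_apply, add_mul, Finset.sum_add_distrib, mul_add]; linarith
    · simp only [AlternatingMap.add_apply, add_mul, Finset.sum_add_distrib, mul_add]
      linarith [ha' v, hb' v]
  smul_mem' := by
    rintro c a ⟨ha, ha'⟩
    simp only [formInner] at *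
    refine ⟨?_, fun v => ?_⟩
    · simp only [AlternatingMap.smul_apply, smul_eq_mul, mul_assoc, ← Finset.mul_sum]
      rw [mul_left_comm, ha, mul_zero]
    · simp only [AlternatingMap.smul_apply, smul_eq_mul, mul_assoc, ← Finset.mul_sum]
      rw [mul_left_comm, ha' v, mul_zero]

/-- The five-forms orthogonal to all `α ∧ ⋆φ`, for one-forms `α`. -/
def fiveForms14 : Submodule ℝ (V [⋀^Fin 5]→ₗ[ℝ] ℝ) where
  carrier := {β | ∀ v : V, formInner e β (wedge (flat v) (cayleyFourForm e)) = 0}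
  zero_mem' := by simp [formInner]
  add_mem' := by
    intro a b ha' hb' v
    have ha := ha' v
    have hb := hb' v
    simp only [formInner] at *
    simp only [AlternatingMap.add_apply, add_mul, Finset.sum_add_distrib, mul_add]
    linarith
  smul_mem' := by
    intro c a ha' v
    have ha := ha' v
    simp only [formInner] at *
    simp only [AlternatingMap.smul_apply, smul_eq_mul, mul_assoc, ← Finset.mul_sum]
    rw [mul_left_comm, ha, mul_zero]

/-- The decomposition of `Λ⁴`: `𝔛₁ = ℝ ⋆φ`, `𝔛₃` of dimension 27, `𝔛₄ = {α ∧ φ}`. There is no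
submodule of type `𝔛₂`. -/
def fourFormModule : Fin 4 → Submodule ℝ (V [⋀^Fin 4]→ₗ[ℝ] ℝ) :=
  ![Submodule.span ℝ {cayleyFourForm e}, ⊥, fourForms27 e,
    Submodule.span ℝ (Set.range fun v : V => wedge (flat v) (cayleyForm e))]

/-- The decomposition of `Λ⁵`: `𝔛₂` of dimension 14 and `𝔛₄ = {α ∧ ⋆φ}`. There are no submodules
of type `𝔛₁` and `𝔛₃`. -/
def fiveFormModule : Fin 4 → Submodule ℝ (V [⋀^Fin 5]→ₗ[ℝ] ℝ) :=
  ![⊥, fiveForms14 e, ⊥,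
    Submodule.span ℝ (Set.range fun v : V => wedge (flat v) (cayleyFourForm e))]

/-- The tuple `c` splits `a` along the family of submodules `W`. -/
def IsSplitting {N : Type*} [AddCommGroup N] [Module ℝ N] (W : Fin 4 → Submodule ℝ N)
    (a : N) (c : Fin 4 → N) : Prop :=
  (∀ i, c i ∈ W i) ∧ ∑ i, c i = a

/-- The components of `a` along the family `W`. They are meaningful if `a` has exactly one
splitting along `W`. -/
def component {N : Type*} [AddCommGroup N] [Module ℝ N] (W : Fin 4 → Submodule ℝ N)
    (a : N) : Fin 4 → N :=
  Classical.epsilon (IsSplitting W a)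

/-- The map `k(a) = ∑ a_{ij} eᵢ* ∧ (eⱼ ⌟ ⋆φ)`. -/
def kMap (a : V →ₗ[ℝ] V) : V [⋀^Fin 4]→ₗ[ℝ] ℝ :=
  ∑ i, ∑ j, entry e a i j • wedge (flat (e i)) (interiorProd (e j) (cayleyFourForm e))

/-- The map `m(a) = ∑ a_{ij} ⋆(eᵢ* ∧ eⱼ*)`. -/
def mMap (a : V →ₗ[ℝ] V) : V [⋀^Fin 5]→ₗ[ℝ] ℝ :=
  ∑ i, ∑ j, entry e a i j • hodge e (by norm_num) (wedge (flat (e i)) (flat (e j)))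

/-- The pairing `(β, eᵢ* ∧ (eⱼ ⌟ ⋆φ))`. -/
def kPairing (β : V [⋀^Fin 4]→ₗ[ℝ] ℝ) (i j : Fin 7) : ℝ :=
  formInner e β (wedge (flat (e i)) (interiorProd (e j) (cayleyFourForm e)))

/-- The one-form `⋆(⋆β ∧ φ)`, which is `pd⋆φ` for `β = dφ`. -/
def pdStar (β : V [⋀^Fin 4]→ₗ[ℝ] ℝ) : V [⋀^Fin 1]→ₗ[ℝ] ℝ :=
  hodge e (p := 3 + 3) (by norm_num)
    (wedge (hodge e (q := 3) (by norm_num) β) (cayleyForm e))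

end Algebra

/-! ### Differential forms on a seven-manifold -/

/-- The model space `ℝ⁷`. -/
abbrev E7 : Type := EuclideanSpace ℝ (Fin 7)

theorem alternating_expand {p : ℕ} (α : E7 [⋀^Fin p]→ₗ[ℝ] ℝ) (v : Fin p → E7) :
    α v = ∑ f : Fin p → Fin 7,
      (∏ k, v k (f k)) * α (fun k => EuclideanSpace.basisFun (Fin 7) ℝ (f k)) := by
  have h : v = fun k => ∑ i, v k i • EuclideanSpace.basisFun (Fin 7) ℝ i := by
    funext k
    simpa using ((EuclideanSpace.basisFun (Fin 7) ℝ).sum_repr (v k)).symm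
  conv_lhs => rw [h]
  rw [← AlternatingMap.coe_multilinearMap, MultilinearMap.map_sum]
  refine Finset.sum_congr rfl fun f _ => ?_
  rw [MultilinearMap.map_smul_univ]
  rfl

/-- An alternating form on `ℝ⁷`, as a continuous alternating form. -/
def toContinuous {p : ℕ} (α : E7 [⋀^Fin p]→ₗ[ℝ] ℝ) : E7 [⋀^Fin p]→L[ℝ] ℝ :=
  { α with
    cont := by
      have h : (fun v : Fin p → E7 => α v) = fun v => ∑ f : Fin p → Fin 7,
          (∏ k, v k (f k)) * α (fun k => EuclideanSpace.basisFun (Fin 7) ℝ (f k)) :=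
        funext (alternating_expand α)
      change Continuous (fun v : Fin p → E7 => α v)
      rw [h]
      fun_prop }

section Manifold

variable {M : Type*} [TopologicalSpace M] [ChartedSpace E7 M]

/-- The expression of a differential form in the chart around `x`. -/
def chartForm {p : ℕ} (η : ∀ y : M, TangentSpace (𝓡 7) y [⋀^Fin p]→ₗ[ℝ] ℝ) (x : M) (z : E7) :
    E7 [⋀^Fin p]→L[ℝ] ℝ :=
  toContinuous ((η ((extChartAt (𝓡 7) x).symm z)).compLinearMap
    (mfderiv 𝓘(ℝ, E7) (𝓡 7) (extChartAt (𝓡 7) x).symm z).toLinearMap)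

/-- The exterior derivative `dη` at `x`, computed in the chart around `x`, with the convention
`dη(X₀, …, Xₚ) = ∑ (-1)ⁱ Xᵢ(η(X₀, …, X̂ᵢ, …, Xₚ))` for coordinate vector fields. -/
def extDerivAt {p : ℕ} (η : ∀ y : M, TangentSpace (𝓡 7) y [⋀^Fin p]→ₗ[ℝ] ℝ) (x : M) :
    TangentSpace (𝓡 7) x [⋀^Fin (p + 1)]→ₗ[ℝ] ℝ :=
  (extDeriv (chartForm η x) (extChartAt (𝓡 7) x x)).toAlternatingMap.compLinearMap
    (mfderiv (𝓡 7) 𝓘(ℝ, E7) (extChartAt (𝓡 7) x) x).toLinearMap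

theorem finrank_tangent (x : M) : Module.finrank ℝ (TangentSpace (𝓡 7) x) = 7 :=
  finrank_euclideanSpace_fin (𝕜 := ℝ) (n := 7)

variable [IsManifold (𝓡 7) ∞ M]
variable [RiemannianBundle (fun x : M => TangentSpace (𝓡 7) x)]

variable (M) in
/-- A `G₂`-structure on a Riemannian seven-manifold: an orientation and a three-form `φ` that are
given, around every point, by a smooth frame field which at each point is a positive orthonormal
basis in which `φ` is the standard form. -/
structure G2Structure where
  /-- The fundamental three-form. -/
  φ : ∀ x : M, TangentSpace (𝓡 7) x [⋀^Fin 3]→ₗ[ℝ] ℝ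
  /-- The orientation of the manifold. -/
  orientation : ∀ x : M, Orientation ℝ (TangentSpace (𝓡 7) x) (Fin 7)
  exists_cayley_frame : ∀ x : M, ∃ U : Set M, IsOpen U ∧ x ∈ U ∧
    ∃ s : Fin 7 → ∀ y : M, TangentSpace (𝓡 7) y,
      (∀ i, ContMDiffOn (𝓡 7) (𝓡 7).tangent ∞ (fun y => (⟨y, s i y⟩ : TangentBundle (𝓡 7) M)) U) ∧
      ∀ y ∈ U, ∃ e : OrthonormalBasis (Fin 7) ℝ (TangentSpace (𝓡 7) y),
        (∀ i, e i = s i y) ∧ e.toBasis.orientation = orientation y ∧ φ y = cayleyForm e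

namespace G2Structure

variable (G : G2Structure M)

/-- The positive orthonormal bases of the tangent space at `x` in which `φ` is the standard
three-form. -/
def IsCayleyBasis (x : M) (e : OrthonormalBasis (Fin 7) ℝ (TangentSpace (𝓡 7) x)) : Prop :=
  e.toBasis.orientation = G.orientation x ∧ G.φ x = cayleyForm e

/-- The four-form `⋆φ`; the Hodge star is computed in some positive orthonormal basis. -/
def starφ (x : M) : TangentSpace (𝓡 7) x [⋀^Fin 4]→ₗ[ℝ] ℝ :=
  hodge ((G.orientation x).finOrthonormalBasis (by norm_num) (finrank_tangent x))
    (by norm_num) (G.φ x)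

/-- The four-form `dφ`. -/
def dφ (x : M) : TangentSpace (𝓡 7) x [⋀^Fin 4]→ₗ[ℝ] ℝ := extDerivAt G.φ x

/-- The five-form `d⋆φ`. -/
def dstarφ (x : M) : TangentSpace (𝓡 7) x [⋀^Fin 5]→ₗ[ℝ] ℝ := extDerivAt G.starφ x

end G2Structure

/-- Affine connections on `M`. -/
abbrev Connection (M : Type*) [TopologicalSpace M] [ChartedSpace E7 M] [IsManifold (𝓡 7) ∞ M] :=
  CovariantDerivative (𝓡 7) E7 (fun x : M => TangentSpace (𝓡 7) x)

/-- The Levi-Civita connection: it is torsion-free and compatible with the metric. -/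
def IsLeviCivita [IsContMDiffRiemannianBundle (𝓡 7) ∞ E7 (fun x : M => TangentSpace (𝓡 7) x)]
    (D : Connection M) : Prop :=
  have : IsContMDiffRiemannianBundle (𝓡 7) 1 E7 (fun x : M => TangentSpace (𝓡 7) x) :=
    IsContMDiffRiemannianBundle.of_le (n := ∞) (by norm_cast)
  D.torsion = 0 ∧ D.IsMetricCompatible

/-- The tensor `ξ_X Y = D'_X Y - D_X Y` at `x`, written `ξ X Y`. -/
def connectionDifference (D' D : Connection M) (x : M) :
    TangentSpace (𝓡 7) x →ₗ[ℝ] TangentSpace (𝓡 7) x →ₗ[ℝ] TangentSpace (𝓡 7) x :=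
  LinearMap.mk₂ ℝ (fun X Y => D'.difference D x Y X)
    (by intro X X' Y; simp) (by intro c X Y; simp) (by intro X Y Y'; simp) (by intro c X Y; simp)

namespace G2Structure

variable (G : G2Structure M)

/-- The `G₂`-connections: those for which `φ` is parallel, that is
`X(φ(Y₀, Y₁, Y₂)) = φ(D_X Y₀, Y₁, Y₂) + φ(Y₀, D_X Y₁, Y₂) + φ(Y₀, Y₁, D_X Y₂)`. -/
def IsG2Connection (D : Connection M) : Prop :=
  ∀ (x : M) (X : TangentSpace (𝓡 7) x) (Y : Fin 3 → ∀ y : M, TangentSpace (𝓡 7) y),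
    (∀ i, MDifferentiableAt (𝓡 7) (𝓡 7).tangent
      (fun y => (⟨y, Y i y⟩ : TangentBundle (𝓡 7) M)) x) →
    mfderiv (𝓡 7) 𝓘(ℝ, ℝ) (fun y => G.φ y (fun i => Y i y)) x X =
      ∑ i, G.φ x (Function.update (fun j => Y j x) i (D (Y i) x X))

/-- The minimal connection: the `G₂`-connection whose difference `ξ` with the Levi-Civita
connection `D` has values in `𝔤₂^⊥`; then `ξ` is the intrinsic torsion. -/
def IsMinimalConnection (D D' : Connection M) : Prop :=
  G.IsG2Connection D' ∧
    ∀ (x : M) (e : OrthonormalBasis (Fin 7) ℝ (TangentSpace (𝓡 7) x)), G.IsCayleyBasis x e →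
      ∀ X, connectionDifference D' D x X ∈ lieG2Perp e

end G2Structure

end Manifold

end G2

end

open G2

/-! Write `D` for the Levi-Civita connection, `D'` for the minimal one and `ξ = D' - D`.

Analysis. Since `D` is torsion-free, the exterior derivative of a `D'`-parallel form `α` is the
alternation of `X ↦ ξ_X · α`, where endomorphisms act on forms as derivations
(`extDerivAt_eq_torsionDeriv`): in coordinate fields the Levi-Civita part is symmetric and drops
out. For `φ` parallelism is the hypothesis. For `⋆φ` it has to be derived: the connection matrix of
`D'` in a Cayley frame annihilates `φ`, and it is skew because `D` is metric and `ξ_X` is skew; so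
it lies in `𝔤₂` and annihilates `⋆φ` as well (`G2Structure.extDerivAt_eq`). After this step
everything is linear algebra in one tangent space.

Algebra. The space `𝔤₂^⊥` consists of the maps `A_v`, and `v` is recovered by `p(A_v) = 6v`; hence
`ξ_X = A_{T(X)}` for exactly one `T`. Two identities determine the derivatives: `A_v · φ = 3 v ⌟ ⋆φ`
and `A_v · ⋆φ = -3 v* ∧ φ`. The first gives `dφ = 3 k(Tᵗ)`. Transposition is the identity on
symmetric endomorphisms and `-1` on skew ones, and `k` kills `𝔤₂`; this explains the coefficients
`3, 3, -3` of the components of `dφ`. The second gives the pairings of `d⋆φ` with the forms `⋆(eᵢ* ∧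
eⱼ*)`, which see only the skew part of `T`.

The formulas for the components of `T` then result from comparing two things: the projections of `T`
onto the four modules, written with the trace, the transpose and `A_{p(T)}`, and the pairings of
`dφ` and `d⋆φ` with `eᵢ* ∧ (eⱼ ⌟ ⋆φ)` and `⋆(eᵢ* ∧ eⱼ*)`. These pairings reduce to contractions of
the structure constants `ε` of `φ` and `ψ` of `⋆φ`.

Forms are mostly compared through their inner products with other forms. This replaces sums over
shuffles by the adjointness of `v* ∧ ·` and `v ⌟ ·` (`formInner_flat_wedge`). -/

noncomputable section

namespace G2

/-! ### Inner products of forms, and wedge products through their pairings -/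

section Pairing

variable {V : Type*} [NormedAddCommGroup V] [InnerProductSpace ℝ V]
variable (e : OrthonormalBasis (Fin 7) ℝ V)

/-- The inner product of forms as a bilinear map. -/
def formPairing (p : ℕ) : (V [⋀^Fin p]→ₗ[ℝ] ℝ) →ₗ[ℝ] (V [⋀^Fin p]→ₗ[ℝ] ℝ) →ₗ[ℝ] ℝ :=
  LinearMap.mk₂ ℝ (formInner e)
    (fun α α' β => by
      simp only [formInner, AlternatingMap.add_apply, add_mul, Finset.sum_add_distrib, mul_add])
    (fun c α β => by
      simp only [formInner, AlternatingMap.smul_apply, smul_eq_mul, mul_assoc, ← Finset.mul_sum]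
      ring)
    (fun α β β' => by
      simp only [formInner, AlternatingMap.add_apply, Finset.sum_add_distrib, mul_add])
    (fun c α β => by
      simp only [formInner, AlternatingMap.smul_apply, smul_eq_mul, mul_left_comm _ c,
        ← Finset.mul_sum])

theorem formPairing_apply {p : ℕ} (α β : V [⋀^Fin p]→ₗ[ℝ] ℝ) :
    formPairing e p α β = formInner e α β := rfl

theorem form_sum_apply {p : ℕ} {ι : Type*} (s : Finset ι) (α : ι → V [⋀^Fin p]→ₗ[ℝ] ℝ)
    (v : Fin p → V) : (∑ i ∈ s, α i) v = ∑ i ∈ s, α i v := by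
  classical
  induction s using Finset.induction_on with
  | empty => simp
  | insert i s hi ih => simp [Finset.sum_insert hi, ih]

theorem formInner_comm {p : ℕ} (α β : V [⋀^Fin p]→ₗ[ℝ] ℝ) :
    formInner e α β = formInner e β α := by
  simp only [formInner, mul_comm]

theorem form_eq_zero_of_basis {p : ℕ} {α : V [⋀^Fin p]→ₗ[ℝ] ℝ}
    (h : ∀ f : Fin p → Fin 7, α (fun k => e (f k)) = 0) : α = 0 :=
  e.toBasis.ext_alternating fun f _ => by simpa using h f

theorem form_ext_basis {p : ℕ} {α β : V [⋀^Fin p]→ₗ[ℝ] ℝ}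
    (h : ∀ f : Fin p → Fin 7, α (fun k => e (f k)) = β (fun k => e (f k))) : α = β :=
  e.toBasis.ext_alternating fun f _ => by simpa using h f

theorem eq_zero_of_formInner_self {p : ℕ} {α : V [⋀^Fin p]→ₗ[ℝ] ℝ} (h : formInner e α α = 0) :
    α = 0 := by
  have hp : ((p.factorial : ℝ))⁻¹ ≠ 0 := by positivity
  have h' := (mul_eq_zero.1 h).resolve_left hp
  rw [Finset.sum_eq_zero_iff_of_nonneg fun f _ => mul_self_nonneg _] at h'
  exact form_eq_zero_of_basis e fun f => mul_self_eq_zero.1 (h' f (Finset.mem_univ f))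

theorem form_ext_formInner {p : ℕ} {α β : V [⋀^Fin p]→ₗ[ℝ] ℝ}
    (h : ∀ η, formInner e α η = formInner e β η) : α = β := by
  rw [← sub_eq_zero]
  refine eq_zero_of_formInner_self e ?_
  rw [← formPairing_apply, LinearMap.map_sub₂, formPairing_apply, formPairing_apply, h, sub_self]

/-- Expansion of a multilinear map in an orthonormal basis. -/
theorem multilinear_expand {p : ℕ} (m : MultilinearMap ℝ (fun _ : Fin p => V) ℝ) (v : Fin p → V) :
    m v = ∑ f : Fin p → Fin 7, (∏ k, inner ℝ (e (f k)) (v k)) * m (fun k => e (f k)) := by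
  have h : v = fun k => ∑ i, inner ℝ (e i) (v k) • e i := by
    funext k
    exact (e.sum_repr' (v k)).symm
  conv_lhs => rw [h]
  rw [MultilinearMap.map_sum]
  refine Finset.sum_congr rfl fun f _ => ?_
  rw [MultilinearMap.map_smul_univ]
  rfl

/-- Expanding `α` on `e'` in terms of `e`, and `β` on `e` in terms of `e'`, turns both sides into
the same double sum. -/
theorem formInner_basis_independent (e' : OrthonormalBasis (Fin 7) ℝ V) {p : ℕ}
    (α β : V [⋀^Fin p]→ₗ[ℝ] ℝ) : formInner e' α β = formInner e α β := by
  unfold formInner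
  congr 1
  have h : ∀ f : Fin p → Fin 7, α (fun k => e' (f k)) =
      ∑ g : Fin p → Fin 7, (∏ k, inner ℝ (e (g k)) (e' (f k))) * α (fun k => e (g k)) :=
    fun f => multilinear_expand e α.toMultilinearMap _
  have h' : ∀ g : Fin p → Fin 7, β (fun k => e (g k)) =
      ∑ f : Fin p → Fin 7, (∏ k, inner ℝ (e' (f k)) (e (g k))) * β (fun k => e' (f k)) :=
    fun f => multilinear_expand e' β.toMultilinearMap _
  simp only [h, h', Finset.sum_mul, Finset.mul_sum]
  rw [Finset.sum_comm]
  refine Finset.sum_congr rfl fun g _ => Finset.sum_congr rfl fun f _ => ?_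
  simp only [real_inner_comm (e' (f _))]
  ring

/-- Reindexing by `τ` moves the permutation from `A` to `η`, where it produces a second factor `sign
τ` that cancels the first. -/
theorem sum_perm_alternating {n : ℕ} (A : (Fin n → Fin 7) → ℝ) (η : V [⋀^Fin n]→ₗ[ℝ] ℝ)
    (τ : Equiv.Perm (Fin n)) :
    ∑ f : Fin n → Fin 7, (Equiv.Perm.sign τ : ℤ) * A (f ∘ τ) * η (fun k => e (f k))
      = ∑ f : Fin n → Fin 7, A f * η (fun k => e (f k)) := by
  rw [← (Equiv.arrowCongr τ (Equiv.refl (Fin 7))).sum_comp]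
  refine Finset.sum_congr rfl fun f _ => ?_
  have h1 : (Equiv.arrowCongr τ (Equiv.refl (Fin 7))) f ∘ τ = f := by
    funext k; simp
  have h2 : η (fun k => e ((Equiv.arrowCongr τ (Equiv.refl (Fin 7))) f k))
      = (Equiv.Perm.sign τ : ℤ) * η (fun k => e (f k)) := by
    have := η.map_perm (fun k => e (f k)) τ⁻¹
    rw [Equiv.Perm.sign_inv] at this
    simpa [Function.comp_def, Units.smul_def] using this
  rw [h1, h2]
  have h3 : (((Equiv.Perm.sign τ : ℤˣ) : ℤ) : ℝ) * ((Equiv.Perm.sign τ : ℤˣ) : ℤ) = 1 := by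
    rw [← Int.cast_mul, Int.units_coe_mul_self, Int.cast_one]
  linear_combination (A f * η fun k => e (f k)) * h3

/-- Alternating a product of two alternating maps counts each shuffle `p! q!` times, so shuffles can
be traded for all permutations. -/
theorem wedge_eq_sum_perm {p q : ℕ} (α : V [⋀^Fin p]→ₗ[ℝ] ℝ) (β : V [⋀^Fin q]→ₗ[ℝ] ℝ)
    (v : Fin (p + q) → V) :
    (p.factorial * q.factorial : ℝ) * wedge α β v = ∑ σ : Equiv.Perm (Fin p ⊕ Fin q),
      (Equiv.Perm.sign σ : ℤ) * (α (fun k => v (finSumFinEquiv (σ (Sum.inl k))))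
        * β (fun k => v (finSumFinEquiv (σ (Sum.inr k))))) := by
  have h := congrArg (fun m => LinearMap.mul' ℝ ℝ (m (fun k => v (finSumFinEquiv k))))
    (MultilinearMap.domCoprod_alternization_eq α β)
  simp only [Fintype.card_fin, MultilinearMap.alternatization_apply, map_sum,
    MultilinearMap.domDomCongr_apply, AlternatingMap.smul_apply, Units.smul_def, map_zsmul,
    MultilinearMap.domCoprod_apply, map_nsmul, AlternatingMap.coe_multilinearMap] at h
  simp only [LinearMap.mul'_apply, zsmul_eq_mul, nsmul_eq_mul, Nat.cast_mul] at h
  exact h.symm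

/-- All `(p + q)!` permutations in the expansion of the wedge product contribute equally once paired
with an alternating `η`, so the unshuffled term suffices. -/
theorem formInner_wedge {p q : ℕ} (α : V [⋀^Fin p]→ₗ[ℝ] ℝ) (β : V [⋀^Fin q]→ₗ[ℝ] ℝ)
    (η : V [⋀^Fin (p + q)]→ₗ[ℝ] ℝ) :
    formInner e (wedge α β) η = (p.factorial * q.factorial : ℝ)⁻¹ *
      ∑ f : Fin p → Fin 7, ∑ h : Fin q → Fin 7,
        α (fun k => e (f k)) * β (fun k => e (h k)) *
          η (Fin.append (fun k => e (f k)) (fun k => e (h k))) := by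
  have hpq : (p.factorial * q.factorial : ℝ) ≠ 0 := by positivity
  have hn : ((p + q).factorial : ℝ) ≠ 0 := by positivity
  let A : (Fin (p + q) → Fin 7) → ℝ := fun f =>
    α (fun k => e (f (Fin.castAdd q k))) * β (fun k => e (f (Fin.natAdd p k)))
  have key : (p.factorial * q.factorial : ℝ) *
      (∑ f : Fin (p + q) → Fin 7, wedge α β (fun k => e (f k)) * η (fun k => e (f k)))
      = (p + q).factorial * ∑ f : Fin (p + q) → Fin 7, A f * η (fun k => e (f k)) := by
    have hσ : ∀ σ : Equiv.Perm (Fin p ⊕ Fin q), ∑ f : Fin (p + q) → Fin 7,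
        (Equiv.Perm.sign σ : ℤ) * (α (fun k => e (f (finSumFinEquiv (σ (Sum.inl k)))))
        * β (fun k => e (f (finSumFinEquiv (σ (Sum.inr k)))))) * η (fun k => e (f k))
        = ∑ f : Fin (p + q) → Fin 7, A f * η (fun k => e (f k)) := by
      intro σ
      rw [← sum_perm_alternating e A η (finSumFinEquiv.permCongr σ)]
      refine Finset.sum_congr rfl fun f _ => ?_
      rw [Equiv.Perm.sign_permCongr]
      simp [A, Equiv.permCongr_apply]
    rw [Finset.mul_sum]
    simp only [← mul_assoc, wedge_eq_sum_perm, Finset.sum_mul]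
    rw [Finset.sum_comm]
    simp only [mul_assoc] at hσ ⊢
    rw [Finset.sum_congr rfl fun σ _ => hσ σ]
    rw [Finset.sum_const, Finset.card_univ, Fintype.card_perm]
    simp
  have hA : ∑ f : Fin (p + q) → Fin 7, A f * η (fun k => e (f k))
      = ∑ f : Fin p → Fin 7, ∑ h : Fin q → Fin 7,
        α (fun k => e (f k)) * β (fun k => e (h k)) *
          η (Fin.append (fun k => e (f k)) (fun k => e (h k))) := by
    rw [← Fintype.sum_prod_type', ← (Fin.appendEquiv p q).sum_comp]
    refine Finset.sum_congr rfl fun f _ => ?_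
    have : (fun k => e (Fin.append f.1 f.2 k))
        = Fin.append (fun k => e (f.1 k)) (fun k => e (f.2 k)) := by
      funext k
      refine Fin.addCases (fun l => ?_) (fun l => ?_) k <;> simp
    simp [A, this]
  rw [← hA, formInner]
  field_simp
  linear_combination key

/-- Wedging with `flat v` is adjoint to the interior product with `v`. -/
theorem formInner_flat_wedge {q : ℕ} (v : V) (β : V [⋀^Fin q]→ₗ[ℝ] ℝ)
    (η : V [⋀^Fin (q + 1)]→ₗ[ℝ] ℝ) :
    formInner e (wedge (flat v) β) (η.domDomCongr (finCongr (Nat.add_comm q 1)))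
      = formInner e β (interiorProd v η) := by
  rw [formInner_wedge, formInner]
  have h1 : ∀ (f : Fin 1 → Fin 7) (h : Fin q → Fin 7),
      η.domDomCongr (finCongr (Nat.add_comm q 1))
        (Fin.append (fun k => e (f k)) (fun k => e (h k)))
      = interiorProd (e (f 0)) η (fun k => e (h k)) := by
    intro f h
    rw [AlternatingMap.domDomCongr_apply, Fin.append_left_eq_cons]
    rfl
  simp only [h1, Nat.factorial_one, Nat.cast_one, one_mul]
  congr 1
  rw [Finset.sum_comm]
  refine Finset.sum_congr rfl fun h _ => ?_
  rw [← (Equiv.funUnique (Fin 1) (Fin 7)).symm.sum_comp]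
  have h2 : interiorProd v η = ∑ i, inner ℝ (e i) v • interiorProd (e i) η := by
    conv_lhs => rw [← e.sum_repr' v]
    simp only [interiorProd, map_sum, map_smul]
  rw [h2, form_sum_apply, Finset.mul_sum]
  refine Finset.sum_congr rfl fun i _ => ?_
  simp [flat, real_inner_comm v]
  ring

/-- Each of the `p + 1` positions of the distinguished argument gives the same contribution: the
sign of the position cancels against the one from moving that argument of `η` to the front. The
factor `p + 1` is absorbed by the factorials. -/
theorem formInner_alternatizeUncurryFin {p : ℕ} (F : V →ₗ[ℝ] V [⋀^Fin p]→ₗ[ℝ] ℝ)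
    (η : V [⋀^Fin (p + 1)]→ₗ[ℝ] ℝ) :
    formInner e (AlternatingMap.alternatizeUncurryFin F) η
      = ∑ i, formInner e (F (e i)) (interiorProd (e i) η) := by
  have hk : ∀ k : Fin (p + 1), ∑ f : Fin (p + 1) → Fin 7,
      (-1 : ℝ) ^ (k : ℕ) * F (e (f k)) (k.removeNth fun l => e (f l)) * η (fun l => e (f l))
      = ∑ i, ∑ g : Fin p → Fin 7, F (e i) (fun l => e (g l))
          * interiorProd (e i) η (fun l => e (g l)) := by
    intro k
    rw [← (Fin.insertNthEquiv (fun _ => Fin 7) k).sum_comp, Fintype.sum_prod_type]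
    refine Finset.sum_congr rfl fun i _ => Finset.sum_congr rfl fun g _ => ?_
    have h1 : (fun l => e (Fin.insertNthEquiv (fun _ => Fin 7) k (i, g) l))
        = k.insertNth (e i) (fun l => e (g l)) := by
      funext l
      refine Fin.succAboveCases k ?_ (fun l => ?_) l <;> simp
    rw [h1, AlternatingMap.map_insertNth]
    have h3 : ((-1 : ℝ) ^ (k : ℕ)) * (-1) ^ (k : ℕ) = 1 := by
      rw [← mul_pow]; simp
    simp only [Fin.insertNthEquiv_apply, Fin.insertNth_apply_same, Fin.removeNth_insertNth,
      zsmul_eq_mul, Int.cast_pow, Int.cast_neg, Int.cast_one]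
    have h4 : η (Matrix.vecCons (e i) fun l => e (g l))
      = interiorProd (e i) η (fun l => e (g l)) := rfl
    rw [h4]
    linear_combination (F (e i) (fun l => e (g l))
          * interiorProd (e i) η (fun l => e (g l))) * h3
  have hp : ((p + 1).factorial : ℝ) ≠ 0 := by positivity
  have hp' : (p.factorial : ℝ) ≠ 0 := by positivity
  simp only [formInner, ← Finset.mul_sum]
  simp only [AlternatingMap.alternatizeUncurryFin_apply, Finset.sum_mul, zsmul_eq_mul,
    Int.cast_pow, Int.cast_neg, Int.cast_one]
  rw [Finset.sum_comm, Finset.sum_congr rfl fun k _ => hk k, Finset.sum_const, Finset.card_univ,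
    Fintype.card_fin, Nat.factorial_succ]
  push_cast
  rw [nsmul_eq_mul]
  push_cast
  field_simp

/-- Both sides have the same pairing with every `η`. The right-hand side is a sum over the position
of a single argument, which yields the cofactor expansions in low degree. -/
theorem flat_wedge_eq (e : OrthonormalBasis (Fin 7) ℝ V) {q : ℕ} (v : V) (β : V [⋀^Fin q]→ₗ[ℝ] ℝ) :
    wedge (flat v) β = (AlternatingMap.alternatizeUncurryFin
      ((innerₛₗ ℝ v).smulRight β)).domDomCongr (finCongr (Nat.add_comm q 1)) := by
  refine form_ext_formInner e fun η => ?_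
  obtain ⟨η, rfl⟩ : ∃ η' : V [⋀^Fin (q + 1)]→ₗ[ℝ] ℝ,
      η = η'.domDomCongr (finCongr (Nat.add_comm q 1)) :=
    ⟨η.domDomCongr (finCongr (Nat.add_comm 1 q)), by ext; rfl⟩
  have h : ∀ α : V [⋀^Fin (q + 1)]→ₗ[ℝ] ℝ,
      formInner e (α.domDomCongr (finCongr (Nat.add_comm q 1)))
        (η.domDomCongr (finCongr (Nat.add_comm q 1))) = formInner e α η := by
    intro α
    simp only [formInner, Nat.add_comm 1 q]
    congr 1
    rw [← (Equiv.arrowCongr (finCongr (Nat.add_comm q 1)) (Equiv.refl (Fin 7))).sum_comp]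
    rfl
  rw [formInner_flat_wedge, h, formInner_alternatizeUncurryFin]
  have h2 : interiorProd v η = ∑ i, inner ℝ (e i) v • interiorProd (e i) η := by
    conv_lhs => rw [← e.sum_repr' v]
    simp only [interiorProd, map_sum, map_smul]
  rw [h2, ← formPairing_apply, map_sum]
  refine Finset.sum_congr rfl fun i _ => ?_
  rw [map_smul, ← formPairing_apply, LinearMap.smulRight_apply, map_smul, LinearMap.smul_apply,
    innerₛₗ_apply_apply, real_inner_comm]

end Pairing

/-! ### The Hodge star in dimension seven -/

section Hodge

variable {V : Type*} [NormedAddCommGroup V] [InnerProductSpace ℝ V]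
variable (e : OrthonormalBasis (Fin 7) ℝ V)

theorem insertFirst_apply {n p q : ℕ} (h : p + q = n) (w : Fin p → V) (η : V [⋀^Fin n]→ₗ[ℝ] ℝ)
    (v : Fin q → V) :
    insertFirst h w η v = η (fun k => Fin.append w v (Fin.cast h.symm k)) := rfl

theorem interiorProd_apply {p : ℕ} (v : V) (α : V [⋀^Fin (p + 1)]→ₗ[ℝ] ℝ) (w : Fin p → V) :
    interiorProd v α w = α (Matrix.vecCons v w) := rfl

/-- Cyclic rotations of seven arguments are even, so two blocks of arguments may be interchanged. -/
theorem insertFirst_swap {p q : ℕ} (h : p + q = 7) (h' : q + p = 7) (w : Fin p → V)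
    (v : Fin q → V) (η : V [⋀^Fin 7]→ₗ[ℝ] ℝ) :
    insertFirst h w η v = insertFirst h' v η w := by
  have hs : ∀ c : Fin 7, Equiv.Perm.sign (Equiv.addRight c) = 1 := by decide +kernel
  have h1 := η.map_perm (fun k => Fin.append v w (Fin.cast h'.symm k)) (Equiv.addRight (Fin.ofNat 7 q))
  rw [hs, one_smul] at h1
  rw [insertFirst_apply, insertFirst_apply, ← h1]
  congr 1
  funext k
  have hk : ((k + Fin.ofNat 7 q : Fin 7) : ℕ) = (k + q) % 7 := by
    rw [Fin.val_add, Fin.val_ofNat]; omega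
  have := k.2
  by_cases hkp : (k : ℕ) < p
  · have e1 : Fin.cast h.symm k = Fin.castAdd q ⟨k, hkp⟩ := rfl
    have e2 : Fin.cast h'.symm (k + Fin.ofNat 7 q) = Fin.natAdd q ⟨k, hkp⟩ := by
      ext; simp only [Fin.val_cast, Fin.val_natAdd, hk]; omega
    simp only [Function.comp_apply, Equiv.coe_addRight]
    rw [e1, e2, Fin.append_left, Fin.append_right]
  · have hkq : (k : ℕ) - p < q := by omega
    have e1 : Fin.cast h.symm k = Fin.natAdd p ⟨k - p, hkq⟩ := by
      ext; simp only [Fin.val_cast, Fin.val_natAdd]; omega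
    have e2 : Fin.cast h'.symm (k + Fin.ofNat 7 q) = Fin.castAdd p ⟨k - p, hkq⟩ := by
      ext; simp only [Fin.val_cast, Fin.val_castAdd, hk]; omega
    simp only [Function.comp_apply, Equiv.coe_addRight]
    rw [e1, e2, Fin.append_left, Fin.append_right]

theorem hodge_apply {p q : ℕ} (h : p + q = 7) (α : V [⋀^Fin p]→ₗ[ℝ] ℝ) (v : Fin q → V) :
    hodge e h α v = (p.factorial : ℝ)⁻¹ * ∑ f : Fin p → Fin 7,
      α (fun k => e (f k)) * insertFirst h (fun k => e (f k)) e.toBasis.det v := by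
  rw [hodge, AlternatingMap.smul_apply, form_sum_apply]
  rfl

/-- Exchanging the two blocks of arguments of `Vol` costs no sign in dimension seven. In this form
the star involves only the inner product and the volume form. -/
theorem hodge_apply_eq_formInner {p q : ℕ} (h : p + q = 7) (h' : q + p = 7)
    (α : V [⋀^Fin p]→ₗ[ℝ] ℝ) (v : Fin q → V) :
    hodge e h α v = formInner e α (insertFirst h' v e.toBasis.det) := by
  simp only [hodge_apply, formInner, insertFirst_swap h h']

/-- The star is symmetric because the blocks of `Vol` commute without sign. -/
theorem formInner_hodge_left {p q : ℕ} (h : p + q = 7) (h' : q + p = 7)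
    (α : V [⋀^Fin p]→ₗ[ℝ] ℝ) (β : V [⋀^Fin q]→ₗ[ℝ] ℝ) :
    formInner e (hodge e h α) β = formInner e α (hodge e h' β) := by
  simp only [formInner, hodge_apply, Finset.mul_sum, Finset.sum_mul, insertFirst_swap h h']
  rw [Finset.sum_comm]
  refine Finset.sum_congr rfl fun f _ => Finset.sum_congr rfl fun g _ => ?_
  ring

theorem exists_complement {p q : ℕ} (h : p + q = 7) (i : Fin p → Fin 7)
    (hi : Function.Injective i) : ∃ j : Fin q → Fin 7, Function.Bijective (Sum.elim i j) := by
  classical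
  have hc : Fintype.card ((Set.range i)ᶜ : Set (Fin 7)) = q := by
    rw [Fintype.card_compl_set, Set.card_range_of_injective hi]
    simp; omega
  let ε := Fintype.equivFinOfCardEq hc
  refine ⟨fun k => (ε.symm k : Fin 7), ?_⟩
  refine (Fintype.bijective_iff_injective_and_card _).2 ⟨?_, by simp [h]⟩
  refine hi.sumElim (Subtype.val_injective.comp ε.symm.injective) fun a b hab => ?_
  exact (ε.symm b).2 ⟨a, hab⟩

/-- Complementary indices together form a permutation, so the determinant is a sign. -/
theorem det_append_sq {p q : ℕ} (h : p + q = 7) (i : Fin p → Fin 7) (j : Fin q → Fin 7)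
    (hij : Function.Bijective (Sum.elim i j)) :
    insertFirst h (fun k => e (i k)) e.toBasis.det (fun k => e (j k)) *
      insertFirst h (fun k => e (i k)) e.toBasis.det (fun k => e (j k)) = 1 := by
  let σ : Equiv.Perm (Fin 7) :=
    ((finCongr h.symm).trans finSumFinEquiv.symm).trans (Equiv.ofBijective _ hij)
  have h1 : (fun k => Fin.append (fun k => e (i k)) (fun k => e (j k)) (Fin.cast h.symm k))
      = e.toBasis ∘ σ := by
    funext k
    have : ∀ l : Fin (p + q), Fin.append (fun k => e (i k)) (fun k => e (j k)) l
        = e (Sum.elim i j (finSumFinEquiv.symm l)) := by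
      intro l
      refine Fin.addCases (fun l => ?_) (fun l => ?_) l <;> simp
    rw [this]
    simp [σ]
  rw [insertFirst_apply, h1, AlternatingMap.map_perm, Module.Basis.det_self]
  rcases Int.units_eq_one_or (Equiv.Perm.sign σ) with h | h <;> simp [h]

/-- The volume form vanishes on a tuple that repeats an index, so only rearrangements of the
complement `i` of `j` survive. There are `p!` of them with equal contributions. -/
theorem formInner_insertFirst_det {p q : ℕ} (h : p + q = 7) (h' : q + p = 7)
    (α : V [⋀^Fin p]→ₗ[ℝ] ℝ) (i : Fin p → Fin 7) (j : Fin q → Fin 7)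
    (hij : Function.Bijective (Sum.elim i j)) :
    formInner e α (insertFirst h' (fun k => e (j k)) e.toBasis.det)
      = α (fun k => e (i k)) *
        insertFirst h (fun k => e (i k)) e.toBasis.det (fun k => e (j k)) := by
  rw [insertFirst_swap h h', formInner]
  set η := insertFirst h' (fun k => e (j k)) e.toBasis.det
  have hi : Function.Injective i := fun a b hab =>
    Sum.inl_injective (hij.1 (by simpa using hab))
  have hsum := Fintype.sum_of_injective (fun τ : Equiv.Perm (Fin p) => i ∘ τ)
    (fun τ τ' hτ => Equiv.ext fun k => hi (congrFun hτ k))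
    (fun _ => α (fun k => e (i k)) * η (fun k => e (i k)))
    (fun f : Fin p → Fin 7 => α (fun k => e (f k)) * η (fun k => e (f k))) ?_ ?_
  · rw [← hsum, Finset.sum_const, Finset.card_univ, Fintype.card_perm, Fintype.card_fin,
      nsmul_eq_mul, inv_mul_cancel_left₀ (by positivity)]
  · intro f hf
    by_contra hne
    have hη : η (fun k => e (f k)) ≠ 0 := right_ne_zero_of_mul hne
    have hfinj : Function.Injective f := by
      by_contra hni
      rw [Function.not_injective_iff] at hni
      obtain ⟨a, b, hab, hne'⟩ := hni
      exact hη (η.map_eq_zero_of_eq _ (by rw [hab]) hne')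
    have hdisj : ∀ a, ∃ b, i b = f a := by
      intro a
      obtain ⟨c, hc⟩ := hij.2 (f a)
      rcases c with b | b
      · exact ⟨b, hc⟩
      · exfalso
        apply hη
        change insertFirst h' (fun k => e (j k)) e.toBasis.det _ = 0
        rw [insertFirst_apply]
        refine AlternatingMap.map_eq_zero_of_eq _ _
          (i := Fin.cast h' (Fin.castAdd p b)) (j := Fin.cast h' (Fin.natAdd q a)) ?_ ?_
        · have hc' : j b = f a := hc
          simp [hc']
        · intro hh
          have := congrArg Fin.val hh
          simp at this
          omega
    choose τ hτ using hdisj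
    have hτi : Function.Injective τ := fun a b hab => hfinj (by rw [← hτ a, ← hτ b, hab])
    exact hf ⟨Equiv.ofBijective τ (Finite.injective_iff_bijective.1 hτi), funext hτ⟩
  · intro τ
    have h1 := α.map_perm (fun k => e (i k)) τ
    have h2 := η.map_perm (fun k => e (i k)) τ
    simp only [Function.comp_def] at h1 h2 ⊢
    rw [h1, h2]
    rcases Int.units_eq_one_or (Equiv.Perm.sign τ) with h | h <;> simp [h]

/-- On a basis tuple two applications multiply by the square of the sign of the tuple followed by
its complement. No further sign appears, as `p (7 - p)` is even. -/
theorem hodge_hodge {p q : ℕ} (h : p + q = 7) (h' : q + p = 7) (α : V [⋀^Fin p]→ₗ[ℝ] ℝ) :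
    hodge e h' (hodge e h α) = α := by
  refine e.toBasis.ext_alternating fun i hi => ?_
  simp only [OrthonormalBasis.coe_toBasis]
  obtain ⟨j, hij⟩ := exists_complement h i hi
  have hji : Function.Bijective (Sum.elim j i) := by
    have : Sum.elim j i = Sum.elim i j ∘ Equiv.sumComm _ _ := by
      funext k; rcases k with k | k <;> rfl
    rw [this]
    exact hij.comp (Equiv.bijective _)
  rw [hodge_apply_eq_formInner e h' h, formInner_insertFirst_det e h' h _ j i hji,
    hodge_apply_eq_formInner e h h', formInner_insertFirst_det e h h' _ i j hij,
    insertFirst_swap h' h, mul_assoc, det_append_sq e h i j hij, mul_one]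

theorem formInner_hodge_hodge {p q : ℕ} (h : p + q = 7) (α β : V [⋀^Fin p]→ₗ[ℝ] ℝ) :
    formInner e (hodge e h α) (hodge e h β) = formInner e α β := by
  rw [formInner_hodge_left e h (by omega), hodge_hodge]

/-- The pairing does not depend on the orthonormal basis, and equally oriented orthonormal bases
have the same determinant. -/
theorem hodge_eq_of_orientation_eq (e' : OrthonormalBasis (Fin 7) ℝ V)
    (ho : e.toBasis.orientation = e'.toBasis.orientation) {p q : ℕ} (h : p + q = 7)
    (α : V [⋀^Fin p]→ₗ[ℝ] ℝ) : hodge e h α = hodge e' h α := by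
  ext v
  rw [hodge_apply_eq_formInner e h (by omega), hodge_apply_eq_formInner e' h (by omega),
    OrthonormalBasis.same_orientation_iff_det_eq_det.2 ho, formInner_basis_independent]

/-- In a concrete degree `1 + q` and `q + 1` are the same numeral by computation, so the reindexing
in `formInner_flat_wedge` disappears. -/
theorem formInner_flat_wedge_three (v : V) (β : V [⋀^Fin 3]→ₗ[ℝ] ℝ) (η : V [⋀^Fin 4]→ₗ[ℝ] ℝ) :
    formInner e (wedge (flat v) β) η = formInner e β (interiorProd v η) :=
  formInner_flat_wedge e v β η

theorem formInner_flat_wedge_four (v : V) (β : V [⋀^Fin 4]→ₗ[ℝ] ℝ) (η : V [⋀^Fin 5]→ₗ[ℝ] ℝ) :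
    formInner e (wedge (flat v) β) η = formInner e β (interiorProd v η) :=
  formInner_flat_wedge e v β η

theorem formInner_flat_wedge_two (v : V) (β : V [⋀^Fin 2]→ₗ[ℝ] ℝ) (η : V [⋀^Fin 3]→ₗ[ℝ] ℝ) :
    formInner e (wedge (flat v) β) η = formInner e β (interiorProd v η) :=
  formInner_flat_wedge e v β η

theorem formInner_flat_wedge_one (v : V) (β : V [⋀^Fin 1]→ₗ[ℝ] ℝ) (η : V [⋀^Fin 2]→ₗ[ℝ] ℝ) :
    formInner e (wedge (flat v) β) η = formInner e β (interiorProd v η) :=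
  formInner_flat_wedge e v β η

/-- `⋆(⋆β ∧ η)` for a four-form `β` and a three-form `η`. -/
theorem hodge_hodge_wedge_three (h₁ : 3 + 3 + 1 = 7) (h₂ : 4 + 3 = 7)
    (β : V [⋀^Fin 4]→ₗ[ℝ] ℝ) (η : V [⋀^Fin 3]→ₗ[ℝ] ℝ) (v : V) :
    hodge e (p := 3 + 3) (q := 1) h₁ (wedge (hodge e (q := 3) h₂ β) η) (fun _ => v)
      = - formInner e β (wedge (flat v) η) := by
  set α : V [⋀^Fin 3]→ₗ[ℝ] ℝ := hodge e (q := 3) h₂ β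
  have hβ : β = hodge e (q := 4) (by norm_num) α := (hodge_hodge e _ _ β).symm
  rw [hβ, formInner_hodge_left e _ (by norm_num), formInner_comm,
    hodge_apply_eq_formInner e _ (by norm_num), formInner_wedge]
  -- Source of the minus sign: `v` passes three arguments of the volume form.
  have h1 : ∀ (f h : Fin 3 → V), insertFirst (p := 1) (q := 3 + 3) (by norm_num) (fun _ => v)
      e.toBasis.det (Fin.append f h)
      = - insertFirst (p := 3) (q := 4) (by norm_num) f e.toBasis.det (Matrix.vecCons v h) := by
    intro f h
    rw [insertFirst_apply, insertFirst_apply]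
    have := e.toBasis.det.map_insertNth 3 v (Fin.append f h)
    have h2 : (fun k => Fin.append f (Matrix.vecCons v h) (Fin.cast (by norm_num) k))
      = Fin.insertNth (n := 6) (α := fun _ => V) 3 v (Fin.append f h) := by
      funext k; fin_cases k <;> rfl
    have h3 : (fun k => Fin.append (fun _ : Fin 1 => v) (Fin.append f h) (Fin.cast (by norm_num) k))
      = Matrix.vecCons v (Fin.append f h) := by
      funext k; fin_cases k <;> rfl
    rw [h2, h3, this]
    norm_num [show ((3 : Fin 7) : ℕ) = 3 from rfl]
  have h4 : ∀ f : Fin 3 → Fin 7, hodge e (q := 3) (by norm_num) (wedge (flat v) η)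
      (fun k => e (f k)) = formInner e η (interiorProd v
        (insertFirst (p := 3) (q := 4) (by norm_num) (fun k => e (f k)) e.toBasis.det)) := by
    intro f
    rw [hodge_apply_eq_formInner e _ (by norm_num)]
    exact formInner_flat_wedge_three e v η _
  simp only [h1]
  rw [formInner_comm]
  simp only [formInner, h4, Finset.mul_sum, ← Finset.sum_neg_distrib]
  refine Finset.sum_congr rfl fun f _ => Finset.sum_congr rfl fun h _ => ?_
  rw [show interiorProd v (insertFirst (p := 3) (q := 4) (by norm_num) (fun k => e (f k))
    e.toBasis.det) (fun k => e (h k)) = insertFirst (p := 3) (q := 4) (by norm_num)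
      (fun k => e (f k)) e.toBasis.det (Matrix.vecCons v (fun k => e (h k))) from rfl, mul_inv]
  ring

theorem hodge_flat_wedge_four (v : V) (η : V [⋀^Fin 4]→ₗ[ℝ] ℝ) (f : Fin 2 → Fin 7) :
    hodge e (q := 2) (by norm_num) (wedge (flat v) η) (fun k => e (f k)) =
      formInner e η (interiorProd v
        (insertFirst (p := 2) (q := 5) (by norm_num) (fun k => e (f k)) e.toBasis.det)) := by
  rw [hodge_apply_eq_formInner e _ (by norm_num)]
  exact formInner_flat_wedge_four e v η _

/-- Here `v` passes two arguments, so the five-form analogue of the preceding formula has no minus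
sign. -/
theorem insertFirst_move_two (v : V) (f : Fin 2 → V) (h : Fin 4 → V) :
    insertFirst (p := 1) (q := 2 + 4) (by norm_num) (fun _ => v) e.toBasis.det (Fin.append f h)
      = insertFirst (p := 2) (q := 5) (by norm_num) f e.toBasis.det (Matrix.vecCons v h) := by
  rw [insertFirst_apply, insertFirst_apply]
  have := e.toBasis.det.map_insertNth 2 v (Fin.append f h)
  have h2 : (fun k => Fin.append f (Matrix.vecCons v h) (Fin.cast (by norm_num) k))
    = Fin.insertNth (n := 6) (α := fun _ => V) 2 v (Fin.append f h) := by
    funext k; fin_cases k <;> rfl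
  have h3 : (fun k => Fin.append (fun _ : Fin 1 => v) (Fin.append f h) (Fin.cast (by norm_num) k))
    = Matrix.vecCons v (Fin.append f h) := by
    funext k; fin_cases k <;> rfl
  rw [h2, h3, this]
  norm_num [show ((2 : Fin 7) : ℕ) = 2 from rfl]

/-- `⋆(⋆γ ∧ η)` for a five-form `γ` and a four-form `η`. -/
theorem hodge_hodge_wedge_four (h₁ : 2 + 4 + 1 = 7) (h₂ : 5 + 2 = 7)
    (γ : V [⋀^Fin 5]→ₗ[ℝ] ℝ) (η : V [⋀^Fin 4]→ₗ[ℝ] ℝ) (v : V) :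
    hodge e (p := 2 + 4) (q := 1) h₁ (wedge (hodge e (q := 2) h₂ γ) η) (fun _ => v)
      = formInner e γ (wedge (flat v) η) := by
  set α : V [⋀^Fin 2]→ₗ[ℝ] ℝ := hodge e (q := 2) h₂ γ
  have hγ : γ = hodge e (q := 5) (by norm_num) α := (hodge_hodge e _ _ γ).symm
  rw [hγ, formInner_hodge_left e _ (by norm_num), formInner_comm,
    hodge_apply_eq_formInner e _ (by norm_num), formInner_wedge]
  have h1 := insertFirst_move_two e v
  have h4 := hodge_flat_wedge_four e v η
  simp only [h1]
  rw [formInner_comm]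
  generalize hodge e (p := 1 + 4) (q := 2) (by norm_num) (wedge (flat v) η) = δ at h4 ⊢
  simp only [formInner, h4, Finset.mul_sum]
  refine Finset.sum_congr rfl fun f _ => Finset.sum_congr rfl fun h _ => ?_
  rw [interiorProd_apply, mul_inv]
  generalize ((Nat.factorial 2 : ℕ) : ℝ)⁻¹ = a
  generalize ((Nat.factorial 4 : ℕ) : ℝ)⁻¹ = b
  ring

end Hodge

/-! ### The structure constants of a Cayley basis -/

section Constants

/-- The structure constants `φ(eᵢ, eⱼ, eₖ)` of a Cayley basis. -/
def epsInt (i j k : Fin 7) : ℤ :=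
  if (j - i = 1 ∧ k - i = 3) ∨ (j - i = 2 ∧ k - i = 6) ∨ (j - i = 4 ∧ k - i = 5) then 1
  else if (k - i = 1 ∧ j - i = 3) ∨ (k - i = 2 ∧ j - i = 6) ∨ (k - i = 4 ∧ j - i = 5) then -1
  else 0

/-- The components `(⋆φ)(eᵢ, eⱼ, eₖ, eₗ)` in a Cayley basis. -/
def psiInt (i j k l : Fin 7) : ℤ :=
  (if i = k ∧ j = l then 1 else 0) - (if i = l ∧ j = k then 1 else 0)
    - ∑ a, epsInt i j a * epsInt k l a

/-- The sign of a map of `Fin 7` to itself, zero if it is not a permutation. -/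
def signInt (g : Fin 7 → Fin 7) : ℤ :=
  ∏ j, ∏ i ∈ Finset.Iio j, if g i < g j then 1 else if g j < g i then -1 else 0

theorem epsInt_swap : ∀ i j k : Fin 7, epsInt i j k = - epsInt j i k := by decide +kernel

theorem epsInt_rotate : ∀ i j k : Fin 7, epsInt i j k = epsInt j k i := by decide +kernel

theorem epsInt_shift (c i j k : Fin 7) : epsInt (i + c) (j + c) (k + c) = epsInt i j k := by
  simp only [epsInt, add_sub_add_right_eq_sub]

/-- Each point of the Fano plane lies on three lines, whose remaining two points can be ordered in
two ways; two distinct points determine the third point of their line, so the off-diagonal terms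
vanish. -/
theorem sum_epsInt_mul_epsInt : ∀ i j : Fin 7,
    ∑ a, ∑ b, epsInt a b i * epsInt a b j = if i = j then 6 else 0 := by decide +kernel

theorem psiInt_shift (c i j k l : Fin 7) :
    psiInt (i + c) (j + c) (k + c) (l + c) = psiInt i j k l := by
  unfold psiInt
  rw [← Equiv.sum_comp (Equiv.addRight c)]
  simp only [Equiv.coe_addRight, epsInt_shift, add_left_inj]

theorem psiInt_swap_left (i j k l : Fin 7) : psiInt i j k l = - psiInt j i k l := by
  simp only [psiInt, epsInt_swap i j, neg_mul, Finset.sum_neg_distrib, and_comm (a := j = k),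
    and_comm (a := j = l)]
  ring

theorem psiInt_swap_right (i j k l : Fin 7) : psiInt i j k l = - psiInt i j l k := by
  simp only [psiInt, epsInt_swap k l, mul_neg, Finset.sum_neg_distrib]
  ring

/-- This is the antisymmetry that the definition of `psiInt` does not show. Cyclic invariance
reduces the finite check to `i = 0`. -/
theorem psiInt_swap_mid (i j k l : Fin 7) : psiInt i j k l = - psiInt i k j l := by
  have h : ∀ j k l : Fin 7, psiInt 0 j k l = - psiInt 0 k j l := by decide +kernel
  rw [← psiInt_shift (-i), ← psiInt_shift (-i) i k, add_neg_cancel]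
  exact h _ _ _

/-- The identity `A_v · φ = 3 v ⌟ ⋆φ` in components, for `v = e_m`. Increasing indices suffice,
since both sides are alternating forms. -/
theorem sum_epsInt_three : ∀ i m j k : Fin 7, i < j → j < k →
    ∑ c, (epsInt i m c * epsInt c j k + epsInt j m c * epsInt i c k + epsInt k m c * epsInt i j c)
      = 3 * psiInt m i j k := by decide +kernel

/-- The identity `A_v · ⋆φ = -3 v* ∧ φ` in components, for `v = e_m`. -/
theorem sum_epsInt_psiInt : ∀ m i j k l : Fin 7, i < j → j < k → k < l →
    ∑ c, (epsInt i m c * psiInt c j k l + epsInt j m c * psiInt i c k l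
      + epsInt k m c * psiInt i j c l + epsInt l m c * psiInt i j k c)
    = -3 * ((if m = i then 1 else 0) * epsInt j k l - (if m = j then 1 else 0) * epsInt i k l
      + (if m = k then 1 else 0) * epsInt i j l - (if m = l then 1 else 0) * epsInt i j k) := by
  decide +kernel

/-- The left-hand side is the Hodge star of the seven monomials of `φ`. This connects the
contraction formula that defines `psiInt` with the actual four-form `⋆φ`. -/
theorem sum_signInt : ∀ i j k l : Fin 7, i < j → j < k → k < l →
    ∑ t, signInt ![i, j, k, l, t, t + 1, t + 3] = psiInt i j k l := by decide +kernel

/-- A totally antisymmetric function of four indices vanishes if it vanishes on increasing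
indices. -/
theorem eq_zero_of_antisymm {F : Fin 7 → Fin 7 → Fin 7 → Fin 7 → ℝ}
    (h₁ : ∀ i j k l, F i j k l = - F j i k l) (h₂ : ∀ i j k l, F i j k l = - F i k j l)
    (h₃ : ∀ i j k l, F i j k l = - F i j l k)
    (h : ∀ i j k l, i < j → j < k → k < l → F i j k l = 0) (i j k l : Fin 7) : F i j k l = 0 := by
  -- Insertion sort: the last index is moved left by transpositions, and two equal neighbours force
  -- the value to vanish.
  have s₃ : ∀ i j k l, i < j → j < k → F i j k l = 0 := by
    intro i j k l hij hjk
    rcases lt_trichotomy k l with hl | rfl | hl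
    · exact h _ _ _ _ hij hjk hl
    · linarith [h₃ i j k k]
    rw [h₃, neg_eq_zero]
    rcases lt_trichotomy j l with hl' | rfl | hl'
    · exact h _ _ _ _ hij hl' hl
    · linarith [h₂ i j j k]
    rw [h₂, neg_eq_zero]
    rcases lt_trichotomy i l with hl'' | rfl | hl''
    · exact h _ _ _ _ hl'' hl' hjk
    · linarith [h₁ i i j k]
    rw [h₁, neg_eq_zero]
    exact h _ _ _ _ hl'' hij hjk
  have s₂ : ∀ i j k l, i < j → F i j k l = 0 := by
    intro i j k l hij
    rcases lt_trichotomy j k with hk | rfl | hk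
    · exact s₃ _ _ _ _ hij hk
    · linarith [h₂ i j j l]
    rw [h₂, neg_eq_zero]
    rcases lt_trichotomy i k with hk' | rfl | hk'
    · exact s₃ _ _ _ _ hk' hk
    · linarith [h₁ i i j l]
    rw [h₁, neg_eq_zero]
    exact s₃ _ _ _ _ hk' hij
  rcases lt_trichotomy i j with hj | rfl | hj
  · exact s₂ _ _ _ _ hj
  · linarith [h₁ i i k l]
  rw [h₁, neg_eq_zero]
  exact s₂ _ _ _ _ hj

end Constants

/-! ### Components of `φ`, `⋆φ` and the volume form in a Cayley basis -/

section Components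

variable {V : Type*} [NormedAddCommGroup V] [InnerProductSpace ℝ V]
variable (e : OrthonormalBasis (Fin 7) ℝ V)

theorem inner_basis (i j : Fin 7) : inner ℝ (e i) (e j) = if i = j then (1 : ℝ) else 0 :=
  orthonormal_iff_ite.1 e.orthonormal i j

/-- Alternating forms that agree on increasing tuples of basis vectors are equal. -/
theorem form_ext_strictMono {p : ℕ} {α β : V [⋀^Fin p]→ₗ[ℝ] ℝ}
    (h : ∀ f : Fin p → Fin 7, StrictMono f → α (fun k => e (f k)) = β (fun k => e (f k))) :
    α = β := by
  refine e.toBasis.ext_alternating fun f hf => ?_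
  have hs : StrictMono (f ∘ Tuple.sort f) :=
    (Tuple.monotone_sort f).strictMono_of_injective (hf.comp (Equiv.injective _))
  have h' := h _ hs
  have h1 := α.map_perm (fun k => e (f k)) (Tuple.sort f)
  have h2 := β.map_perm (fun k => e (f k)) (Tuple.sort f)
  simp only [Function.comp_def] at h' h1 h2
  rw [h1, h2] at h'
  simpa using h'

theorem interiorProd_sum {p : ℕ} (α : V [⋀^Fin (p + 1)]→ₗ[ℝ] ℝ) (v : V) :
    interiorProd v α = ∑ i, inner ℝ (e i) v • interiorProd (e i) α := by
  conv_lhs => rw [← e.sum_repr' v]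
  simp only [interiorProd, map_sum, map_smul]

theorem flat_wedge_one_apply (e : OrthonormalBasis (Fin 7) ℝ V) (v b x y : V) :
    wedge (flat v) (flat b) ![x, y]
      = inner ℝ v x * inner ℝ b y - inner ℝ v y * inner ℝ b x := by
  rw [flat_wedge_eq e, AlternatingMap.domDomCongr_apply, AlternatingMap.alternatizeUncurryFin_apply,
    Fin.sum_univ_two]
  simp [flat, Fin.removeNth]
  ring

theorem flat_wedge_two_apply (e : OrthonormalBasis (Fin 7) ℝ V) (v : V) (β : V [⋀^Fin 2]→ₗ[ℝ] ℝ)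
    (w : Fin 3 → V) :
    wedge (flat v) β w = inner ℝ v (w 0) * β ![w 1, w 2] - inner ℝ v (w 1) * β ![w 0, w 2]
      + inner ℝ v (w 2) * β ![w 0, w 1] := by
  have h0 : (Fin.removeNth 0 w : Fin 2 → V) = ![w 1, w 2] := by
    funext k; fin_cases k <;> rfl
  have h1 : (Fin.removeNth 1 w : Fin 2 → V) = ![w 0, w 2] := by
    funext k; fin_cases k <;> rfl
  have h2 : (Fin.removeNth 2 w : Fin 2 → V) = ![w 0, w 1] := by
    funext k; fin_cases k <;> rfl
  have h : wedge (flat v) β w = AlternatingMap.alternatizeUncurryFin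
      ((innerₛₗ ℝ v).smulRight β) w := by
    rw [flat_wedge_eq e]; rfl
  rw [h, AlternatingMap.alternatizeUncurryFin_apply, Fin.sum_univ_three, h0, h1, h2]
  simp
  ring

theorem flat_wedge_three_apply (e : OrthonormalBasis (Fin 7) ℝ V) (v : V)
    (β : V [⋀^Fin 3]→ₗ[ℝ] ℝ) (w : Fin 4 → V) :
    wedge (flat v) β w = inner ℝ v (w 0) * β ![w 1, w 2, w 3]
      - inner ℝ v (w 1) * β ![w 0, w 2, w 3] + inner ℝ v (w 2) * β ![w 0, w 1, w 3]
      - inner ℝ v (w 3) * β ![w 0, w 1, w 2] := by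
  have h0 : (Fin.removeNth 0 w : Fin 3 → V) = ![w 1, w 2, w 3] := by
    funext k; fin_cases k <;> rfl
  have h1 : (Fin.removeNth 1 w : Fin 3 → V) = ![w 0, w 2, w 3] := by
    funext k; fin_cases k <;> rfl
  have h2 : (Fin.removeNth 2 w : Fin 3 → V) = ![w 0, w 1, w 3] := by
    funext k; fin_cases k <;> rfl
  have h3 : (Fin.removeNth 3 w : Fin 3 → V) = ![w 0, w 1, w 2] := by
    funext k; fin_cases k <;> rfl
  have h : wedge (flat v) β w = AlternatingMap.alternatizeUncurryFin
      ((innerₛₗ ℝ v).smulRight β) w := by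
    rw [flat_wedge_eq e]; rfl
  rw [h, AlternatingMap.alternatizeUncurryFin_apply, Fin.sum_univ_four, h0, h1, h2, h3]
  simp [show (-1 : ℤ) ^ 3 = -1 by norm_num]
  ring

theorem formInner_flat (v : V) (η : V [⋀^Fin 1]→ₗ[ℝ] ℝ) :
    formInner e (flat v) η = η ![v] := by
  have h : ∀ u : V, η ![u] = interiorProd u η ![] := fun u => rfl
  rw [formInner, ← (Equiv.funUnique (Fin 1) (Fin 7)).symm.sum_comp, h, interiorProd_sum e η v,
    form_sum_apply]
  simp only [Nat.factorial_one, Nat.cast_one, inv_one, one_mul, AlternatingMap.smul_apply,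
    smul_eq_mul, ← h]
  refine Finset.sum_congr rfl fun i _ => ?_
  have h1 : (fun k => e ((Equiv.funUnique (Fin 1) (Fin 7)).symm i k)) = ![e i] := by
    funext k; fin_cases k; rfl
  rw [h1, real_inner_comm]
  rfl

/-- Peeling off one-forms by adjointness leaves an evaluation of `η`. Removing the last factor first
only rotates three arguments cyclically, which is even. -/
theorem formInner_wedge_flat_three (a b c : V) (η : V [⋀^Fin 3]→ₗ[ℝ] ℝ) :
    formInner e (wedge (wedge (flat a) (flat b)) (flat c)) η = η ![a, b, c] := by
  have h : formInner e (wedge (wedge (flat a) (flat b)) (flat c)) η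
      = formInner e (wedge (flat a) (flat b)) (interiorProd c η) := by
    rw [formInner_wedge, formInner]
    simp only [Nat.factorial_one, Nat.cast_one, mul_one]
    congr 1
    refine Finset.sum_congr rfl fun f _ => ?_
    rw [interiorProd_sum e η c, form_sum_apply, Finset.mul_sum,
      ← (Equiv.funUnique (Fin 1) (Fin 7)).symm.sum_comp]
    refine Finset.sum_congr rfl fun i _ => ?_
    have hr := η.map_perm (Matrix.vecCons (e i) fun k => e (f k)) (finRotate 3)
    have h1 : (Matrix.vecCons (e i) fun k => e (f k)) ∘ (finRotate 3) = Fin.append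
        (fun k => e (f k)) (fun k => e ((Equiv.funUnique (Fin 1) (Fin 7)).symm i k)) := by
      funext k; fin_cases k <;> rfl
    rw [h1, show Equiv.Perm.sign (finRotate 3) = 1 by decide, one_smul] at hr
    rw [hr, AlternatingMap.smul_apply, interiorProd_apply, smul_eq_mul]
    have h2 : flat c (fun k => e ((Equiv.funUnique (Fin 1) (Fin 7)).symm i k)) = inner ℝ c (e i) :=
      rfl
    rw [h2, real_inner_comm (e i) c]
    ring
  rw [h, formInner_flat_wedge_one, formInner_flat, interiorProd_apply, interiorProd_apply]
  have hr := η.map_perm ![c, a, b] (finRotate 3)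
  rw [show Equiv.Perm.sign (finRotate 3) = 1 by decide, one_smul] at hr
  rw [← hr]
  congr 1
  funext k; fin_cases k <;> rfl

theorem formInner_cayleyForm (η : V [⋀^Fin 3]→ₗ[ℝ] ℝ) :
    formInner e (cayleyForm e) η = ∑ i, η ![e i, e (i + 1), e (i + 3)] := by
  rw [cayleyForm, ← formPairing_apply, map_sum, LinearMap.sum_apply]
  simp only [formPairing_apply]
  exact Finset.sum_congr rfl fun i _ => formInner_wedge_flat_three e _ _ _ η

theorem wedge_flat_three_apply (e : OrthonormalBasis (Fin 7) ℝ V) (a b c : V) (w : Fin 3 → V) :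
    wedge (wedge (flat a) (flat b)) (flat c) w
      = inner ℝ a (w 0) * (inner ℝ b (w 1) * inner ℝ c (w 2) - inner ℝ b (w 2) * inner ℝ c (w 1))
      - inner ℝ a (w 1) * (inner ℝ b (w 0) * inner ℝ c (w 2) - inner ℝ b (w 2) * inner ℝ c (w 0))
      + inner ℝ a (w 2) * (inner ℝ b (w 0) * inner ℝ c (w 1) - inner ℝ b (w 1) * inner ℝ c (w 0))
      := by
  -- Associativity in this degree: both bracketings pair with `η` to `η ![a, b, c]`.
  have h : (wedge (wedge (flat a) (flat b)) (flat c) : V [⋀^Fin 3]→ₗ[ℝ] ℝ)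
      = wedge (flat a) (wedge (flat b) (flat c)) := by
    refine form_ext_formInner e fun η => ?_
    rw [formInner_wedge_flat_three]
    refine Eq.symm ((formInner_flat_wedge_two e a _ η).trans ?_)
    refine (formInner_flat_wedge_one e b _ _).trans ?_
    rw [formInner_flat]
    rfl
  refine (congrArg (fun α => α w) h).trans ((flat_wedge_two_apply e a _ w).trans ?_)
  rw [flat_wedge_one_apply e, flat_wedge_one_apply e, flat_wedge_one_apply e]

theorem cayleyForm_apply_basis (f : Fin 3 → Fin 7) :
    cayleyForm e (fun k => e (f k)) = (epsInt (f 0) (f 1) (f 2) : ℝ) := by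
  have h : ∀ i j k : Fin 7, ∑ t : Fin 7,
      ((if t = i then 1 else 0) * ((if t + 1 = j then 1 else 0) * (if t + 3 = k then 1 else 0)
          - (if t + 1 = k then 1 else 0) * (if t + 3 = j then 1 else 0))
      - (if t = j then 1 else 0) * ((if t + 1 = i then 1 else 0) * (if t + 3 = k then 1 else 0)
          - (if t + 1 = k then 1 else 0) * (if t + 3 = i then 1 else 0))
      + (if t = k then 1 else 0) * ((if t + 1 = i then 1 else 0) * (if t + 3 = j then 1 else 0)
          - (if t + 1 = j then 1 else 0) * (if t + 3 = i then 1 else 0)))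
      = epsInt i j k := by decide +kernel
  rw [cayleyForm, form_sum_apply, ← h]
  push_cast
  refine Finset.sum_congr rfl fun t _ => ?_
  rw [wedge_flat_three_apply e]
  simp only [inner_basis]

/-- The sign of a permutation is computed by inversions, and a repeated value makes one factor of
the product zero. This makes the determinant accessible to a finite check. -/
theorem det_apply_basis (g : Fin 7 → Fin 7) : e.toBasis.det (fun k => e (g k)) = signInt g := by
  by_cases hg : Function.Injective g
  · let σ : Equiv.Perm (Fin 7) := Equiv.ofBijective g (Finite.injective_iff_bijective.1 hg)
    have h1 : (fun k => e (g k)) = e.toBasis ∘ σ := by funext k; simp [σ]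
    have h2 : signInt g = (Equiv.Perm.sign σ : ℤ) := by
      rw [Equiv.Perm.sign_eq_prod_prod_Iio, signInt, Units.coe_prod]
      refine Finset.prod_congr rfl fun j _ => ?_
      rw [Units.coe_prod]
      refine Finset.prod_congr rfl fun i hi => ?_
      have hne : g i ≠ g j := fun h => (Finset.mem_Iio.1 hi).ne (hg h)
      change _ = ((if g i < g j then (1 : ℤˣ) else -1 : ℤˣ) : ℤ)
      by_cases hlt : g i < g j
      · simp [hlt]
      · have : g j < g i := lt_of_le_of_ne (not_lt.1 hlt) hne.symm
        simp [hlt, this]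
    rw [h1, AlternatingMap.map_perm, Module.Basis.det_self, h2]
    simp [Units.smul_def]
  · rw [Function.not_injective_iff] at hg
    obtain ⟨a, b, hab, hne⟩ := hg
    rw [AlternatingMap.map_eq_zero_of_eq _ _ (by rw [hab]) hne]
    wlog hlt : a < b generalizing a b
    · exact this b a hab.symm hne.symm (lt_of_le_of_ne (not_lt.1 hlt) hne.symm)
    rw [signInt, Finset.prod_eq_zero (Finset.mem_univ b)
      (Finset.prod_eq_zero (Finset.mem_Iio.2 hlt) (by simp [hab]))]
    simp

theorem cayleyFourForm_apply_basis (f : Fin 4 → Fin 7) :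
    cayleyFourForm e (fun k => e (f k)) = (psiInt (f 0) (f 1) (f 2) (f 3) : ℝ) := by
  -- The difference of the two sides is totally antisymmetric, so increasing indices suffice, where
  -- `sum_signInt` applies.
  let F : Fin 7 → Fin 7 → Fin 7 → Fin 7 → ℝ := fun i j k l =>
    cayleyFourForm e (fun a => e (![i, j, k, l] a)) - psiInt i j k l
  have hsw : ∀ (a b : Fin 4) (hab : a ≠ b) (g h : Fin 4 → Fin 7), h = g ∘ Equiv.swap a b →
      cayleyFourForm e (fun k => e (g k)) = - cayleyFourForm e (fun k => e (h k)) := by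
    rintro a b hab g h rfl
    have := (cayleyFourForm e).map_swap (fun k => e (g k)) hab
    simp only [Function.comp_def] at this ⊢
    rw [this, neg_neg]
  have hF : ∀ i j k l, F i j k l = 0 := by
    refine eq_zero_of_antisymm ?_ ?_ ?_ ?_
    · intro i j k l
      simp only [F, psiInt_swap_left i j]
      rw [hsw 0 1 (by decide) _ ![j, i, k, l] (by funext a; fin_cases a <;> rfl)]
      push_cast; ring
    · intro i j k l
      simp only [F, psiInt_swap_mid i j]
      rw [hsw 1 2 (by decide) _ ![i, k, j, l] (by funext a; fin_cases a <;> rfl)]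
      push_cast; ring
    · intro i j k l
      simp only [F, psiInt_swap_right i j k]
      rw [hsw 2 3 (by decide) _ ![i, j, l, k] (by funext a; fin_cases a <;> rfl)]
      push_cast; ring
    · intro i j k l hij hjk hkl
      simp only [F]
      rw [← sum_signInt i j k l hij hjk hkl, sub_eq_zero, cayleyFourForm,
        hodge_apply_eq_formInner e _ (by norm_num), formInner_cayleyForm]
      push_cast
      refine Finset.sum_congr rfl fun t _ => ?_
      rw [← det_apply_basis e, insertFirst_apply]
      congr 1
      funext a
      fin_cases a <;> rfl
  have h := hF (f 0) (f 1) (f 2) (f 3)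
  have hf : ![f 0, f 1, f 2, f 3] = f := by funext a; fin_cases a <;> rfl
  simp only [F, hf] at h
  linarith

end Components

/-! ### The action of endomorphisms on forms -/

section Action

variable {V : Type*} [AddCommGroup V] [Module ℝ V]

/-- The derivation action `(A · α)(v₁, …, vₚ) = ∑ₖ α(v₁, …, A vₖ, …, vₚ)`. -/
def derivAction {p : ℕ} (A : V →ₗ[ℝ] V) (α : V [⋀^Fin p]→ₗ[ℝ] ℝ) : V [⋀^Fin p]→ₗ[ℝ] ℝ where
  toMultilinearMap := ∑ k, α.toMultilinearMap.compLinearMap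
    (Function.update (fun _ => LinearMap.id) k A)
  map_eq_zero_of_eq' := by
    intro v i j hv hij
    have happ : ∀ k, (α.toMultilinearMap.compLinearMap
        (Function.update (fun _ => LinearMap.id) k A)) v = α (Function.update v k (A (v k))) := by
      intro k
      rw [MultilinearMap.compLinearMap_apply]
      change α _ = _
      congr 1
      funext l
      by_cases h : l = k
      · subst h; simp
      · simp [Function.update_of_ne h]
    change (∑ k, α.toMultilinearMap.compLinearMap
      (Function.update (fun _ => LinearMap.id) k A)) v = 0
    rw [sum_apply]
    simp only [happ]
    -- If `v i = v j`, all terms but those of the slots `i` and `j` vanish; these two differ by a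
    -- transposition and cancel.
    rw [Fintype.sum_eq_add i j hij]
    · rw [← hv]
      have h := α.map_swap (Function.update v i (A (v i))) hij
      have h' : Function.update v i (A (v i)) ∘ Equiv.swap i j = Function.update v j (A (v i)) := by
        funext l
        by_cases hli : l = i
        · subst hli; simp [Function.update_of_ne hij, Function.update_of_ne hij.symm, hv]
        · by_cases hlj : l = j
          · subst hlj; simp
          · simp [Equiv.swap_apply_of_ne_of_ne hli hlj, Function.update_of_ne hli,
              Function.update_of_ne hlj]
      rw [h'] at h
      rw [h, add_neg_cancel]
    · rintro k ⟨hki, hkj⟩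
      exact α.map_eq_zero_of_eq _ (by
        rw [Function.update_of_ne hki.symm, Function.update_of_ne hkj.symm, hv]) hij

theorem derivAction_apply {p : ℕ} (A : V →ₗ[ℝ] V) (α : V [⋀^Fin p]→ₗ[ℝ] ℝ) (v : Fin p → V) :
    derivAction A α v = ∑ k, α (Function.update v k (A (v k))) := by
  change (∑ k, α.toMultilinearMap.compLinearMap
      (Function.update (fun _ => LinearMap.id) k A)) v = _
  rw [sum_apply]
  refine Finset.sum_congr rfl fun k _ => ?_
  rw [MultilinearMap.compLinearMap_apply]
  change α _ = _
  congr 1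
  funext l
  by_cases h : l = k
  · subst h; simp
  · simp [Function.update_of_ne h]

/-- The derivation action as a linear map of the endomorphism. -/
def derivActionL {p : ℕ} (α : V [⋀^Fin p]→ₗ[ℝ] ℝ) : (V →ₗ[ℝ] V) →ₗ[ℝ] V [⋀^Fin p]→ₗ[ℝ] ℝ where
  toFun A := derivAction A α
  map_add' A B := by
    ext v
    simp [derivAction_apply, AlternatingMap.map_update_add, Finset.sum_add_distrib]
  map_smul' c A := by
    ext v
    simp [derivAction_apply, AlternatingMap.map_update_smul, Finset.mul_sum]

end Action

/-! ### The action of cross products on `φ` and `⋆φ` -/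

section CrossAction

variable {V : Type*} [NormedAddCommGroup V] [InnerProductSpace ℝ V]
variable (e : OrthonormalBasis (Fin 7) ℝ V)

theorem cayleyForm_apply_vec (i j k : Fin 7) :
    cayleyForm e ![e i, e j, e k] = (epsInt i j k : ℝ) := by
  rw [show ![e i, e j, e k] = fun l => e (![i, j, k] l) by funext l; fin_cases l <;> rfl,
    cayleyForm_apply_basis]
  rfl

theorem cross_apply_basis (i j : Fin 7) :
    cross e (e i) (e j) = ∑ k, (epsInt i j k : ℝ) • e k := by
  change ∑ k, cayleyForm e ![e i, e j, e k] • e k = _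
  refine Finset.sum_congr rfl fun k _ => ?_
  rw [cayleyForm_apply_vec]

theorem derivAction_crossRight_basis {p : ℕ} (α : V [⋀^Fin p]→ₗ[ℝ] ℝ) (m : Fin 7)
    (f : Fin p → Fin 7) :
    derivAction (crossRight e (e m)) α (fun k => e (f k))
      = ∑ k, ∑ c, (epsInt (f k) m c : ℝ) * α (fun l => e (Function.update f k c l)) := by
  rw [derivAction_apply]
  refine Finset.sum_congr rfl fun k _ => ?_
  rw [show crossRight e (e m) (e (f k)) = ∑ c, (epsInt (f k) m c : ℝ) • e c from
    cross_apply_basis e (f k) m, AlternatingMap.map_update_sum]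
  refine Finset.sum_congr rfl fun c _ => ?_
  rw [AlternatingMap.map_update_smul, smul_eq_mul]
  congr 2
  funext l
  by_cases h : l = k
  · subst h; simp
  · simp [Function.update_of_ne h]

theorem interiorProd_cayleyFourForm_basis (m : Fin 7) (f : Fin 3 → Fin 7) :
    interiorProd (e m) (cayleyFourForm e) (fun k => e (f k))
      = (psiInt m (f 0) (f 1) (f 2) : ℝ) := by
  obtain ⟨g, hg⟩ : ∃ g : Fin 4 → Fin 7, g = Fin.cons m f := ⟨_, rfl⟩
  have h0 : g 0 = m := by rw [hg]; rfl
  have h1 : g 1 = f 0 := by rw [hg]; rfl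
  have h2 : g 2 = f 1 := by rw [hg]; rfl
  have h3 : g 3 = f 2 := by rw [hg]; rfl
  have hc : (Matrix.vecCons (e m) (fun k => e (f k)) : Fin 4 → V) = fun l => e (g l) := by
    rw [hg]
    funext l
    refine Fin.cases rfl (fun l => rfl) l
  have h4 := cayleyFourForm_apply_basis e g
  rw [h0, h1, h2, h3] at h4
  rw [interiorProd_apply]
  exact (congrArg (cayleyFourForm e) hc).trans h4

/-- The cross product with `v` acts on `φ` as three times the interior product with `⋆φ`. -/
theorem derivAction_crossRight_cayleyForm (v : V) :
    derivAction (crossRight e v) (cayleyForm e) = (3 : ℝ) • interiorProd v (cayleyFourForm e) := by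
  -- The right-hand side as a linear map of `v`, so that basis vectors suffice.
  let R : V →ₗ[ℝ] V [⋀^Fin 3]→ₗ[ℝ] ℝ :=
    { toFun := fun u => (3 : ℝ) • interiorProd u (cayleyFourForm e)
      map_add' := fun u u' => by rw [interiorProd, map_add, smul_add]; rfl
      map_smul' := fun c u => by rw [interiorProd, map_smul, smul_comm]; rfl }
  have h : derivActionL (cayleyForm e) ∘ₗ (cross e).flip = R := by
    refine e.toBasis.ext fun m => ?_
    rw [OrthonormalBasis.coe_toBasis]
    refine form_ext_strictMono e fun f hf => ?_
    have hL : (derivActionL (cayleyForm e) ∘ₗ (cross e).flip) (e m) = derivAction (crossRight e (e m)) (cayleyForm e) := rfl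
    have hR : R (e m) = (3 : ℝ) • interiorProd (e m) (cayleyFourForm e) := rfl
    rw [hL, hR, AlternatingMap.smul_apply, smul_eq_mul]
    have hψ := interiorProd_cayleyFourForm_basis e m f
    rw [derivAction_crossRight_basis, hψ]
    have h01 : f 0 < f 1 := hf (by decide)
    have h12 : f 1 < f 2 := hf (by decide)
    have key := sum_epsInt_three (f 0) m (f 1) (f 2) h01 h12
    simp only [cayleyForm_apply_basis, Fin.sum_univ_three (M := ℝ), ← Finset.sum_add_distrib]
    refine (Eq.trans ?_ (congrArg (Int.cast : ℤ → ℝ) key)).trans (by push_cast; rfl)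
    push_cast
    refine Finset.sum_congr rfl fun c _ => ?_
    simp [Function.update]
  exact LinearMap.congr_fun h v

/-- The cross product with `v` acts on `⋆φ` as `-3` times the wedge product with `φ`. -/
theorem derivAction_crossRight_cayleyFourForm (v : V) :
    derivAction (crossRight e v) (cayleyFourForm e)
      = (-3 : ℝ) • wedge (flat v) (cayleyForm e) := by
  have hw : ∀ (u : V) (f : Fin 4 → Fin 7), wedge (flat u) (cayleyForm e) (fun k => e (f k))
      = inner ℝ u (e (f 0)) * (epsInt (f 1) (f 2) (f 3) : ℝ)
      - inner ℝ u (e (f 1)) * (epsInt (f 0) (f 2) (f 3) : ℝ)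
      + inner ℝ u (e (f 2)) * (epsInt (f 0) (f 1) (f 3) : ℝ)
      - inner ℝ u (e (f 3)) * (epsInt (f 0) (f 1) (f 2) : ℝ) := by
    intro u f
    refine (flat_wedge_three_apply e u (cayleyForm e) _).trans ?_
    simp only [cayleyForm_apply_vec]
  have h : derivActionL (cayleyFourForm e) ∘ₗ (cross e).flip
      = { toFun := fun u => (-3 : ℝ) • wedge (flat u) (cayleyForm e)
          map_add' := fun u u' => by
            refine form_ext_basis e fun f => ?_
            simp only [AlternatingMap.smul_apply, AlternatingMap.add_apply, hw, inner_add_left,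
              smul_eq_mul]
            ring
          map_smul' := fun c u => by
            refine form_ext_basis e fun f => ?_
            simp only [AlternatingMap.smul_apply, hw, real_inner_smul_left, smul_eq_mul,
              RingHom.id_apply]
            ring } := by
    refine e.toBasis.ext fun m => ?_
    rw [OrthonormalBasis.coe_toBasis]
    change derivAction (crossRight e (e m)) (cayleyFourForm e)
      = (-3 : ℝ) • wedge (flat (e m)) (cayleyForm e)
    refine form_ext_strictMono e fun f hf => ?_
    rw [derivAction_crossRight_basis, AlternatingMap.smul_apply, hw]
    have key := sum_epsInt_psiInt m (f 0) (f 1) (f 2) (f 3) (hf (by decide)) (hf (by decide))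
      (hf (by decide))
    simp only [cayleyFourForm_apply_basis, Fin.sum_univ_four (M := ℝ), ← Finset.sum_add_distrib,
      inner_basis]
    refine (Eq.trans ?_ (congrArg (Int.cast : ℤ → ℝ) key)).trans (by push_cast; rfl)
    push_cast
    refine Finset.sum_congr rfl fun c _ => ?_
    simp [Function.update]
  exact LinearMap.congr_fun h v

end CrossAction

/-! ### Endomorphisms -/

section Splitting

variable {N : Type*} [AddCommGroup N] [Module ℝ N]

/-- The choice operator returns some splitting because `c` is one, and uniqueness identifies the
two. -/
theorem component_eq {W : Fin 4 → Submodule ℝ N} {a : N} {c : Fin 4 → N}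
    (hu : ∃! c, IsSplitting W a c) (hc : IsSplitting W a c) : component W a = c :=
  hu.unique (Classical.epsilon_spec (p := IsSplitting W a) ⟨c, hc⟩) hc

theorem IsSplitting.map {N' : Type*} [AddCommGroup N'] [Module ℝ N'] {W : Fin 4 → Submodule ℝ N}
    {a : N} {c : Fin 4 → N} (hc : IsSplitting W a c) (f : N →ₗ[ℝ] N') :
    IsSplitting (fun i => (W i).map f) (f a) (fun i => f (c i)) :=
  ⟨fun i => Submodule.mem_map_of_mem (hc.1 i), by rw [← map_sum, hc.2]⟩

/-- Unique splittings are transported by injective linear maps. -/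
theorem existsUnique_isSplitting_map {N' : Type*} [AddCommGroup N'] [Module ℝ N']
    {W : Fin 4 → Submodule ℝ N} {a : N} (hu : ∃! c, IsSplitting W a c) (f : N →ₗ[ℝ] N')
    (hf : Function.Injective f) : ∃! c, IsSplitting (fun i => (W i).map f) (f a) c := by
  obtain ⟨c, hc, hcu⟩ := hu
  refine ⟨fun i => f (c i), hc.map f, fun d hd => ?_⟩
  choose d' hd' hfd using fun i => Submodule.mem_map.1 (hd.1 i)
  have h : IsSplitting W a d' := by
    refine ⟨hd', hf ?_⟩
    rw [map_sum, ← hd.2]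
    exact Finset.sum_congr rfl fun i _ => hfd i
  have h' := hcu d' h
  funext i
  rw [← hfd i, h']

end Splitting

/-! ### Splitting endomorphisms and torsion tensors along the four modules -/

section Endomorphisms

variable {V : Type*} [NormedAddCommGroup V] [InnerProductSpace ℝ V]
variable (e : OrthonormalBasis (Fin 7) ℝ V)

theorem vector_ext {u v : V} (h : ∀ i, inner ℝ (e i) u = inner ℝ (e i) v) : u = v := by
  rw [← e.sum_repr' u, ← e.sum_repr' v]
  simp only [h]

theorem end_ext {a b : V →ₗ[ℝ] V} (h : ∀ i j, entry e a i j = entry e b i j) : a = b := by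
  refine e.toBasis.ext fun j => ?_
  rw [OrthonormalBasis.coe_toBasis]
  exact vector_ext e fun i => h i j

theorem entry_add (a b : V →ₗ[ℝ] V) (i j : Fin 7) :
    entry e (a + b) i j = entry e a i j + entry e b i j := by
  simp [entry, inner_add_right]

theorem entry_sub (a b : V →ₗ[ℝ] V) (i j : Fin 7) :
    entry e (a - b) i j = entry e a i j - entry e b i j := by
  simp [entry, inner_sub_right]

theorem entry_smul (c : ℝ) (a : V →ₗ[ℝ] V) (i j : Fin 7) :
    entry e (c • a) i j = c * entry e a i j := by
  simp [entry, inner_smul_right]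

theorem entry_sum {ι : Type*} (s : Finset ι) (a : ι → V →ₗ[ℝ] V) (i j : Fin 7) :
    entry e (∑ k ∈ s, a k) i j = ∑ k ∈ s, entry e (a k) i j := by
  simp [entry, inner_sum]

theorem entry_id (i j : Fin 7) : entry e LinearMap.id i j = if i = j then 1 else 0 := by
  simp only [entry, LinearMap.id_apply, inner_basis]

theorem entry_tensor (k l i j : Fin 7) :
    entry e (tensor (e k) (e l)) i j = (if i = k then 1 else 0) * (if l = j then 1 else 0) := by
  simp only [entry, tensor, LinearMap.smulRight_apply, innerₛₗ_apply_apply, inner_smul_right,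
    inner_basis]
  ring

/-- The endomorphism with prescribed entries. -/
def endOfEntries (m : Fin 7 → Fin 7 → ℝ) : V →ₗ[ℝ] V := ∑ i, ∑ j, m i j • tensor (e i) (e j)

theorem entry_endOfEntries (m : Fin 7 → Fin 7 → ℝ) (i j : Fin 7) :
    entry e (endOfEntries e m) i j = m i j := by
  simp [endOfEntries, entry_sum, entry_smul, entry_tensor]

theorem cross_apply_eq_sum (u v : V) :
    cross e u v = ∑ k, (∑ i, ∑ j, (epsInt i j k : ℝ) * inner ℝ (e i) u * inner ℝ (e j) v) • e k := by
  conv_lhs => rw [← e.sum_repr' u, ← e.sum_repr' v]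
  simp only [map_sum, LinearMap.sum_apply, map_smul, LinearMap.smul_apply, cross_apply_basis,
    Finset.smul_sum, Finset.sum_smul, smul_smul]
  rw [Finset.sum_comm]
  refine (Finset.sum_congr rfl fun i _ => Finset.sum_comm).trans ?_
  rw [Finset.sum_comm]
  refine Finset.sum_congr rfl fun k _ => Finset.sum_congr rfl fun i _ =>
    Finset.sum_congr rfl fun j _ => ?_
  congr 1
  ring

theorem entry_crossRight (v : V) (i j : Fin 7) :
    entry e (crossRight e v) i j = ∑ k, (epsInt i j k : ℝ) * inner ℝ (e k) v := by
  rw [entry, show crossRight e v (e j) = cross e (e j) v from rfl, cross_apply_eq_sum, inner_sum]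
  simp [inner_smul_right, inner_basis]
  exact Finset.sum_congr rfl fun k _ => by rw [epsInt_rotate i j k]

theorem sum_eps_mul (x : Fin 7 → Fin 7 → ℝ) (c : Fin 7) :
    ∑ k, ∑ l, (epsInt k l c : ℝ) * x k l
      = x (c + 1) (c + 3) - x (c + 3) (c + 1) + x (c + 4) (c + 5) - x (c + 5) (c + 4)
        + x (c + 2) (c + 6) - x (c + 6) (c + 2) := by
  have h : ∀ k l c : Fin 7, epsInt k l c
      = (if k = c + 1 then if l = c + 3 then 1 else 0 else 0)
      - (if k = c + 3 then if l = c + 1 then 1 else 0 else 0)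
      + (if k = c + 4 then if l = c + 5 then 1 else 0 else 0)
      - (if k = c + 5 then if l = c + 4 then 1 else 0 else 0)
      + (if k = c + 2 then if l = c + 6 then 1 else 0 else 0)
      - (if k = c + 6 then if l = c + 2 then 1 else 0 else 0) := by decide +kernel
  simp only [h]
  push_cast
  simp only [sub_mul, add_mul, ite_mul, one_mul, zero_mul, Finset.sum_add_distrib,
    Finset.sum_sub_distrib, Finset.sum_ite_eq', Finset.mem_univ, if_true,
    Finset.sum_ite_irrel, Finset.sum_const_zero]

/-- The six cyclic entries in the definition of `p(a)` are a contraction with the structure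
constants; this is the form in which `p` enters all later computations. -/
theorem inner_pVector (a : V →ₗ[ℝ] V) (c : Fin 7) :
    inner ℝ (e c) (pVector e a) = ∑ k, ∑ l, (epsInt k l c : ℝ) * entry e a k l := by
  rw [sum_eps_mul, pVector, inner_sum]
  simp [inner_smul_right, inner_basis]

theorem sum_eps_mul_eps (i j : Fin 7) :
    ∑ a, ∑ b, (epsInt a b i : ℝ) * (epsInt a b j : ℝ) = if i = j then 6 else 0 := by
  exact_mod_cast sum_epsInt_mul_epsInt i j

theorem eps_swap (i j k : Fin 7) : (epsInt i j k : ℝ) = - (epsInt j i k : ℝ) := by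
  exact_mod_cast epsInt_swap i j k

theorem psi_eq (i j k l : Fin 7) : (psiInt i j k l : ℝ) =
    (if i = k then 1 else 0) * (if j = l then 1 else 0)
    - (if i = l then 1 else 0) * (if j = k then 1 else 0)
    - ∑ a, (epsInt i j a : ℝ) * (epsInt k l a : ℝ) := by
  simp only [psiInt, ite_and]
  push_cast
  simp only [ite_mul, one_mul, zero_mul]

/-- By the contraction `∑ ε_{klc} ε_{klx} = 6 δ_{cx}`. Hence `a ↦ (1/6) A_{p(a)}` is a projection
onto `𝔤₂^⊥`. -/
theorem pVector_crossRight (v : V) : pVector e (crossRight e v) = (6 : ℝ) • v := by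
  refine vector_ext e fun c => ?_
  rw [inner_pVector, inner_smul_right]
  simp only [entry_crossRight, Finset.mul_sum, ← mul_assoc]
  have h : ∀ k, ∑ x, ∑ l, (epsInt k l c : ℝ) * (epsInt k l x : ℝ) * inner ℝ (e x) v
      = ∑ l, ∑ x, (epsInt k l c : ℝ) * (epsInt k l x : ℝ) * inner ℝ (e x) v :=
    fun k => Finset.sum_comm
  simp only [← h]
  rw [Finset.sum_comm]
  simp only [← Finset.sum_mul, sum_eps_mul_eps]
  simp

theorem crossRight_mem_lieG2Perp (v : V) : crossRight e v ∈ lieG2Perp e := by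
  have h : ∀ i k : Fin 7, epsInt (i + 1) (i + 3) k = (if k = i then 1 else 0)
      ∧ epsInt (i + 4) (i + 5) k = (if k = i then 1 else 0)
      ∧ epsInt (i + 2) (i + 6) k = (if k = i then 1 else 0) := by decide +kernel
  refine ⟨fun i j => ?_, fun i => ?_⟩
  · simp only [entry_crossRight, eps_swap i j, neg_mul, Finset.sum_neg_distrib]
  · simp only [entry_crossRight, (h i _).1, (h i _).2.1, (h i _).2.2]
    exact ⟨trivial, trivial⟩

/-- The defining equations express every entry of `a` by the seven numbers `a_{k+1 k+3}`, which are
the coordinates of `p(a)` divided by 6. -/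
theorem lieG2Perp_eq {a : V →ₗ[ℝ] V} (ha : a ∈ lieG2Perp e) :
    a = (1 / 6 : ℝ) • crossRight e (pVector e a) := by
  obtain ⟨hs, h⟩ := ha
  have hp : ∀ k, inner ℝ (e k) (pVector e a) = 6 * entry e a (k + 1) (k + 3) := by
    intro k
    rw [inner_pVector, sum_eps_mul, hs (k + 3), hs (k + 5), hs (k + 6), ← (h k).2, ← (h k).1]
    ring
  have hE : ∀ i k : Fin 7, epsInt (i + 1) (i + 3) k = (if k = i then 1 else 0)
      ∧ epsInt (i + 4) (i + 5) k = (if k = i then 1 else 0)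
      ∧ epsInt (i + 2) (i + 6) k = (if k = i then 1 else 0) := by decide +kernel
  -- The pairs `(1,3)`, `(4,5)`, `(2,6)` have differences `2, 1, 4`, and each nonzero residue modulo
  -- 7 is one of these up to sign.
  have hex : ∀ i j : Fin 7, i = j ∨ ∃ k, (i = k + 1 ∧ j = k + 3) ∨ (i = k + 4 ∧ j = k + 5)
      ∨ (i = k + 2 ∧ j = k + 6) ∨ (j = k + 1 ∧ i = k + 3) ∨ (j = k + 4 ∧ i = k + 5)
      ∨ (j = k + 2 ∧ i = k + 6) := by decide +kernel
  have hii : ∀ i k : Fin 7, epsInt i i k = 0 := by decide +kernel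
  refine end_ext e fun i j => ?_
  rw [entry_smul, entry_crossRight]
  simp only [hp]
  rcases hex i j with rfl | ⟨k, ⟨rfl, rfl⟩ | ⟨rfl, rfl⟩ | ⟨rfl, rfl⟩ | ⟨rfl, rfl⟩ | ⟨rfl, rfl⟩ |
    ⟨rfl, rfl⟩⟩
  · simp only [hii, Int.cast_zero, zero_mul, Finset.sum_const_zero, mul_zero]
    linarith [hs i i]
  · simp [(hE k _).1]
  · simp [(hE k _).2.1, (h k).1]
  · simp [(hE k _).2.2, (h k).1, (h k).2]
  · simp [eps_swap (k + 3), (hE k _).1]; exact hs _ _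
  · simp [eps_swap (k + 5), (hE k _).2.1, (h k).1]; exact hs _ _
  · simp [eps_swap (k + 6), (hE k _).2.2, (h k).1, (h k).2]; exact hs _ _

theorem pVector_add (a b : V →ₗ[ℝ] V) : pVector e (a + b) = pVector e a + pVector e b := by
  refine vector_ext e fun c => ?_
  simp only [inner_add_right, inner_pVector, entry_add, mul_add, Finset.sum_add_distrib]

theorem pVector_smul (r : ℝ) (a : V →ₗ[ℝ] V) : pVector e (r • a) = r • pVector e a := by
  refine vector_ext e fun c => ?_
  simp only [inner_smul_right, inner_pVector, entry_smul, Finset.mul_sum, mul_left_comm]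

theorem pVector_eq_zero_of_symm {a : V →ₗ[ℝ] V} (h : ∀ i j, entry e a i j = entry e a j i) :
    pVector e a = 0 := by
  refine vector_ext e fun c => ?_
  rw [inner_pVector, sum_eps_mul, h (c + 1), h (c + 4), h (c + 2), inner_zero_right]
  ring

/-- For skew `a` the six terms of `p(a)` coincide in pairs, so each coordinate of `p(a)` is twice
the sum that defines `𝔤₂`. -/
theorem mem_lieG2_iff {a : V →ₗ[ℝ] V} :
    a ∈ lieG2 e ↔ (∀ i j, entry e a i j = - entry e a j i) ∧ pVector e a = 0 := by
  refine and_congr_right fun hs => ?_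
  have hp : ∀ c, inner ℝ (e c) (pVector e a) = 2 * (entry e a (c + 1) (c + 3)
      + entry e a (c + 4) (c + 5) + entry e a (c + 2) (c + 6)) := by
    intro c
    rw [inner_pVector, sum_eps_mul, hs (c + 3), hs (c + 5), hs (c + 6)]
    ring
  constructor
  · intro h
    refine vector_ext e fun c => ?_
    rw [hp, h, inner_zero_right, mul_zero]
  · intro h c
    have := hp c
    rw [h, inner_zero_right] at this
    linarith

/-- The components of an endomorphism. -/
def endSplitting (a : V →ₗ[ℝ] V) : Fin 4 → V →ₗ[ℝ] V :=
  ![(1 / 7 * ∑ i, entry e a i i) • LinearMap.id,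
    endOfEntries e (fun i j => (entry e a i j - entry e a j i) / 2)
      - (1 / 6 : ℝ) • crossRight e (pVector e a),
    endOfEntries e (fun i j => (entry e a i j + entry e a j i) / 2)
      - (1 / 7 * ∑ i, entry e a i i) • LinearMap.id,
    (1 / 6 : ℝ) • crossRight e (pVector e a)]

theorem isSplitting_endSplitting (a : V →ₗ[ℝ] V) :
    IsSplitting (endModule e) a (endSplitting e a) := by
  have hcs := (crossRight_mem_lieG2Perp e (pVector e a)).1
  refine ⟨fun i => ?_, ?_⟩
  · fin_cases i
    · exact Submodule.smul_mem _ _ (Submodule.mem_span_singleton_self _)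
    · change endOfEntries e (fun i j => (entry e a i j - entry e a j i) / 2)
        - (1 / 6 : ℝ) • crossRight e (pVector e a) ∈ lieG2 e
      rw [mem_lieG2_iff]
      refine ⟨fun i j => ?_, ?_⟩
      · simp only [entry_sub, entry_smul, entry_endOfEntries]
        rw [hcs i j]
        ring
      · rw [sub_eq_add_neg, ← neg_smul, pVector_add, pVector_smul, pVector_crossRight]
        have h : pVector e (endOfEntries e fun i j => (entry e a i j - entry e a j i) / 2)
            = pVector e a := by
          refine vector_ext e fun c => ?_
          simp only [inner_pVector, sum_eps_mul, entry_endOfEntries]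
          ring
        rw [h, smul_smul]
        norm_num
    · change endOfEntries e (fun i j => (entry e a i j + entry e a j i) / 2)
        - (1 / 7 * ∑ i, entry e a i i) • LinearMap.id ∈ tracelessSymmetric e
      refine ⟨fun i j => ?_, ?_⟩
      · simp only [entry_sub, entry_smul, entry_endOfEntries, entry_id, eq_comm (a := i)]
        ring
      · simp only [entry_sub, entry_smul, entry_endOfEntries, entry_id, Finset.sum_sub_distrib,
          if_true, ← Finset.mul_sum, ← two_mul]
        simp
        ring
    · exact Submodule.smul_mem _ _ (crossRight_mem_lieG2Perp e _)
  · refine end_ext e fun i j => ?_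
    rw [Fin.sum_univ_four]
    simp only [endSplitting, Matrix.cons_val, entry_add, entry_sub, entry_smul, entry_endOfEntries]
    ring

theorem existsUnique_isSplitting_end (a : V →ₗ[ℝ] V) :
    ∃! c, IsSplitting (endModule e) a c := by
  refine ⟨endSplitting e a, isSplitting_endSplitting e a, fun c hc => ?_⟩
  obtain ⟨hm, hsum⟩ := hc
  rw [Fin.sum_univ_four] at hsum
  obtain ⟨r, hr⟩ := Submodule.mem_span_singleton.1 (hm 0)
  have h1 := (mem_lieG2_iff e).1 (hm 1)
  have h2 : (∀ i j, entry e (c 2) i j = entry e (c 2) j i) ∧ ∑ i, entry e (c 2) i i = 0 := hm 2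
  have h3 := hm 3
  have h3s : ∀ i j, entry e (c 3) i j = - entry e (c 3) j i := h3.1
  have he : ∀ i j, entry e a i j = r * (if i = j then 1 else 0) + entry e (c 1) i j
      + entry e (c 2) i j + entry e (c 3) i j := by
    intro i j
    rw [← hsum]
    simp only [entry_add, ← hr, entry_smul, entry_id]
  -- Uniqueness: `p` vanishes on the first three modules and thus determines the component in
  -- `𝔤₂^⊥`. The trace determines the scalar part; the skew and symmetric parts of `a` then
  -- determine the other two.
  have hp : pVector e a = pVector e (c 3) := by
    rw [← hsum, pVector_add, pVector_add, pVector_add, h1.2, pVector_eq_zero_of_symm e h2.1,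
      ← hr, pVector_smul, pVector_eq_zero_of_symm e fun i j => by
        simp only [entry_id, eq_comm (a := i)]]
    simp
  have ht : 1 / 7 * ∑ i, entry e a i i = r := by
    have h1d : ∀ i, entry e (c 1) i i = 0 := fun i => by linarith [h1.1 i i]
    have h3d : ∀ i, entry e (c 3) i i = 0 := fun i => by linarith [h3s i i]
    simp only [he, Finset.sum_add_distrib, h2.2, h1d, h3d]
    simp
  have hc3 : (1 / 6 : ℝ) • crossRight e (pVector e a) = c 3 := by
    rw [hp, ← lieG2Perp_eq e h3]
  funext i
  fin_cases i
  · change c 0 = (1 / 7 * ∑ i, entry e a i i) • LinearMap.id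
    rw [ht, hr]
  · change c 1 = endOfEntries e (fun i j => (entry e a i j - entry e a j i) / 2)
        - (1 / 6 : ℝ) • crossRight e (pVector e a)
    rw [hc3]
    refine end_ext e fun i j => ?_
    rw [entry_sub, entry_endOfEntries, he i j, he j i, h1.1 j i, h2.1 j i, h3s j i]
    simp only [eq_comm (a := j)]
    ring
  · change c 2 = endOfEntries e (fun i j => (entry e a i j + entry e a j i) / 2)
        - (1 / 7 * ∑ i, entry e a i i) • LinearMap.id
    rw [ht]
    refine end_ext e fun i j => ?_
    rw [entry_sub, entry_endOfEntries, he i j, he j i, h1.1 j i, h2.1 j i, h3s j i, entry_smul,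
      entry_id]
    simp only [eq_comm (a := j)]
    ring
  · exact hc3.symm

theorem component_end (a : V →ₗ[ℝ] V) : component (endModule e) a = endSplitting e a :=
  component_eq (existsUnique_isSplitting_end e a) (isSplitting_endSplitting e a)

/-- Applying `p` to `A_{a(X)}` recovers `6 a(X)`. -/
theorem torsionOf_injective : Function.Injective (torsionOf e) := by
  intro a b h
  refine e.toBasis.ext fun j => ?_
  rw [OrthonormalBasis.coe_toBasis]
  have h1 : crossRight e (a (e j)) = crossRight e (b (e j)) := LinearMap.congr_fun h (e j)
  have h2 := congrArg (pVector e) h1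
  rw [pVector_crossRight, pVector_crossRight] at h2
  exact smul_right_injective V (by norm_num : (6 : ℝ) ≠ 0) h2

/-- A tensor with values in `𝔤₂^⊥` is given by an endomorphism. -/
theorem exists_eq_torsionOf (ξ : V →ₗ[ℝ] V →ₗ[ℝ] V) (h : ∀ X, ξ X ∈ lieG2Perp e) :
    ∃ T : V →ₗ[ℝ] V, ξ = torsionOf e T := by
  -- The witness is forced: `p(A_{T(X)}) = 6 T(X)`.
  refine ⟨{ toFun := fun X => (1 / 6 : ℝ) • pVector e (ξ X)
            map_add' := fun X Y => by rw [map_add, pVector_add, smul_add]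
            map_smul' := fun c X => by
              rw [map_smul, pVector_smul, smul_comm]; rfl }, ?_⟩
  ext1 X
  refine (lieG2Perp_eq e (h X)).trans ?_
  change _ = (cross e).flip ((1 / 6 : ℝ) • pVector e (ξ X))
  rw [map_smul]
  rfl

theorem existsUnique_isSplitting_torsion (T : V →ₗ[ℝ] V) :
    ∃! c, IsSplitting (torsionModule e) (torsionOf e T) c :=
  existsUnique_isSplitting_map (existsUnique_isSplitting_end e T) _ (torsionOf_injective e)

theorem component_torsion (T : V →ₗ[ℝ] V) (i : Fin 4) :
    component (torsionModule e) (torsionOf e T) i = torsionOf e (endSplitting e T i) :=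
  congrFun (component_eq (existsUnique_isSplitting_torsion e T)
    ((isSplitting_endSplitting e T).map (torsionOf e))) i

end Endomorphisms

/-! ### Four-forms -/

section FourForms

variable {V : Type*} [NormedAddCommGroup V] [InnerProductSpace ℝ V]
variable (e : OrthonormalBasis (Fin 7) ℝ V)

/-- In the formula for `ψ` the Kronecker terms contribute `2 ε_{ijk}` and the product of structure
constants contributes `-6 ε_{ijk}`. -/
theorem sum_eps_mul_psi (i j k : Fin 7) :
    ∑ x, ∑ y, (epsInt x y k : ℝ) * (psiInt i j x y : ℝ) = -4 * (epsInt i j k : ℝ) := by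
  have h : ∑ x, ∑ y, (epsInt x y k : ℝ) * ∑ a, (epsInt i j a : ℝ) * (epsInt x y a : ℝ)
      = 6 * (epsInt i j k : ℝ) := by
    simp only [Finset.mul_sum]
    rw [Finset.sum_congr rfl fun x _ => Finset.sum_comm, Finset.sum_comm]
    have : ∀ a, ∑ x, ∑ y, (epsInt x y k : ℝ) * ((epsInt i j a : ℝ) * (epsInt x y a : ℝ))
        = (epsInt i j a : ℝ) * if k = a then 6 else 0 := by
      intro a
      rw [← sum_eps_mul_eps, Finset.mul_sum]
      refine Finset.sum_congr rfl fun x _ => ?_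
      rw [Finset.mul_sum]
      exact Finset.sum_congr rfl fun y _ => by ring
    simp only [this]
    simp [mul_comm]
  simp only [psi_eq, mul_sub, Finset.sum_sub_distrib, h]
  simp
  rw [eps_swap j i k]
  ring

theorem psi_swap_left (i j k l : Fin 7) : (psiInt i j k l : ℝ) = - (psiInt j i k l : ℝ) := by
  exact_mod_cast psiInt_swap_left i j k l

theorem psi_swap_mid (i j k l : Fin 7) : (psiInt i j k l : ℝ) = - (psiInt i k j l : ℝ) := by
  exact_mod_cast psiInt_swap_mid i j k l

theorem psi_swap_right (i j k l : Fin 7) : (psiInt i j k l : ℝ) = - (psiInt i j l k : ℝ) := by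
  exact_mod_cast psiInt_swap_right i j k l

theorem psi_swap_pairs (i j k l : Fin 7) : (psiInt i j k l : ℝ) = (psiInt k l i j : ℝ) := by
  rw [psi_swap_mid i j k l, psi_swap_left i k j l, psi_swap_right k i j l, psi_swap_mid k i l j]
  ring

/-- Only one factor is expanded; the other is contracted with `sum_eps_mul_psi`, and the product of
structure constants that remains is rewritten through `ψ`. -/
theorem sum_psi_mul_psi (i j k l : Fin 7) :
    ∑ x, ∑ y, (psiInt i j x y : ℝ) * (psiInt k l x y : ℝ)
      = 4 * ((if i = k then 1 else 0) * (if j = l then 1 else 0)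
        - (if i = l then 1 else 0) * (if j = k then 1 else 0)) - 2 * (psiInt i j k l : ℝ) := by
  have h : ∑ x, ∑ y, (∑ a, (epsInt i j a : ℝ) * (epsInt x y a : ℝ)) * (psiInt k l x y : ℝ)
      = -4 * ∑ a, (epsInt i j a : ℝ) * (epsInt k l a : ℝ) := by
    simp only [Finset.sum_mul]
    rw [Finset.sum_congr rfl fun x _ => Finset.sum_comm, Finset.sum_comm, Finset.mul_sum]
    refine Finset.sum_congr rfl fun a _ => ?_
    have := sum_eps_mul_psi k l a
    rw [show -4 * ((epsInt i j a : ℝ) * (epsInt k l a : ℝ))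
      = (epsInt i j a : ℝ) * (-4 * (epsInt k l a : ℝ)) by ring, ← this, Finset.mul_sum]
    refine Finset.sum_congr rfl fun x _ => ?_
    rw [Finset.mul_sum]
    exact Finset.sum_congr rfl fun y _ => by ring
  have h1 : ∑ x, ∑ y, (psiInt i j x y : ℝ) * (psiInt k l x y : ℝ)
      = psiInt k l i j - psiInt k l j i
        - ∑ x, ∑ y, (∑ a, (epsInt i j a : ℝ) * (epsInt x y a : ℝ)) * (psiInt k l x y : ℝ) := by
    conv_lhs => simp only [psi_eq i j]
    simp only [sub_mul, Finset.sum_sub_distrib]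
    simp
  rw [h1, h, psi_swap_right k l j i, ← psi_swap_pairs i j k l, psi_eq i j k l]
  ring

/-- Alternating the curried form returns `p + 1` times the form. This allows norms to be computed by
descending to two-forms, where the contractions of `ε` and `ψ` apply. -/
theorem formInner_succ {p : ℕ} (α β : V [⋀^Fin (p + 1)]→ₗ[ℝ] ℝ) :
    formInner e α β = ((p : ℝ) + 1)⁻¹ *
      ∑ i, formInner e (interiorProd (e i) α) (interiorProd (e i) β) := by
  have h := formInner_alternatizeUncurryFin e (AlternatingMap.curryLeft α) β
  rw [AlternatingMap.alternatizeUncurryFin_curryLeft, ← formPairing_apply, map_nsmul,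
    LinearMap.smul_apply, formPairing_apply, nsmul_eq_mul] at h
  have hp : (p : ℝ) + 1 ≠ 0 := by positivity
  push_cast at h
  rw [eq_inv_mul_iff_mul_eq₀ hp, h]
  rfl

theorem formInner_two (α β : V [⋀^Fin 2]→ₗ[ℝ] ℝ) :
    formInner e α β = 1 / 2 * ∑ x, ∑ y, α ![e x, e y] * β ![e x, e y] := by
  rw [formInner, ← (finTwoArrowEquiv (Fin 7)).symm.sum_comp, Fintype.sum_prod_type]
  have h : ∀ x y : Fin 7, (fun k => e ((finTwoArrowEquiv (Fin 7)).symm (x, y) k)) = ![e x, e y] := by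
    intro x y; funext k; fin_cases k <;> rfl
  simp only [h]
  norm_num

theorem interiorProd_cayleyForm_apply (i x y : Fin 7) :
    interiorProd (e i) (cayleyForm e) ![e x, e y] = (epsInt i x y : ℝ) :=
  cayleyForm_apply_vec e i x y

theorem interiorProd_cayleyFourForm_apply (i j x y : Fin 7) :
    interiorProd (e j) (interiorProd (e i) (cayleyFourForm e)) ![e x, e y]
      = (psiInt i j x y : ℝ) := by
  obtain ⟨f, h0, h1, h2⟩ : ∃ f : Fin 3 → Fin 7, f 0 = j ∧ f 1 = x ∧ f 2 = y :=
    ⟨![j, x, y], rfl, rfl, rfl⟩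
  have h := interiorProd_cayleyFourForm_basis e i f
  rw [h0, h1, h2] at h
  have hβ : ∀ β : V [⋀^Fin 3]→ₗ[ℝ] ℝ,
      interiorProd (e j) β ![e x, e y] = β (fun k => e (f k)) := by
    intro β
    rw [interiorProd_apply]
    congr 1
    funext l
    fin_cases l
    · exact congrArg e h0.symm
    · exact congrArg e h1.symm
    · exact congrArg e h2.symm
  rw [hβ, h]

theorem formInner_interiorProd_cayleyForm (i j : Fin 7) :
    formInner e (interiorProd (e i) (cayleyForm e)) (interiorProd (e j) (cayleyForm e))
      = if i = j then 3 else 0 := by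
  rw [formInner_two]
  simp only [interiorProd_cayleyForm_apply]
  have h : ∀ i x y : Fin 7, epsInt i x y = epsInt x y i := epsInt_rotate
  simp only [h i, h j, sum_eps_mul_eps]
  split_ifs <;> norm_num

theorem formInner_interiorProd_two (i j k l : Fin 7) :
    formInner e (interiorProd (e j) (interiorProd (e i) (cayleyFourForm e)))
      (interiorProd (e l) (interiorProd (e k) (cayleyFourForm e)))
      = 2 * ((if i = k then 1 else 0) * (if j = l then 1 else 0)
        - (if i = l then 1 else 0) * (if j = k then 1 else 0)) - (psiInt i j k l : ℝ) := by
  rw [formInner_two]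
  simp only [interiorProd_cayleyFourForm_apply, sum_psi_mul_psi]
  ring

theorem psi_self_mid (i j k : Fin 7) : (psiInt i j k j : ℝ) = 0 := by
  rw [psi_swap_right]
  linarith [psi_swap_mid i j j k]

theorem formInner_interiorProd_cayleyFourForm (i j : Fin 7) :
    formInner e (interiorProd (e i) (cayleyFourForm e)) (interiorProd (e j) (cayleyFourForm e))
      = if i = j then 4 else 0 := by
  rw [formInner_succ]
  simp only [formInner_interiorProd_two, psi_self_mid]
  by_cases h : i = j
  · subst h
    simp [← Finset.mul_sum, Finset.sum_sub_distrib]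
    norm_num
  · simp [h]

theorem formInner_interiorProd_cayleyForm_fourForm (i j k : Fin 7) :
    formInner e (interiorProd (e i) (cayleyForm e))
      (interiorProd (e k) (interiorProd (e j) (cayleyFourForm e))) = -2 * (epsInt i j k : ℝ) := by
  rw [formInner_two]
  simp only [interiorProd_cayleyForm_apply, interiorProd_cayleyFourForm_apply]
  simp only [epsInt_rotate i, sum_eps_mul_psi]
  ring

theorem formInner_cayleyForm_interiorProd (j : Fin 7) :
    formInner e (cayleyForm e) (interiorProd (e j) (cayleyFourForm e)) = 0 := by
  rw [formInner_succ]
  simp only [formInner_interiorProd_cayleyForm_fourForm]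
  have h : ∀ i j : Fin 7, epsInt i j i = 0 := by decide +kernel
  simp [h]

theorem formInner_cayleyForm_self : formInner e (cayleyForm e) (cayleyForm e) = 7 := by
  rw [formInner_succ]
  simp [formInner_interiorProd_cayleyForm]
  norm_num

theorem formInner_cayleyFourForm_self :
    formInner e (cayleyFourForm e) (cayleyFourForm e) = 7 := by
  rw [formInner_succ]
  simp [formInner_interiorProd_cayleyFourForm]
  norm_num

theorem interiorProd_flat_wedge (e : OrthonormalBasis (Fin 7) ℝ V) (u v : V)
    (β : V [⋀^Fin 3]→ₗ[ℝ] ℝ) :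
    interiorProd (p := 3) u (wedge (p := 1) (q := 3) (flat v) β)
      = inner ℝ v u • β - wedge (p := 1) (q := 2) (flat v) (interiorProd u β) := by
  ext w
  have h1 := flat_wedge_three_apply e v β (Matrix.vecCons u w)
  have h2 := flat_wedge_two_apply e v (interiorProd u β) w
  have hw : (![w 0, w 1, w 2] : Fin 3 → V) = w := by
    funext k; fin_cases k <;> rfl
  refine h1.trans ?_
  rw [AlternatingMap.sub_apply, AlternatingMap.smul_apply, smul_eq_mul]
  refine Eq.trans ?_ (congrArg (fun t => inner ℝ v u * β w - t) h2.symm)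
  have e1 : (Matrix.vecCons u w : Fin 4 → V) 1 = w 0 := rfl
  have e2 : (Matrix.vecCons u w : Fin 4 → V) 2 = w 1 := rfl
  have e3 : (Matrix.vecCons u w : Fin 4 → V) 3 = w 2 := rfl
  have e0 : (Matrix.vecCons u w : Fin 4 → V) 0 = u := rfl
  rw [e0, e1, e2, e3, hw]
  simp only [interiorProd_apply]
  ring

theorem formInner_smul_right {p : ℕ} (c : ℝ) (α β : V [⋀^Fin p]→ₗ[ℝ] ℝ) :
    formInner e α (c • β) = c * formInner e α β := by
  simp only [← formPairing_apply, map_smul, smul_eq_mul]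

theorem formInner_smul_left {p : ℕ} (c : ℝ) (α β : V [⋀^Fin p]→ₗ[ℝ] ℝ) :
    formInner e (c • α) β = c * formInner e α β := by
  simp only [← formPairing_apply, map_smul, LinearMap.smul_apply, smul_eq_mul]

theorem formInner_sub_right {p : ℕ} (α β γ : V [⋀^Fin p]→ₗ[ℝ] ℝ) :
    formInner e α (β - γ) = formInner e α β - formInner e α γ := by
  simp only [← formPairing_apply, map_sub]

theorem formInner_sub_left {p : ℕ} (α β γ : V [⋀^Fin p]→ₗ[ℝ] ℝ) :
    formInner e (α - β) γ = formInner e α γ - formInner e β γ := by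
  rw [formInner_comm, formInner_sub_right, formInner_comm e γ, formInner_comm e γ]

theorem formInner_add_right {p : ℕ} (α β γ : V [⋀^Fin p]→ₗ[ℝ] ℝ) :
    formInner e α (β + γ) = formInner e α β + formInner e α γ := by
  simp only [← formPairing_apply, map_add]

theorem formInner_add_left {p : ℕ} (α β γ : V [⋀^Fin p]→ₗ[ℝ] ℝ) :
    formInner e (α + β) γ = formInner e α γ + formInner e β γ := by
  rw [formInner_comm, formInner_add_right, formInner_comm e γ, formInner_comm e γ]

theorem formInner_sum_right {p : ℕ} {ι : Type*} (s : Finset ι) (α : V [⋀^Fin p]→ₗ[ℝ] ℝ)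
    (β : ι → V [⋀^Fin p]→ₗ[ℝ] ℝ) :
    formInner e α (∑ i ∈ s, β i) = ∑ i ∈ s, formInner e α (β i) := by
  simp only [← formPairing_apply, map_sum]

theorem formInner_sum_left {p : ℕ} {ι : Type*} (s : Finset ι) (α : V [⋀^Fin p]→ₗ[ℝ] ℝ)
    (β : ι → V [⋀^Fin p]→ₗ[ℝ] ℝ) :
    formInner e (∑ i ∈ s, β i) α = ∑ i ∈ s, formInner e (β i) α := by
  simp only [formInner_comm e _ α, formInner_sum_right]

/-- Wedging with one-forms, as a linear map of the dual vector. -/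
def flatWedge (e : OrthonormalBasis (Fin 7) ℝ V) {q : ℕ} (β : V [⋀^Fin q]→ₗ[ℝ] ℝ) :
    V →ₗ[ℝ] V [⋀^Fin (1 + q)]→ₗ[ℝ] ℝ where
  toFun v := wedge (flat v) β
  map_add' u v := by
    simp only [flat_wedge_eq e]
    rw [← AlternatingMap.domDomCongr_add, ← AlternatingMap.alternatizeUncurryFin_add]
    congr 2
    ext x w
    simp [add_mul]
  map_smul' c v := by
    simp only [flat_wedge_eq e]
    rw [RingHom.id_apply, ← AlternatingMap.domDomCongr_smul,
      ← AlternatingMap.alternatizeUncurryFin_smul]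
    congr 2
    ext x w
    simp [mul_assoc]

theorem flatWedge_apply {q : ℕ} (β : V [⋀^Fin q]→ₗ[ℝ] ℝ) (v : V) :
    flatWedge e β v = wedge (flat v) β := rfl

theorem flat_wedge_sum {q : ℕ} (β : V [⋀^Fin q]→ₗ[ℝ] ℝ) (v : V) :
    wedge (flat v) β = ∑ i, inner ℝ (e i) v • wedge (flat (e i)) β := by
  simp only [← flatWedge_apply e]
  conv_lhs => rw [← e.sum_repr' v]
  simp only [map_sum, map_smul]

theorem mem_span_range_flat_wedge (e : OrthonormalBasis (Fin 7) ℝ V) {q : ℕ}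
    {β : V [⋀^Fin q]→ₗ[ℝ] ℝ} {η : V [⋀^Fin (1 + q)]→ₗ[ℝ] ℝ}
    (h : η ∈ Submodule.span ℝ (Set.range fun v : V => wedge (flat v) β)) :
    ∃ v, η = wedge (flat v) β := by
  have h' : Submodule.span ℝ (Set.range fun v : V => wedge (flat v) β)
      ≤ LinearMap.range (flatWedge e β) := by
    rw [Submodule.span_le]
    rintro _ ⟨v, rfl⟩
    exact ⟨v, rfl⟩
  obtain ⟨v, hv⟩ := h' h
  exact ⟨v, hv.symm⟩

/-- The four-forms `eᵢ* ∧ (eⱼ ⌟ ⋆φ)`. -/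
def kForm (i j : Fin 7) : V [⋀^Fin 4]→ₗ[ℝ] ℝ :=
  wedge (flat (e i)) (interiorProd (e j) (cayleyFourForm e))

theorem formInner_kForm_left (η : V [⋀^Fin 4]→ₗ[ℝ] ℝ) (i j : Fin 7) :
    formInner e (kForm e i j) η
      = formInner e (interiorProd (e j) (cayleyFourForm e)) (interiorProd (e i) η) :=
  formInner_flat_wedge_three e _ _ η

/-- Adjointness and the antiderivation rule for `eᵢ ⌟ ·` leave contractions of `⋆φ` with itself,
known from `formInner_interiorProd_two`. -/
theorem formInner_kForm_kForm (i j k l : Fin 7) :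
    formInner e (kForm e i j) (kForm e k l)
      = 2 * ((if i = k then 1 else 0) * (if j = l then 1 else 0))
        + 2 * ((if i = j then 1 else 0) * (if k = l then 1 else 0)) - (psiInt i j k l : ℝ) := by
  rw [formInner_kForm_left, kForm]
  refine (congrArg (formInner e _) (interiorProd_flat_wedge e (e i) (e k) _)).trans ?_
  refine (formInner_sub_right e _ _ _).trans ?_
  rw [formInner_smul_right, formInner_interiorProd_cayleyFourForm, inner_basis, formInner_comm]
  refine (congrArg (fun t => _ - t) (formInner_flat_wedge_two e _ _ _)).trans ?_
  rw [formInner_interiorProd_two, psi_swap_pairs l i j k, psi_swap_left j k l i,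
    psi_swap_mid k j l i, psi_swap_pairs k l j i, psi_swap_left j i k l]
  simp only [eq_comm (a := k) (b := i), eq_comm (a := l) (b := j), eq_comm (a := l) (b := k)]
  split_ifs <;> ring

theorem formInner_flat_wedge_cayleyForm_fourForm (v : V) :
    formInner e (wedge (flat v) (cayleyForm e)) (cayleyFourForm e) = 0 := by
  refine (formInner_flat_wedge_three e v _ _).trans ?_
  rw [interiorProd_sum e, formInner_sum_right]
  simp [formInner_smul_right, formInner_cayleyForm_interiorProd]

theorem formInner_flat_wedge_basis (i j : Fin 7) :
    formInner e (wedge (flat (e i)) (cayleyForm e)) (wedge (flat (e j)) (cayleyForm e))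
      = if i = j then 4 else 0 := by
  refine (formInner_flat_wedge_three e (e i) _ _).trans ?_
  refine (congrArg (formInner e _) (interiorProd_flat_wedge e (e i) (e j) _)).trans ?_
  refine (formInner_sub_right e _ _ _).trans ?_
  rw [formInner_smul_right, formInner_cayleyForm_self, inner_basis, formInner_comm]
  refine (congrArg (fun t => _ - t) (formInner_flat_wedge_two e _ _ _)).trans ?_
  rw [formInner_interiorProd_cayleyForm]
  simp only [eq_comm (a := j)]
  split_ifs <;> norm_num

theorem formInner_flat_wedge_flat_wedge (u v : V) :
    formInner e (wedge (flat u) (cayleyForm e)) (wedge (flat v) (cayleyForm e))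
      = 4 * inner ℝ u v := by
  rw [flat_wedge_sum e _ u, flat_wedge_sum e _ v, formInner_sum_left]
  simp only [formInner_sum_right, formInner_smul_left, formInner_smul_right,
    formInner_flat_wedge_basis]
  rw [← e.sum_inner_mul_inner u v, Finset.mul_sum]
  refine Finset.sum_congr rfl fun i _ => ?_
  simp [real_inner_comm u]
  ring

theorem formInner_flat_wedge_kForm (v : V) (i j : Fin 7) :
    formInner e (wedge (flat v) (cayleyForm e)) (kForm e i j)
      = 2 * entry e (crossRight e v) i j := by
  have h : ∀ m, formInner e (wedge (flat (e m)) (cayleyForm e)) (kForm e i j)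
      = 2 * (epsInt i j m : ℝ) := by
    intro m
    refine (formInner_flat_wedge_three e (e m) _ _).trans ?_
    refine (congrArg (formInner e _) (interiorProd_flat_wedge e (e m) (e i) _)).trans ?_
    refine (formInner_sub_right e _ _ _).trans ?_
    rw [formInner_smul_right, formInner_cayleyForm_interiorProd, formInner_comm]
    refine (congrArg (fun t => _ - t) (formInner_flat_wedge_two e _ _ _)).trans ?_
    rw [formInner_comm, formInner_interiorProd_cayleyForm_fourForm]
    ring
  rw [flat_wedge_sum e, formInner_sum_left, entry_crossRight, Finset.mul_sum]
  refine Finset.sum_congr rfl fun m _ => ?_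
  rw [formInner_smul_left]
  refine (congrArg _ (h m)).trans ?_
  ring

theorem formInner_kMap_left (a : V →ₗ[ℝ] V) (η : V [⋀^Fin 4]→ₗ[ℝ] ℝ) :
    formInner e (kMap e a) η = ∑ i, ∑ j, entry e a i j * formInner e (kForm e i j) η := by
  rw [kMap, formInner_sum_left]
  refine Finset.sum_congr rfl fun i _ => (formInner_sum_left e _ _ _).trans ?_
  exact Finset.sum_congr rfl fun j _ => formInner_smul_left e _ _ _

/-- The term `ψ` of the Gram matrix cancels the skew part of `a` up to `A_{p(a)}`. So `k` sees only
the symmetric part of `a` and its component in `𝔤₂^⊥`. -/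
theorem formInner_kMap_kForm (a : V →ₗ[ℝ] V) (i j : Fin 7) :
    formInner e (kMap e a) (kForm e i j) = entry e a i j + entry e a j i
      + (if i = j then 2 * ∑ k, entry e a k k else 0)
      + entry e (crossRight e (pVector e a)) i j := by
  rw [formInner_kMap_left]
  simp only [formInner_kForm_kForm]
  have h1 : ∑ k, ∑ l, entry e a k l * (psiInt k l i j : ℝ) = entry e a i j - entry e a j i
      - entry e (crossRight e (pVector e a)) i j := by
    simp only [psi_eq, mul_sub, Finset.sum_sub_distrib]
    have h2 : ∑ k, ∑ l, entry e a k l * ∑ c, (epsInt k l c : ℝ) * (epsInt i j c : ℝ)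
        = entry e (crossRight e (pVector e a)) i j := by
      simp only [entry_crossRight, inner_pVector, Finset.mul_sum]
      rw [Finset.sum_congr rfl fun k _ => Finset.sum_comm, Finset.sum_comm]
      exact Finset.sum_congr rfl fun c _ => Finset.sum_congr rfl fun k _ =>
        Finset.sum_congr rfl fun l _ => by ring
    rw [h2]
    simp
  simp only [mul_sub, mul_add, Finset.sum_add_distrib, Finset.sum_sub_distrib, h1]
  by_cases hij : i = j
  · subst hij
    simp [mul_comm]
    rw [← Finset.sum_mul]
    ring
  · simp [hij]
    ring

theorem formInner_kMap_kMap (a b : V →ₗ[ℝ] V) :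
    formInner e (kMap e a) (kMap e b)
      = ∑ i, ∑ j, entry e b i j * formInner e (kMap e a) (kForm e i j) := by
  rw [formInner_comm, formInner_kMap_left]
  simp only [formInner_comm e _ (kMap e a)]

theorem formInner_kMap_flat_wedge (a : V →ₗ[ℝ] V) (v : V) :
    formInner e (kMap e a) (wedge (flat v) (cayleyForm e)) = 2 * inner ℝ v (pVector e a) := by
  rw [formInner_kMap_left]
  have h : ∀ i j, formInner e (kForm e i j) (wedge (flat v) (cayleyForm e))
      = 2 * entry e (crossRight e v) i j := fun i j => by
    rw [← formInner_flat_wedge_kForm]; exact formInner_comm e _ _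
  simp only [h, entry_crossRight]
  rw [← e.sum_inner_mul_inner v]
  simp only [inner_pVector, Finset.mul_sum]
  rw [Finset.sum_congr rfl fun k _ => Finset.sum_comm, Finset.sum_comm]
  refine Finset.sum_congr rfl fun c _ => Finset.sum_congr rfl fun k _ =>
    Finset.sum_congr rfl fun l _ => ?_
  rw [real_inner_comm v]
  ring

theorem kMap_smul (c : ℝ) (a : V →ₗ[ℝ] V) : kMap e (c • a) = c • kMap e a := by
  simp only [kMap, entry_smul, Finset.smul_sum, mul_smul]

theorem kMap_add (a b : V →ₗ[ℝ] V) : kMap e (a + b) = kMap e a + kMap e b := by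
  simp only [kMap, entry_add, add_smul, Finset.sum_add_distrib]

/-- A four-form is counted once for each of its four slots. -/
theorem kMap_id : kMap e LinearMap.id = (4 : ℝ) • cayleyFourForm e := by
  refine form_ext_formInner e fun η => ?_
  rw [formInner_kMap_left, formInner_smul_left, formInner_succ]
  simp only [entry_id, formInner_kForm_left]
  push_cast
  simp
  ring

/-- The square of the norm of the difference is `(36 - 2 · 3 · 12 + 9 · 4) |v|² = 0`, from
`|k(A_v)|² = 36 |v|²`, `(k(A_v), v* ∧ φ) = 12 |v|²` and `|v* ∧ φ|² = 4 |v|²`. -/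
theorem kMap_crossRight (v : V) :
    kMap e (crossRight e v) = (3 : ℝ) • wedge (flat v) (cayleyForm e) := by
  rw [← sub_eq_zero]
  refine eq_zero_of_formInner_self e ?_
  have h1 : formInner e (kMap e (crossRight e v)) (kMap e (crossRight e v))
      = 36 * inner ℝ v v := by
    have hs := (crossRight_mem_lieG2Perp e v).1
    have h : ∀ i j, formInner e (kMap e (crossRight e v)) (kForm e i j)
        = 6 * entry e (crossRight e v) i j := by
      intro i j
      have ht : ∀ k, entry e (crossRight e v) k k = 0 := fun k => by linarith [hs k k]
      rw [formInner_kMap_kForm, pVector_crossRight, hs j i]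
      simp only [ht, Finset.sum_const_zero, mul_zero, ite_self]
      rw [show crossRight e ((6 : ℝ) • v) = (6 : ℝ) • crossRight e v from map_smul _ _ _,
        entry_smul]
      ring
    have h' : formInner e (kMap e (crossRight e v)) (wedge (flat v) (cayleyForm e))
        = 12 * inner ℝ v v := by
      rw [formInner_kMap_flat_wedge, pVector_crossRight, inner_smul_right]; ring
    rw [formInner_kMap_kMap]
    rw [formInner_kMap_left] at h'
    have h3 : ∀ i j, formInner e (kForm e i j) (wedge (flat v) (cayleyForm e))
      = 2 * entry e (crossRight e v) i j := fun i j => by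
        rw [← formInner_flat_wedge_kForm]; exact formInner_comm e _ _
    simp only [h3] at h'
    simp only [h]
    rw [show (36 : ℝ) * inner ℝ v v = 3 * (12 * inner ℝ v v) by ring, ← h', Finset.mul_sum]
    refine Finset.sum_congr rfl fun i _ => ?_
    rw [Finset.mul_sum]
    exact Finset.sum_congr rfl fun j _ => by ring
  have h2 : formInner e (kMap e (crossRight e v)) (wedge (flat v) (cayleyForm e))
        = 12 * inner ℝ v v := by
    rw [formInner_kMap_flat_wedge, pVector_crossRight, inner_smul_right]; ring
  have h3 := formInner_flat_wedge_flat_wedge e v v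
  rw [formInner_sub_left, formInner_sub_right, formInner_sub_right, formInner_smul_right,
    formInner_smul_left, formInner_smul_left, formInner_smul_right, h1]
  rw [formInner_comm e _ (kMap e (crossRight e v))]
  refine (congrArg₂ (fun s t => 36 * inner ℝ v v - 3 * s - (3 * s - 3 * (3 * t))) h2 h3).trans ?_
  ring

/-- Skewness and `p(a) = 0` make every pairing of `k(a)` with `eᵢ* ∧ (eⱼ ⌟ ⋆φ)` vanish, hence also
the norm of `k(a)`. -/
theorem kMap_eq_zero_of_mem_lieG2 {a : V →ₗ[ℝ] V} (ha : a ∈ lieG2 e) : kMap e a = 0 := by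
  obtain ⟨hs, hp⟩ := (mem_lieG2_iff e).1 ha
  refine eq_zero_of_formInner_self e ?_
  rw [formInner_kMap_kMap]
  refine Finset.sum_eq_zero fun i _ => Finset.sum_eq_zero fun j _ => ?_
  have ht : ∀ k, entry e a k k = 0 := fun k => by linarith [hs k k]
  rw [formInner_kMap_kForm, hp, hs j i, show crossRight e (0 : V) = 0 from map_zero _]
  simp only [ht, Finset.sum_const_zero, mul_zero, ite_self]
  simp [entry]

theorem kMap_mem_fourForms27 {a : V →ₗ[ℝ] V} (ha : a ∈ tracelessSymmetric e) :
    kMap e a ∈ fourForms27 e := by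
  obtain ⟨hs, ht⟩ := ha
  refine ⟨?_, fun v => ?_⟩
  -- The factor 4 turns `⋆φ` into `k(Id)`, so that the pairings of `k(a)` with the forms `kForm`
  -- apply.
  · rw [formInner_comm, ← mul_right_inj' (show (4 : ℝ) ≠ 0 by norm_num), ← formInner_smul_left,
      ← kMap_id, formInner_comm, formInner_kMap_kMap]
    simp only [entry_id, formInner_kMap_kForm, pVector_eq_zero_of_symm e hs, ht]
    rw [show crossRight e (0 : V) = 0 from map_zero _]
    have h0 : ∀ i, entry e (0 : V →ₗ[ℝ] V) i i = 0 := fun i => by simp [entry]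
    simp [Finset.sum_add_distrib, ht, h0]
  · refine (formInner_kMap_flat_wedge e a v).trans ?_
    rw [pVector_eq_zero_of_symm e hs]
    simp

theorem existsUnique_isSplitting_fourForm (β : V [⋀^Fin 4]→ₗ[ℝ] ℝ) :
    ∃! c, IsSplitting (fourFormModule e) β c := by
  set ψ := cayleyFourForm e
  let w : V → V [⋀^Fin 4]→ₗ[ℝ] ℝ := fun v => wedge (flat v) (cayleyForm e)
  have hww : ∀ u v, formInner e (w u) (w v) = 4 * inner ℝ u v := formInner_flat_wedge_flat_wedge e
  have hwψ : ∀ v, formInner e (w v) ψ = 0 := formInner_flat_wedge_cayleyForm_fourForm e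
  have hψw : ∀ v, formInner e ψ (w v) = 0 := fun v => by rw [formInner_comm, hwψ]
  have hψψ : formInner e ψ ψ = 7 := formInner_cayleyFourForm_self e
  have hws : ∀ v, w v = ∑ i, inner ℝ (e i) v • w (e i) := flat_wedge_sum e _
  -- Orthogonal projection: `4` and `7` are the squared norms of `eᵢ* ∧ φ` and `⋆φ`, and these forms
  -- are mutually orthogonal.
  let u : V := ∑ i, (1 / 4 * formInner e β (w (e i))) • e i
  let r : ℝ := 1 / 7 * formInner e β ψ
  have hu : ∀ v, formInner e β (w v) = 4 * inner ℝ u v := by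
    intro v
    rw [hws v, formInner_sum_right, sum_inner, Finset.mul_sum]
    refine Finset.sum_congr rfl fun i _ => ?_
    rw [formInner_smul_right, real_inner_smul_left]
    ring
  refine ⟨![r • ψ, 0, β - r • ψ - w u, w u], ⟨fun i => ?_, ?_⟩, fun c hc => ?_⟩
  · fin_cases i
    · exact Submodule.smul_mem _ _ (Submodule.mem_span_singleton_self _)
    · exact Submodule.zero_mem _
    · change β - r • ψ - w u ∈ fourForms27 e
      refine ⟨?_, fun v => ?_⟩
      · change formInner e (β - r • ψ - w u) ψ = 0
        rw [formInner_sub_left, formInner_sub_left, formInner_smul_left, hψψ, hwψ]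
        simp only [r]; ring
      · change formInner e (β - r • ψ - w u) (w v) = 0
        rw [formInner_sub_left, formInner_sub_left, formInner_smul_left, hψw, hww, hu]
        ring
    · exact Submodule.subset_span ⟨u, rfl⟩
  · rw [Fin.sum_univ_four]
    simp only [Matrix.cons_val]
    abel
  · obtain ⟨hm, hsum⟩ := hc
    rw [Fin.sum_univ_four] at hsum
    obtain ⟨s, hs⟩ := Submodule.mem_span_singleton.1 (hm 0)
    have h1 : c 1 = 0 := (Submodule.mem_bot ℝ).1 (hm 1)
    have h2 : formInner e (c 2) ψ = 0 ∧ ∀ v, formInner e (c 2) (w v) = 0 := hm 2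
    obtain ⟨v, hv⟩ := mem_span_range_flat_wedge e
      (show c 3 ∈ Submodule.span ℝ (Set.range fun v : V => wedge (flat v) (cayleyForm e)) from hm 3)
    have hv : c 3 = w v := hv
    have hs : s • ψ = c 0 := hs
    have hsr : s = r := by
      simp only [r]
      rw [← hsum, formInner_add_left, formInner_add_left, formInner_add_left, ← hs, h1, h2.1, hv,
        hwψ, formInner_smul_left, hψψ, ← formPairing_apply, map_zero, LinearMap.zero_apply]
      ring
    have hvu : v = u := by
      refine vector_ext e fun i => ?_
      have h4 := hu (e i)
      rw [← hsum, formInner_add_left, formInner_add_left, formInner_add_left, ← hs, h1, h2.2, hv,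
        hww, formInner_smul_left, hψw, ← formPairing_apply, map_zero, LinearMap.zero_apply] at h4
      rw [real_inner_comm, real_inner_comm u]
      linarith
    funext i
    fin_cases i
    · change c 0 = r • ψ
      rw [← hs, hsr]
    · exact h1
    · change c 2 = β - r • ψ - w u
      rw [← hsum, ← hs, h1, hv, hsr, hvu]
      abel
    · change c 3 = w u
      rw [hv, hvu]

end FourForms

/-! ### Five-forms -/

section FiveForms

variable {V : Type*} [NormedAddCommGroup V] [InnerProductSpace ℝ V]
variable (e : OrthonormalBasis (Fin 7) ℝ V)

/-- The five-forms `⋆(eᵢ* ∧ eⱼ*)`. -/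
def mForm (i j : Fin 7) : V [⋀^Fin 5]→ₗ[ℝ] ℝ :=
  hodge e (p := 2) (by norm_num) (wedge (p := 1) (q := 1) (flat (e i)) (flat (e j)))

theorem formInner_flat_wedge_flat (x y : V) (η : V [⋀^Fin 2]→ₗ[ℝ] ℝ) :
    formInner e (wedge (flat x) (flat y)) η = η ![x, y] := by
  refine (formInner_flat_wedge_one e x (flat y) η).trans ?_
  rw [formInner_flat]
  rfl

theorem mForm_apply (i j : Fin 7) (w : Fin 5 → V) :
    mForm e i j w = insertFirst (p := 2) (q := 5) (by norm_num) ![e i, e j] e.toBasis.det w := by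
  rw [mForm, hodge_apply_eq_formInner e (p := 2) (q := 5) _ (by norm_num),
    insertFirst_swap (p := 2) (q := 5) (by norm_num) (by norm_num)]
  exact formInner_flat_wedge_flat e _ _ _

theorem formInner_mForm_right (γ : V [⋀^Fin 5]→ₗ[ℝ] ℝ) (i j : Fin 7) :
    formInner e γ (mForm e i j) = hodge e (q := 2) (by norm_num) γ ![e i, e j] := by
  rw [formInner_comm, mForm, formInner_hodge_left e _ (by norm_num)]
  exact formInner_flat_wedge_flat e _ _ _

/-- The star is an isometry onto two-forms; the factor `1 / 2` is that of ordered pairs. -/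
theorem formInner_five (γ δ : V [⋀^Fin 5]→ₗ[ℝ] ℝ) :
    formInner e γ δ
      = 1 / 2 * ∑ i, ∑ j, formInner e γ (mForm e i j) * formInner e δ (mForm e i j) := by
  rw [← formInner_hodge_hodge e (p := 5) (q := 2) (by norm_num), formInner_two]
  simp only [formInner_mForm_right]

theorem fiveForm_ext {γ δ : V [⋀^Fin 5]→ₗ[ℝ] ℝ}
    (h : ∀ i j, formInner e γ (mForm e i j) = formInner e δ (mForm e i j)) : γ = δ := by
  refine form_ext_formInner e fun η => ?_
  rw [formInner_five, formInner_five e δ]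
  simp only [h]

theorem hodge_cayleyFourForm :
    hodge e (p := 4) (q := 3) (by norm_num) (cayleyFourForm e) = cayleyForm e :=
  hodge_hodge e _ _ _

theorem entry_crossRight_eq_cayleyForm (v : V) (i j : Fin 7) :
    entry e (crossRight e v) i j = cayleyForm e ![e i, e j, v] := by
  have h : cayleyForm e ![e j, v, e i] = cayleyForm e ![e i, e j, v] := by
    have hr := (cayleyForm e).map_perm ![e i, e j, v] (finRotate 3)
    rw [show Equiv.Perm.sign (finRotate 3) = 1 by decide, one_smul] at hr
    rw [← hr]
    congr 1
    funext k; fin_cases k <;> rfl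
  rw [← h, entry, show crossRight e v (e j) = ∑ i, cayleyForm e ![e j, v, e i] • e i from rfl,
    inner_sum]
  simp [inner_smul_right, inner_basis]

theorem formInner_flat_wedge_mForm (v : V) (i j : Fin 7) :
    formInner e (wedge (flat v) (cayleyFourForm e)) (mForm e i j)
      = entry e (crossRight e v) i j := by
  refine (formInner_flat_wedge_four e v _ _).trans ?_
  -- Both forms are `Vol(eᵢ, eⱼ, v, ·)`. Pairing this with `⋆φ` gives `(⋆⋆φ)(eᵢ, eⱼ, v) = φ(eᵢ, eⱼ,
  -- v)`.
  have h2 : interiorProd v (mForm e i j)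
      = insertFirst (p := 3) (q := 4) (by norm_num) ![e i, e j, v] e.toBasis.det := by
    ext h
    rw [interiorProd_apply, mForm_apply, insertFirst_apply, insertFirst_apply]
    congr 1
    funext k; fin_cases k <;> rfl
  rw [h2, ← hodge_apply_eq_formInner e (by norm_num), hodge_cayleyFourForm,
    entry_crossRight_eq_cayleyForm]

/-- The map `p` is the adjoint of `v ↦ A_v` for the sum of products of entries. -/
theorem sum_mul_entry_crossRight (a : V →ₗ[ℝ] V) (v : V) :
    ∑ i, ∑ j, entry e a i j * entry e (crossRight e v) i j = inner ℝ v (pVector e a) := by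
  rw [← e.sum_inner_mul_inner v]
  simp only [inner_pVector, entry_crossRight, Finset.mul_sum]
  rw [Finset.sum_congr rfl fun k _ => Finset.sum_comm, Finset.sum_comm]
  refine Finset.sum_congr rfl fun c _ => Finset.sum_congr rfl fun k _ =>
    Finset.sum_congr rfl fun l _ => ?_
  rw [real_inner_comm v]
  ring

theorem formInner_flat_wedge_five (γ : V [⋀^Fin 5]→ₗ[ℝ] ℝ) (v : V) :
    formInner e γ (wedge (flat v) (cayleyFourForm e))
      = 1 / 2 * ∑ i, ∑ j, formInner e γ (mForm e i j) * entry e (crossRight e v) i j := by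
  refine (formInner_five e γ _).trans ?_
  simp only [← formInner_flat_wedge_mForm]

theorem formInner_flat_wedge_flat_wedge_five (u v : V) :
    formInner e (wedge (flat u) (cayleyFourForm e)) (wedge (flat v) (cayleyFourForm e))
      = 3 * inner ℝ u v := by
  refine (formInner_flat_wedge_five e _ v).trans ?_
  have h : ∀ i j, formInner e (wedge (flat u) (cayleyFourForm e)) (mForm e i j)
      * entry e (crossRight e v) i j
      = entry e (crossRight e u) i j * entry e (crossRight e v) i j := fun i j => by
    exact congrArg (· * _) (formInner_flat_wedge_mForm e u i j)
  rw [Finset.sum_congr rfl fun i _ => Finset.sum_congr rfl fun j _ => h i j,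
    sum_mul_entry_crossRight, pVector_crossRight, inner_smul_right, real_inner_comm]
  ring

/-- The forms `⋆(eᵢ* ∧ eⱼ*)` inherit the pairings of `eᵢ* ∧ eⱼ*`, so `m` sees exactly the skew part
of `a`. -/
theorem formInner_mMap_mForm (a : V →ₗ[ℝ] V) (i j : Fin 7) :
    formInner e (mMap e a) (mForm e i j) = entry e a i j - entry e a j i := by
  have h : ∀ k l, formInner e (mForm e k l) (mForm e i j)
      = (if k = i then 1 else 0) * (if l = j then 1 else 0)
        - (if k = j then 1 else 0) * (if l = i then 1 else 0) := by
    intro k l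
    refine (formInner_hodge_hodge e _ _ _).trans ?_
    refine (formInner_flat_wedge_flat e _ _ _).trans ?_
    refine (flat_wedge_one_apply e _ _ _ _).trans ?_
    simp only [inner_basis, eq_comm]
    try ring
  have h' : formInner e (mMap e a) (mForm e i j)
      = ∑ k, ∑ l, entry e a k l * formInner e (mForm e k l) (mForm e i j) := by
    rw [mMap, formInner_sum_left]
    refine Finset.sum_congr rfl fun i _ => (formInner_sum_left e _ _ _).trans ?_
    exact Finset.sum_congr rfl fun j _ => formInner_smul_left e _ _ _
  rw [h']
  simp only [h, mul_sub, Finset.sum_sub_distrib]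
  simp

theorem mMap_eq_zero_of_symm {a : V →ₗ[ℝ] V} (h : ∀ i j, entry e a i j = entry e a j i) :
    mMap e a = 0 := by
  refine fiveForm_ext e fun i j => ?_
  rw [formInner_mMap_mForm, h i j, ← formPairing_apply, map_zero, LinearMap.zero_apply, sub_self]

theorem formInner_cayleyForm_mForm (u v : V) (i j : Fin 7) :
    formInner e (cayleyForm e) (interiorProd v (interiorProd u (mForm e i j)))
      = cayleyFourForm e ![e i, e j, u, v] := by
  have h : interiorProd v (interiorProd u (mForm e i j))
      = insertFirst (p := 4) (q := 3) (by norm_num) ![e i, e j, u, v] e.toBasis.det := by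
    ext h
    rw [interiorProd_apply, interiorProd_apply, mForm_apply, insertFirst_apply, insertFirst_apply]
    congr 1
    funext k; fin_cases k <;> rfl
  rw [h, cayleyFourForm, hodge_apply_eq_formInner e (p := 3) (q := 4) _ (by norm_num)]

theorem existsUnique_isSplitting_fiveForm (γ : V [⋀^Fin 5]→ₗ[ℝ] ℝ) :
    ∃! c, IsSplitting (fiveFormModule e) γ c := by
  let w : V → V [⋀^Fin 5]→ₗ[ℝ] ℝ := fun v => wedge (flat v) (cayleyFourForm e)
  have hww : ∀ u v, formInner e (w u) (w v) = 3 * inner ℝ u v :=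
    formInner_flat_wedge_flat_wedge_five e
  have hws : ∀ v, w v = ∑ i, inner ℝ (e i) v • w (e i) := flat_wedge_sum e _
  -- Orthogonal projection, with `3` the squared norm of `eᵢ* ∧ ⋆φ`.
  let u : V := ∑ i, (1 / 3 * formInner e γ (w (e i))) • e i
  have hu : ∀ v, formInner e γ (w v) = 3 * inner ℝ u v := by
    intro v
    rw [hws v, formInner_sum_right, sum_inner, Finset.mul_sum]
    refine Finset.sum_congr rfl fun i _ => ?_
    rw [formInner_smul_right, real_inner_smul_left]
    ring
  refine ⟨![0, γ - w u, 0, w u], ⟨fun i => ?_, ?_⟩, fun c hc => ?_⟩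
  · fin_cases i
    · exact Submodule.zero_mem _
    · intro v
      change formInner e (γ - w u) (w v) = 0
      rw [formInner_sub_left, hww, hu, sub_self]
    · exact Submodule.zero_mem _
    · exact Submodule.subset_span ⟨u, rfl⟩
  · rw [Fin.sum_univ_four]
    simp only [Matrix.cons_val]
    abel
  · obtain ⟨hm, hsum⟩ := hc
    rw [Fin.sum_univ_four] at hsum
    have h0 : c 0 = 0 := (Submodule.mem_bot ℝ).1 (hm 0)
    have h1 : ∀ v, formInner e (c 1) (w v) = 0 := hm 1
    have h2 : c 2 = 0 := (Submodule.mem_bot ℝ).1 (hm 2)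
    obtain ⟨v, hv⟩ := mem_span_range_flat_wedge e
      (show c 3 ∈ Submodule.span ℝ (Set.range fun v : V => wedge (flat v) (cayleyFourForm e))
        from hm 3)
    have hv : c 3 = w v := hv
    rw [h0, h2, zero_add, add_zero] at hsum
    have hvu : v = u := by
      refine vector_ext e fun i => ?_
      have h4 := hu (e i)
      rw [← hsum, formInner_add_left, h1, hv, hww] at h4
      rw [real_inner_comm, real_inner_comm u]
      linarith
    funext i
    fin_cases i
    · exact h0
    · change c 1 = γ - w u
      rw [← hsum, hv, hvu]
      abel
    · exact h2
    · change c 3 = w u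
      rw [hv, hvu]

end FiveForms

/-! ### The exterior derivatives in terms of the torsion -/

section Torsion

variable {V : Type*} [NormedAddCommGroup V] [InnerProductSpace ℝ V]
variable (e : OrthonormalBasis (Fin 7) ℝ V)

/-- The alternation of `X ↦ ξ_X · α`. If `α` is parallel for a connection whose difference with a
torsion-free one is `ξ`, this is `dα`. -/
def torsionDeriv {p : ℕ} (α : V [⋀^Fin p]→ₗ[ℝ] ℝ) (ξ : V →ₗ[ℝ] V →ₗ[ℝ] V) :
    V [⋀^Fin (p + 1)]→ₗ[ℝ] ℝ :=
  AlternatingMap.alternatizeUncurryFin (derivActionL α ∘ₗ ξ)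

variable (T : V →ₗ[ℝ] V)

/-- The transpose of an endomorphism. -/
def transposeEnd : V →ₗ[ℝ] V := endOfEntries e fun i j => entry e T j i

theorem entry_transposeEnd (i j : Fin 7) : entry e (transposeEnd e T) i j = entry e T j i :=
  entry_endOfEntries e _ i j

theorem pVector_transposeEnd : pVector e (transposeEnd e T) = - pVector e T := by
  refine vector_ext e fun c => ?_
  rw [inner_neg_right, inner_pVector, inner_pVector, Finset.sum_comm, ← Finset.sum_neg_distrib]
  refine Finset.sum_congr rfl fun k _ => ?_
  rw [← Finset.sum_neg_distrib]
  refine Finset.sum_congr rfl fun l _ => ?_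
  rw [entry_transposeEnd, eps_swap]
  ring

/-- The alternation is `3 ∑ e_m* ∧ (T(e_m) ⌟ ⋆φ)`. The coefficient of `e_m* ∧ (e_c ⌟ ⋆φ)` is
`T_{cm}`, which is why the transpose appears. -/
theorem torsionDeriv_cayleyForm :
    torsionDeriv (cayleyForm e) (torsionOf e T) = (3 : ℝ) • kMap e (transposeEnd e T) := by
  refine form_ext_formInner e fun η => ?_
  rw [torsionDeriv, formInner_alternatizeUncurryFin, formInner_smul_left, formInner_kMap_left,
    Finset.mul_sum]
  refine Finset.sum_congr rfl fun m _ => ?_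
  have h : (derivActionL (cayleyForm e) ∘ₗ torsionOf e T) (e m)
      = (3 : ℝ) • interiorProd (T (e m)) (cayleyFourForm e) :=
    derivAction_crossRight_cayleyForm e (T (e m))
  rw [h, formInner_smul_left, interiorProd_sum e, formInner_sum_left]
  congr 1
  refine Finset.sum_congr rfl fun c _ => ?_
  rw [formInner_smul_left, formInner_kForm_left, entry_transposeEnd, entry]

theorem formInner_torsionDeriv_kForm (i j : Fin 7) :
    formInner e (torsionDeriv (cayleyForm e) (torsionOf e T)) (kForm e i j)
      = 3 * (entry e T i j + entry e T j i + (if i = j then 2 * ∑ k, entry e T k k else 0)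
        - entry e (crossRight e (pVector e T)) i j) := by
  rw [torsionDeriv_cayleyForm, formInner_smul_left, formInner_kMap_kForm, pVector_transposeEnd,
    show crossRight e (-pVector e T) = (-1 : ℝ) • crossRight e (pVector e T) by
      rw [neg_one_smul]; exact map_neg (cross e).flip _, entry_smul]
  simp only [entry_transposeEnd]
  ring

theorem entry_crossRight_self (v : V) (i : Fin 7) : entry e (crossRight e v) i i = 0 := by
  linarith [(crossRight_mem_lieG2Perp e v).1 i i]

/-- Pairing with `4 ⋆φ = k(Id)` sums the diagonal pairings. As `84 = 7 · 12`, this gives the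
constant of the first component. -/
theorem formInner_torsionDeriv_cayleyFourForm :
    formInner e (torsionDeriv (cayleyForm e) (torsionOf e T)) (cayleyFourForm e)
      = 12 * ∑ k, entry e T k k := by
  have h : 4 * formInner e (torsionDeriv (cayleyForm e) (torsionOf e T)) (cayleyFourForm e)
      = 48 * ∑ k, entry e T k k := by
    rw [← formInner_smul_right, ← kMap_id, formInner_comm, formInner_kMap_left]
    simp only [formInner_comm e (kForm e _ _), formInner_torsionDeriv_kForm, entry_id, ite_mul,
      one_mul, zero_mul, Finset.sum_ite_eq, Finset.mem_univ, if_true, entry_crossRight_self,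
      ← Finset.mul_sum, Finset.sum_add_distrib, sub_zero, Finset.sum_const, Finset.card_univ,
      Fintype.card_fin, nsmul_eq_mul]
    push_cast
    ring
  linarith

theorem formInner_torsionDeriv_flat_wedge (v : V) :
    formInner e (torsionDeriv (cayleyForm e) (torsionOf e T))
      (wedge (p := 1) (q := 3) (flat v) (cayleyForm e)) = -6 * inner ℝ v (pVector e T) := by
  rw [torsionDeriv_cayleyForm]
  refine (formInner_smul_left e _ _ _).trans ?_
  rw [formInner_kMap_flat_wedge, pVector_transposeEnd, inner_neg_right]
  ring

theorem oneForm_ext {α β : V [⋀^Fin 1]→ₗ[ℝ] ℝ} (h : ∀ v, α (fun _ => v) = β (fun _ => v)) :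
    α = β := by
  ext w
  rw [show w = fun _ => w 0 by funext k; rw [Subsingleton.elim k 0]]
  exact h _

theorem pdStar_apply (β : V [⋀^Fin 4]→ₗ[ℝ] ℝ) (v : V) :
    pdStar e β (fun _ => v) = - formInner e β (wedge (flat v) (cayleyForm e)) :=
  hodge_hodge_wedge_three e _ _ β _ v

theorem pdStar_torsionDeriv :
    pdStar e (torsionDeriv (cayleyForm e) (torsionOf e T)) = flat ((6 : ℝ) • pVector e T) := by
  refine oneForm_ext fun v => (pdStar_apply e _ v).trans ?_
  refine (congrArg Neg.neg (formInner_torsionDeriv_flat_wedge e T v)).trans ?_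
  rw [show flat ((6 : ℝ) • pVector e T) (fun _ => v) = inner ℝ ((6 : ℝ) • pVector e T) v from rfl,
    real_inner_smul_left, real_inner_comm]
  ring

theorem sharp_flat (v : V) : sharp e (flat v) = v := by
  refine Eq.trans ?_ (e.sum_repr' v)
  refine Finset.sum_congr rfl fun i _ => ?_
  rw [real_inner_comm]
  rfl

theorem sharp_pdStar_torsionDeriv :
    sharp e (pdStar e (torsionDeriv (cayleyForm e) (torsionOf e T))) = (6 : ℝ) • pVector e T := by
  rw [pdStar_torsionDeriv, sharp_flat]

theorem cayleyFourForm_apply_vec (i j k l : Fin 7) :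
    cayleyFourForm e ![e i, e j, e k, e l] = (psiInt i j k l : ℝ) := by
  obtain ⟨f, h0, h1, h2, h3⟩ : ∃ f : Fin 4 → Fin 7, f 0 = i ∧ f 1 = j ∧ f 2 = k ∧ f 3 = l :=
    ⟨![i, j, k, l], rfl, rfl, rfl, rfl⟩
  have h := cayleyFourForm_apply_basis e f
  rw [h0, h1, h2, h3] at h
  rw [← h]
  congr 1
  funext m
  fin_cases m
  · exact congrArg e h0.symm
  · exact congrArg e h1.symm
  · exact congrArg e h2.symm
  · exact congrArg e h3.symm

/-- By `A_v · ⋆φ = -3 v* ∧ φ` the left-hand side is `-3 ∑ T_{cm} ψ_{ijmc}`; expanding `ψ` gives the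
skew part of `T` and `A_{p(T)}`. -/
theorem formInner_torsionDeriv_mForm (i j : Fin 7) :
    formInner e (torsionDeriv (cayleyFourForm e) (torsionOf e T)) (mForm e i j)
      = 3 * (entry e T i j - entry e T j i)
        - 3 * entry e (crossRight e (pVector e T)) i j := by
  rw [torsionDeriv, formInner_alternatizeUncurryFin]
  have h : ∀ m, formInner e ((derivActionL (cayleyFourForm e) ∘ₗ torsionOf e T) (e m))
      (interiorProd (e m) (mForm e i j)) = -3 * ∑ c, entry e T c m * (psiInt i j m c : ℝ) := by
    intro m
    have h1 : (derivActionL (cayleyFourForm e) ∘ₗ torsionOf e T) (e m)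
        = (-3 : ℝ) • wedge (flat (T (e m))) (cayleyForm e) :=
      derivAction_crossRight_cayleyFourForm e (T (e m))
    rw [h1, formInner_smul_left]
    refine (congrArg (fun t => -3 * t) (formInner_flat_wedge_three e _ _ _)).trans ?_
    rw [interiorProd_sum e, formInner_sum_right]
    congr 1
    refine Finset.sum_congr rfl fun c _ => ?_
    rw [formInner_smul_right, formInner_cayleyForm_mForm, cayleyFourForm_apply_vec, entry]
  simp only [h]
  -- The sign is due to the order `m, c` in `ε`, opposite to that of the indices of `T`.
  have h2 : ∑ m, ∑ c, entry e T c m * ∑ a, (epsInt i j a : ℝ) * (epsInt m c a : ℝ)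
      = - entry e (crossRight e (pVector e T)) i j := by
    simp only [entry_crossRight, inner_pVector, Finset.mul_sum]
    rw [Finset.sum_congr rfl fun k _ => Finset.sum_comm, Finset.sum_comm,
      ← Finset.sum_neg_distrib]
    refine Finset.sum_congr rfl fun a _ => ?_
    rw [Finset.sum_comm, ← Finset.sum_neg_distrib]
    refine Finset.sum_congr rfl fun k _ => ?_
    rw [← Finset.sum_neg_distrib]
    refine Finset.sum_congr rfl fun l _ => ?_
    rw [eps_swap l k]
    ring
  rw [← Finset.mul_sum]
  simp only [psi_eq, mul_sub, Finset.sum_sub_distrib, h2]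
  simp
  ring

/-- The coefficient is `(3 + 3 - 3 · 6) / 2 = -6`. It agrees with that of
`formInner_torsionDeriv_flat_wedge`, which is why `dφ` and `d⋆φ` yield the same one-form up to the
sign of the star formulas. -/
theorem formInner_torsionDeriv_flat_wedge_five (v : V) :
    formInner e (torsionDeriv (cayleyFourForm e) (torsionOf e T))
      (wedge (p := 1) (q := 4) (flat v) (cayleyFourForm e)) = -6 * inner ℝ v (pVector e T) := by
  refine (formInner_flat_wedge_five e _ v).trans ?_
  have h1 := sum_mul_entry_crossRight e T v
  have h2 := sum_mul_entry_crossRight e (transposeEnd e T) v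
  have h3 := sum_mul_entry_crossRight e (crossRight e (pVector e T)) v
  rw [pVector_crossRight, inner_smul_right] at h3
  rw [pVector_transposeEnd, inner_neg_right] at h2
  simp only [entry_transposeEnd] at h2
  simp only [formInner_torsionDeriv_mForm, sub_mul, mul_assoc, Finset.sum_sub_distrib,
    ← Finset.mul_sum, h1, h2, h3]
  linarith

theorem neg_hodge_torsionDeriv (h₁ : 2 + 4 + 1 = 7) (h₂ : 5 + 2 = 7) :
    - hodge e (p := 2 + 4) (q := 1) h₁ (wedge (hodge e (q := 2) h₂
      (torsionDeriv (cayleyFourForm e) (torsionOf e T))) (cayleyFourForm e))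
      = flat ((6 : ℝ) • pVector e T) := by
  refine oneForm_ext fun v => ?_
  rw [AlternatingMap.neg_apply]
  refine (congrArg Neg.neg (hodge_hodge_wedge_four e _ _ _ _ v)).trans ?_
  refine (congrArg Neg.neg (formInner_torsionDeriv_flat_wedge_five e T v)).trans ?_
  rw [show flat ((6 : ℝ) • pVector e T) (fun _ => v) = inner ℝ ((6 : ℝ) • pVector e T) v from rfl,
    real_inner_smul_left, real_inner_comm]
  ring

theorem entry_sum_erase (x : Fin 7 → Fin 7 → ℝ) (a : Fin 7 → Fin 7 → V →ₗ[ℝ] V) (k l : Fin 7) :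
    entry e (∑ i : Fin 7, ∑ j ∈ Finset.univ.erase i, x i j • a i j) k l
      = ∑ i, ∑ j, x i j * entry e (a i j) k l - ∑ i, x i i * entry e (a i i) k l := by
  rw [entry_sum, ← Finset.sum_sub_distrib]
  refine Finset.sum_congr rfl fun i _ => ?_
  rw [entry_sum, Finset.sum_erase_eq_sub (Finset.mem_univ i)]
  simp only [entry_smul]

theorem entry_endSplitting_zero (i j : Fin 7) :
    entry e (endSplitting e T 0) i j = if i = j then 1 / 7 * ∑ k, entry e T k k else 0 := by
  change entry e ((1 / 7 * ∑ i, entry e T i i) • LinearMap.id) i j = _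
  rw [entry_smul, entry_id]
  simp

theorem entry_endSplitting_one (i j : Fin 7) :
    entry e (endSplitting e T 1) i j = (entry e T i j - entry e T j i) / 2
      - 1 / 6 * entry e (crossRight e (pVector e T)) i j := by
  change entry e (endOfEntries e (fun i j => (entry e T i j - entry e T j i) / 2)
      - (1 / 6 : ℝ) • crossRight e (pVector e T)) i j = _
  rw [entry_sub, entry_smul, entry_endOfEntries]

theorem entry_endSplitting_two (i j : Fin 7) :
    entry e (endSplitting e T 2) i j = (entry e T i j + entry e T j i) / 2
      - if i = j then 1 / 7 * ∑ k, entry e T k k else 0 := by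
  change entry e (endOfEntries e (fun i j => (entry e T i j + entry e T j i) / 2)
      - (1 / 7 * ∑ i, entry e T i i) • LinearMap.id) i j = _
  rw [entry_sub, entry_smul, entry_endOfEntries, entry_id]
  simp

theorem entry_endSplitting_three (i j : Fin 7) :
    entry e (endSplitting e T 3) i j
      = 1 / 6 * entry e (crossRight e (pVector e T)) i j :=
  entry_smul e _ _ _ _

/-- The correction `(1/3) pd⋆φ ∧ ⋆φ` contributes `2 A_{p(T)}`, so the coefficients become `3 (T -
Tᵗ) - A_{p(T)} = 6 T₍₂₎`. The sum over ordered pairs doubles this skew matrix, whence `1 / 12`. -/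
theorem endSplitting_one_eq :
    endSplitting e T 1 = (1 / 12 : ℝ) • ∑ i : Fin 7, ∑ j ∈ Finset.univ.erase i,
      formInner e (torsionDeriv (cayleyFourForm e) (torsionOf e T)
        + (1 / 3 : ℝ) • wedge (flat ((6 : ℝ) • pVector e T)) (cayleyFourForm e)) (mForm e i j) •
      (tensor (e i) (e j) - tensor (e j) (e i)) := by
  have h : ∀ i j, formInner e (torsionDeriv (cayleyFourForm e) (torsionOf e T)
        + (1 / 3 : ℝ) • wedge (flat ((6 : ℝ) • pVector e T)) (cayleyFourForm e)) (mForm e i j)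
      = 3 * (entry e T i j - entry e T j i) - entry e (crossRight e (pVector e T)) i j := by
    intro i j
    refine (formInner_add_left e _ _ _).trans ?_
    rw [formInner_torsionDeriv_mForm]
    refine (congrArg (fun t => _ + t) ((formInner_smul_left e _ _ _).trans
      (congrArg (fun t => 1 / 3 * t) (formInner_flat_wedge_mForm e _ i j)))).trans ?_
    rw [show crossRight e ((6 : ℝ) • pVector e T) = (6 : ℝ) • crossRight e (pVector e T) from
      map_smul _ _ _, entry_smul]
    ring
  refine end_ext e fun k l => ?_
  rw [entry_smul, entry_sum_erase]
  simp only [h, entry_sub, entry_tensor, entry_endSplitting_one]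
  simp only [sub_self, mul_zero, Finset.sum_const_zero, sub_zero, mul_sub, Finset.sum_sub_distrib]
  simp
  rw [(crossRight_mem_lieG2Perp e (pVector e T)).1 l k]
  ring

/-- The multiple `4 / 7` of `⋆φ` is the one for which the diagonal coefficient is `6 (Tᵢᵢ - tr T /
7)`. Off the diagonal the coefficient is `12` times the symmetric part, doubled by the ordered
pairs. -/
theorem endSplitting_two_eq :
    endSplitting e T 2 = (1 / 6 : ℝ) • ∑ i : Fin 7,
        formInner e (torsionDeriv (cayleyForm e) (torsionOf e T))
          (kForm e i i - (4 / 7 : ℝ) • cayleyFourForm e) • tensor (e i) (e i)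
      + (1 / 24 : ℝ) • ∑ i : Fin 7, ∑ j ∈ Finset.univ.erase i,
        formInner e (torsionDeriv (cayleyForm e) (torsionOf e T))
          (kForm e i j + kForm e j i) • (tensor (e i) (e j) + tensor (e j) (e i)) := by
  have h1 : ∀ i, formInner e (torsionDeriv (cayleyForm e) (torsionOf e T))
      (kForm e i i - (4 / 7 : ℝ) • cayleyFourForm e)
      = 6 * entry e T i i - 6 / 7 * ∑ k, entry e T k k := by
    intro i
    rw [formInner_sub_right, formInner_smul_right, formInner_torsionDeriv_kForm,
      formInner_torsionDeriv_cayleyFourForm, if_pos rfl, entry_crossRight_self]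
    ring
  have h2 : ∀ i j, formInner e (torsionDeriv (cayleyForm e) (torsionOf e T))
      (kForm e i j + kForm e j i)
      = 6 * (entry e T i j + entry e T j i) + if i = j then 12 * ∑ k, entry e T k k else 0 := by
    intro i j
    rw [formInner_add_right, formInner_torsionDeriv_kForm, formInner_torsionDeriv_kForm,
      (crossRight_mem_lieG2Perp e (pVector e T)).1 j i]
    simp only [eq_comm (a := j)]
    split_ifs <;> ring
  refine end_ext e fun k l => ?_
  rw [entry_endSplitting_two]
  generalize ht : ∑ k, entry e T k k = t at *
  rw [entry_add, entry_smul, entry_smul, entry_sum_erase, entry_sum]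
  simp only [h1, h2, entry_smul, entry_add, entry_tensor]
  by_cases hkl : k = l
  · subst hkl
    simp [mul_add, Finset.sum_add_distrib]
    ring
  · have hlk : l ≠ k := fun h => hkl h.symm
    simp [mul_add, Finset.sum_add_distrib, hkl, hlk]
    ring

theorem kMap_sub (a b : V →ₗ[ℝ] V) : kMap e (a - b) = kMap e a - kMap e b := by
  rw [sub_eq_add_neg, ← neg_one_smul ℝ b, kMap_add, kMap_smul]
  module

theorem mMap_smul (c : ℝ) (a : V →ₗ[ℝ] V) : mMap e (c • a) = c • mMap e a := by
  simp only [mMap, entry_smul, Finset.smul_sum, mul_smul]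

theorem endSplitting_mem (i : Fin 4) : endSplitting e T i ∈ endModule e i :=
  (isSplitting_endSplitting e T).1 i

theorem kMap_endSplitting_one : kMap e (endSplitting e T 1) = 0 :=
  kMap_eq_zero_of_mem_lieG2 e (endSplitting_mem e T 1)

theorem isSplitting_torsionDeriv_cayleyForm :
    IsSplitting (fourFormModule e) (torsionDeriv (cayleyForm e) (torsionOf e T))
      ![(3 : ℝ) • kMap e (endSplitting e T 0), 0, (3 : ℝ) • kMap e (endSplitting e T 2),
        (-3 : ℝ) • kMap e (endSplitting e T 3)] := by
  refine ⟨fun i => ?_, ?_⟩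
  · fin_cases i
    · refine Submodule.smul_mem _ _ ?_
      change kMap e ((1 / 7 * ∑ i, entry e T i i) • LinearMap.id) ∈
        Submodule.span ℝ {cayleyFourForm e}
      rw [kMap_smul, kMap_id]
      exact Submodule.smul_mem _ _ (Submodule.smul_mem _ _ (Submodule.mem_span_singleton_self _))
    · exact Submodule.zero_mem _
    · exact Submodule.smul_mem _ _ (kMap_mem_fourForms27 e (endSplitting_mem e T 2))
    · refine Submodule.smul_mem _ _ ?_
      change kMap e ((1 / 6 : ℝ) • crossRight e (pVector e T)) ∈
        Submodule.span ℝ (Set.range fun v : V => wedge (flat v) (cayleyForm e))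
      rw [kMap_smul, kMap_crossRight]
      exact Submodule.smul_mem _ _ (Submodule.smul_mem _ _ (Submodule.subset_span ⟨_, rfl⟩))
  -- Transposition changes the sign of the two skew components; `k` then annihilates the one in
  -- `𝔤₂`.
  · have h : transposeEnd e T = endSplitting e T 0 + endSplitting e T 2 - endSplitting e T 1
        - endSplitting e T 3 := by
      refine end_ext e fun i j => ?_
      rw [entry_transposeEnd, entry_sub, entry_sub, entry_add, entry_endSplitting_zero,
        entry_endSplitting_one, entry_endSplitting_two, entry_endSplitting_three]
      ring
    rw [torsionDeriv_cayleyForm, h, kMap_sub, kMap_sub, kMap_add, kMap_endSplitting_one,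
      Fin.sum_univ_four]
    simp only [Matrix.cons_val]
    module

theorem mMap_crossRight (v : V) :
    mMap e (crossRight e v) = (2 : ℝ) • wedge (flat v) (cayleyFourForm e) := by
  refine fiveForm_ext e fun i j => ?_
  rw [formInner_mMap_mForm, (crossRight_mem_lieG2Perp e v).1 j i]
  refine Eq.trans ?_ (formInner_smul_left e _ _ _).symm
  rw [formInner_flat_wedge_mForm]
  ring

theorem mMap_mem_fiveForms14 {a : V →ₗ[ℝ] V} (ha : a ∈ lieG2 e) : mMap e a ∈ fiveForms14 e := by
  obtain ⟨hs, hp⟩ := (mem_lieG2_iff e).1 ha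
  intro v
  refine (formInner_flat_wedge_five e _ v).trans ?_
  have h : ∀ i j, formInner e (mMap e a) (mForm e i j) * entry e (crossRight e v) i j
      = 2 * (entry e a i j * entry e (crossRight e v) i j) := by
    intro i j
    rw [formInner_mMap_mForm, hs j i]
    ring
  simp only [h, ← Finset.mul_sum, sum_mul_entry_crossRight, hp, inner_zero_right, mul_zero]

theorem isSplitting_torsionDeriv_cayleyFourForm :
    IsSplitting (fiveFormModule e) (torsionDeriv (cayleyFourForm e) (torsionOf e T))
      ![0, (3 : ℝ) • mMap e (endSplitting e T 1), 0, (-6 : ℝ) • mMap e (endSplitting e T 3)] := by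
  refine ⟨fun i => ?_, ?_⟩
  · fin_cases i
    · exact Submodule.zero_mem _
    · exact Submodule.smul_mem _ _ (mMap_mem_fiveForms14 e (endSplitting_mem e T 1))
    · exact Submodule.zero_mem _
    · refine Submodule.smul_mem _ _ ?_
      change mMap e ((1 / 6 : ℝ) • crossRight e (pVector e T)) ∈
        Submodule.span ℝ (Set.range fun v : V => wedge (flat v) (cayleyFourForm e))
      rw [mMap_smul, mMap_crossRight]
      exact Submodule.smul_mem _ _ (Submodule.smul_mem _ _ (Submodule.subset_span ⟨_, rfl⟩))
  · rw [Fin.sum_univ_four]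
    simp only [Matrix.cons_val]
    rw [zero_add, add_zero]
    refine fiveForm_ext e fun i j => ?_
    rw [formInner_add_left, formInner_smul_left, formInner_smul_left, formInner_mMap_mForm,
      formInner_mMap_mForm, formInner_torsionDeriv_mForm, entry_endSplitting_one,
      entry_endSplitting_one, entry_endSplitting_three, entry_endSplitting_three,
      (crossRight_mem_lieG2Perp e (pVector e T)).1 j i]
    ring

theorem entry_crossRight_add (v : V) (i : Fin 7) :
    entry e (crossRight e v) (i + 1) (i + 3) = inner ℝ (e i) v ∧
    entry e (crossRight e v) (i + 4) (i + 5) = inner ℝ (e i) v ∧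
    entry e (crossRight e v) (i + 2) (i + 6) = inner ℝ (e i) v := by
  have h : ∀ i k : Fin 7, epsInt (i + 1) (i + 3) k = (if i = k then 1 else 0) ∧
      epsInt (i + 4) (i + 5) k = (if i = k then 1 else 0) ∧
      epsInt (i + 2) (i + 6) k = (if i = k then 1 else 0) := by decide +kernel
  simp [entry_crossRight, (h i _).1, (h i _).2.1, (h i _).2.2]

/-- Antisymmetrising removes the symmetric part and the trace. Only `A_{p(T)}` remains, whose
entries at the three distinguished pairs coincide. -/
theorem kPairing_torsionDeriv_sub (i j : Fin 7) :
    -(kPairing e (torsionDeriv (cayleyForm e) (torsionOf e T)) i j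
      - kPairing e (torsionDeriv (cayleyForm e) (torsionOf e T)) j i)
      = 6 * entry e (crossRight e (pVector e T)) i j := by
  have h : ∀ i j, kPairing e (torsionDeriv (cayleyForm e) (torsionOf e T)) i j = _ :=
    formInner_torsionDeriv_kForm e T
  rw [h, h, (crossRight_mem_lieG2Perp e (pVector e T)).1 j i]
  simp only [eq_comm (a := j)]
  ring

end Torsion

/-! ### The components of the torsion -/

/-- The pointwise content of the theorem: the only geometric input is that `β` and `γ` are the
alternations of `ξ · φ` and `ξ · ⋆φ`. -/
theorem torsion_components {V : Type*} [NormedAddCommGroup V] [InnerProductSpace ℝ V]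
    (e : OrthonormalBasis (Fin 7) ℝ V) {ξ : V →ₗ[ℝ] V →ₗ[ℝ] V} {β : V [⋀^Fin 4]→ₗ[ℝ] ℝ}
    {γ : V [⋀^Fin 5]→ₗ[ℝ] ℝ} {ψ : V [⋀^Fin 4]→ₗ[ℝ] ℝ} (hψ : ψ = cayleyFourForm e)
    (hξ : ∀ X, ξ X ∈ lieG2Perp e) (hβ : β = torsionDeriv (cayleyForm e) ξ)
    (hγ : γ = torsionDeriv (cayleyFourForm e) ξ) :
    (∀ a : V →ₗ[ℝ] V,
      ∃! c, IsSplitting (endModule e) a c) ∧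
    (∀ η : V [⋀^Fin 4]→ₗ[ℝ] ℝ, ∃! c, IsSplitting (fourFormModule e) η c) ∧
    (∀ η : V [⋀^Fin 5]→ₗ[ℝ] ℝ, ∃! c, IsSplitting (fiveFormModule e) η c) ∧
    (∃! c, IsSplitting (torsionModule e) (ξ) c) ∧
    pdStar e β =
      - hodge e (p := 2 + 4) (by norm_num)
          (wedge (hodge e (q := 2) (by norm_num) γ) ψ) ∧
    ∃ T : V →ₗ[ℝ] V,
      (∀ X Y, ξ X Y = cross e Y (T X)) ∧
      (∀ T' : V →ₗ[ℝ] V,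
        (∀ X Y, ξ X Y = cross e Y (T' X)) → T' = T) ∧
      -- the first components
      component (endModule e) T 0
        = (1 / 84 * formInner e β ψ) • LinearMap.id ∧
      (∀ X Y, component (torsionModule e) (ξ) 0 X Y
        = (1 / 84 * formInner e β ψ) • cross e Y X) ∧
      -- the second components
      component (endModule e) T 1
        = (1 / 12 : ℝ) • ∑ i : Fin 7, ∑ j ∈ Finset.univ.erase i,
            formInner e
              (γ + (1 / 3 : ℝ) • wedge (pdStar e β) ψ)
              (hodge e (p := 1 + 1) (by norm_num) (wedge (flat (e i)) (flat (e j)))) •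
            (tensor (e i) (e j) - tensor (e j) (e i)) ∧
      (∀ X Y, component (torsionModule e) (ξ) 1 X Y
        = cross e Y (component (endModule e) T 1 X)) ∧
      -- the third components
      component (endModule e) T 2
        = (1 / 6 : ℝ) • ∑ i : Fin 7,
            formInner e β
              (wedge (flat (e i)) (interiorProd (e i) ψ) - (4 / 7 : ℝ) • ψ) •
            tensor (e i) (e i)
          + (1 / 24 : ℝ) • ∑ i : Fin 7, ∑ j ∈ Finset.univ.erase i,
            formInner e β
              (wedge (flat (e i)) (interiorProd (e j) ψ)
                + wedge (flat (e j)) (interiorProd (e i) ψ)) •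
            (tensor (e i) (e j) + tensor (e j) (e i)) ∧
      (∀ X Y, component (torsionModule e) (ξ) 2 X Y
        = cross e Y (component (endModule e) T 2 X)) ∧
      -- the fourth components
      component (endModule e) T 3 = (1 / 36 : ℝ) • crossRight e (sharp e (pdStar e β)) ∧
      (∀ X Y, component (torsionModule e) (ξ) 3 X Y
        = (1 / 36 : ℝ) • cross e Y (cross e X (sharp e (pdStar e β)))) ∧
      sharp e (pdStar e β) = (6 : ℝ) • pVector e T ∧
      (∀ i : Fin 7,
        inner ℝ (e i) (sharp e (pdStar e β))
          = -(kPairing e β (i + 1) (i + 3) - kPairing e β (i + 3) (i + 1)) ∧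
        inner ℝ (e i) (sharp e (pdStar e β))
          = -(kPairing e β (i + 4) (i + 5) - kPairing e β (i + 5) (i + 4)) ∧
        inner ℝ (e i) (sharp e (pdStar e β))
          = -(kPairing e β (i + 2) (i + 6) - kPairing e β (i + 6) (i + 2))) ∧
      -- the components of the exterior derivatives
      component (fourFormModule e) β 0
        = (3 : ℝ) • kMap e (component (endModule e) T 0) ∧
      component (fourFormModule e) β 2
        = (3 : ℝ) • kMap e (component (endModule e) T 2) ∧
      component (fourFormModule e) β 3
        = (-3 : ℝ) • kMap e (component (endModule e) T 3) ∧
      kMap e (component (endModule e) T 1) = 0 ∧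
      component (fiveFormModule e) γ 1
        = (3 : ℝ) • mMap e (component (endModule e) T 1) ∧
      component (fiveFormModule e) γ 3
        = (-6 : ℝ) • mMap e (component (endModule e) T 3) ∧
      mMap e (component (endModule e) T 0) = 0 ∧
      mMap e (component (endModule e) T 2) = 0 := by
  obtain ⟨T, rfl⟩ := exists_eq_torsionOf e ξ hξ
  subst hψ hβ hγ
  have hT : ∀ i, component (endModule e) T i = endSplitting e T i :=
    fun i => congrFun (component_end e T) i
  have hB := component_eq (existsUnique_isSplitting_fourForm e _)
    (isSplitting_torsionDeriv_cayleyForm e T)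
  have hC := component_eq (existsUnique_isSplitting_fiveForm e _)
    (isSplitting_torsionDeriv_cayleyFourForm e T)
  have hx : ∀ i X Y, component (torsionModule e) (torsionOf e T) i X Y
      = cross e Y (endSplitting e T i X) := fun i X Y => by
    rw [component_torsion]; rfl
  have h84 : 1 / 84 * formInner e (torsionDeriv (cayleyForm e) (torsionOf e T)) (cayleyFourForm e)
      = 1 / 7 * ∑ k, entry e T k k := by
    rw [formInner_torsionDeriv_cayleyFourForm]; ring
  refine ⟨existsUnique_isSplitting_end e, existsUnique_isSplitting_fourForm e,
    existsUnique_isSplitting_fiveForm e, existsUnique_isSplitting_torsion e T,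
    (pdStar_torsionDeriv e T).trans (neg_hodge_torsionDeriv e T _ _).symm, T, fun X Y => rfl,
    fun T' h => ?_, ?_, fun X Y => ?_, ?_, fun X Y => ?_, ?_, fun X Y => ?_, ?_, fun X Y => ?_,
    sharp_pdStar_torsionDeriv e T, fun i => ?_, ?_, ?_, ?_, ?_, ?_, ?_, ?_, ?_⟩
  · refine torsionOf_injective e (LinearMap.ext fun X => LinearMap.ext fun Y => ?_)
    exact (h X Y).symm
  · rw [hT, h84]; rfl
  · rw [hx, h84]
    exact map_smul (cross e Y) _ _
  · rw [hT, pdStar_torsionDeriv]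
    exact endSplitting_one_eq e T
  · rw [hT, hx]
  · rw [hT]
    exact endSplitting_two_eq e T
  · rw [hT, hx]
  · rw [hT, sharp_pdStar_torsionDeriv]
    change (1 / 6 : ℝ) • crossRight e (pVector e T) = _
    rw [show crossRight e ((6 : ℝ) • pVector e T) = (6 : ℝ) • crossRight e (pVector e T) from
      map_smul _ _ _, smul_smul]
    norm_num
  · rw [hx, sharp_pdStar_torsionDeriv, map_smul, map_smul, smul_smul]
    change cross e Y ((1 / 6 : ℝ) • cross e X (pVector e T)) = _
    rw [map_smul]
    norm_num
  · obtain ⟨h1, h2, h3⟩ := entry_crossRight_add e (pVector e T) i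
    rw [kPairing_torsionDeriv_sub, kPairing_torsionDeriv_sub, kPairing_torsionDeriv_sub, h1, h2, h3,
      sharp_pdStar_torsionDeriv, inner_smul_right]
    exact ⟨rfl, rfl, rfl⟩
  · rw [hT]; exact congrFun hB 0
  · rw [hT]; exact congrFun hB 2
  · rw [hT]; exact congrFun hB 3
  · rw [hT]; exact kMap_endSplitting_one e T
  · rw [hT]; exact congrFun hC 1
  · rw [hT]; exact congrFun hC 3
  · rw [hT]; exact mMap_eq_zero_of_symm e fun i j => by
      simp only [entry_endSplitting_zero, eq_comm]
  · rw [hT]; exact mMap_eq_zero_of_symm e (endSplitting_mem e T 2).1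

/-! ### The derivation action as an alternation -/

section Alternation

variable {V : Type*} [AddCommGroup V] [Module ℝ V]

/-- Moving `A v_k` to the first slot produces the sign of the alternation; this is `A · α = ∑ e_m* ∧
(A e_m ⌟ α)` without a basis. -/
theorem derivAction_eq_alternatizeUncurryFin {p : ℕ} (A : V →ₗ[ℝ] V)
    (α : V [⋀^Fin (p + 1)]→ₗ[ℝ] ℝ) :
    derivAction A α = AlternatingMap.alternatizeUncurryFin (α.curryLeft ∘ₗ A) := by
  ext v
  rw [derivAction_apply, AlternatingMap.alternatizeUncurryFin_apply]
  refine Finset.sum_congr rfl fun k _ => ?_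
  have h : Function.update v k (A (v k)) = k.insertNth (A (v k)) (k.removeNth v) := by
    rw [Fin.insertNth_removeNth]
  rw [h, AlternatingMap.map_insertNth]
  rfl

/-- The contribution of a symmetric connection term to the exterior derivative vanishes. -/
theorem alternatizeUncurryFin_derivAction_of_symm {p : ℕ} (α : V [⋀^Fin (p + 1)]→ₗ[ℝ] ℝ)
    (N : V →ₗ[ℝ] V →ₗ[ℝ] V) (hN : ∀ u v, N u v = N v u) :
    AlternatingMap.alternatizeUncurryFin (derivActionL α ∘ₗ N) = 0 := by
  -- As the action is itself an alternation, the form in question is alternated twice, in two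
  -- arguments in which it is symmetric.
  have h := AlternatingMap.alternatizeUncurryFin_alternatizeUncurryFinLM_comp_of_symmetric
    (f := (LinearMap.llcomp ℝ V V (V [⋀^Fin p]→ₗ[ℝ] ℝ) α.curryLeft) ∘ₗ N)
    (fun u v => by simp [hN u v])
  refine Eq.trans ?_ h
  congr 1
  ext1 u
  exact derivAction_eq_alternatizeUncurryFin (N u) α

end Alternation

/-! ### Skew endomorphisms that annihilate `φ` also annihilate `⋆φ` -/

section Annihilator

variable {V : Type*} [NormedAddCommGroup V] [InnerProductSpace ℝ V]
variable (e : OrthonormalBasis (Fin 7) ℝ V)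

theorem formInner_derivAction {p : ℕ} (A : V →ₗ[ℝ] V) (α η : V [⋀^Fin (p + 1)]→ₗ[ℝ] ℝ) :
    formInner e (derivAction A α) η = ∑ m, ∑ c, entry e A c m *
      formInner e (interiorProd (e c) α) (interiorProd (e m) η) := by
  rw [derivAction_eq_alternatizeUncurryFin, formInner_alternatizeUncurryFin]
  refine Finset.sum_congr rfl fun m _ => ?_
  have h : (α.curryLeft ∘ₗ A) (e m) = interiorProd (A (e m)) α := rfl
  rw [h, interiorProd_sum e, formInner_sum_left]
  refine Finset.sum_congr rfl fun c _ => ?_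
  rw [formInner_smul_left, entry]

/-- The pairing of `A · φ` with `e_k ⌟ ⋆φ` is a nonzero multiple of the `k`-th coordinate of `p(A)`.
-/
theorem mem_lieG2_of_derivAction_cayleyForm {A : V →ₗ[ℝ] V}
    (hs : ∀ i j, entry e A i j = - entry e A j i) (h : derivAction A (cayleyForm e) = 0) :
    A ∈ lieG2 e := by
  refine (mem_lieG2_iff e).2 ⟨hs, vector_ext e fun k => ?_⟩
  have h1 := formInner_derivAction e A (cayleyForm e) (interiorProd (e k) (cayleyFourForm e))
  rw [h, ← formPairing_apply, map_zero, LinearMap.zero_apply] at h1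
  simp only [formInner_interiorProd_cayleyForm_fourForm] at h1
  rw [inner_pVector, inner_zero_right]
  have h2 : ∀ c m : Fin 7, (epsInt c k m : ℝ) = epsInt m c k := fun c m => by
    rw [epsInt_rotate m c k]
  simp only [h2, mul_left_comm _ (-2 : ℝ), ← Finset.mul_sum] at h1
  have h3 : ∑ m, ∑ c, (epsInt m c k : ℝ) * entry e A m c
      = ∑ m, ∑ c, -(entry e A c m * epsInt m c k) := by
    refine Finset.sum_congr rfl fun m _ => Finset.sum_congr rfl fun c _ => ?_
    rw [hs m c]
    ring
  rw [h3]
  simp only [Finset.sum_neg_distrib]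
  linarith

/-- For skew `A` one has `A · ⋆φ = -k(A)`, and `k` vanishes on `𝔤₂`. -/
theorem derivAction_cayleyFourForm_eq_zero {A : V →ₗ[ℝ] V} (hA : A ∈ lieG2 e) :
    derivAction A (cayleyFourForm e) = 0 := by
  refine form_ext_formInner e fun η => ?_
  have h := formInner_kMap_left e A η
  rw [kMap_eq_zero_of_mem_lieG2 e hA] at h
  have h0 : formInner e 0 η = 0 := by
    rw [← formPairing_apply, map_zero, LinearMap.zero_apply]
  rw [h0] at h ⊢
  rw [formInner_derivAction, ← neg_eq_zero, h, ← Finset.sum_neg_distrib]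
  refine Finset.sum_congr rfl fun m _ => ?_
  rw [← Finset.sum_neg_distrib]
  refine Finset.sum_congr rfl fun c _ => ?_
  rw [formInner_kForm_left, hA.1 c m]
  ring

end Annihilator

/-! ### Coordinate vector fields -/

section CoordField

open Filter Topology VectorField

variable {M : Type*} [TopologicalSpace M] [ChartedSpace E7 M] [IsManifold (𝓡 7) ∞ M]

/-- The vector field with constant coefficient `v` in the chart around `x`. -/
def coordField (x : M) (v : TangentSpace (𝓡 7) x) (y : M) : TangentSpace (𝓡 7) y :=
  FiberBundle.extend E7 v y

theorem mdifferentiableAt_coordField (x : M) (v : TangentSpace (𝓡 7) x) :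
    MDifferentiableAt (𝓡 7) (𝓡 7).tangent
      (fun y => (⟨y, coordField x v y⟩ : TangentBundle (𝓡 7) M)) x :=
  FiberBundle.mdifferentiableAt_extend ..

theorem coordField_self (x : M) (v : TangentSpace (𝓡 7) x) : coordField x v x = v :=
  FiberBundle.extend_apply_self ..

/-- The extension has constant coefficients in the tangent bundle trivialisation at `x`, whose
inverse on fibres is the derivative of the inverse chart. -/
theorem coordField_symm (x : M) (v : E7) {z : E7} (hz : z ∈ (extChartAt (𝓡 7) x).target) :
    coordField x v ((extChartAt (𝓡 7) x).symm z)
      = mfderiv 𝓘(ℝ, E7) (𝓡 7) (extChartAt (𝓡 7) x).symm z v := by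
  have : IsManifold (𝓡 7) 1 M := .of_le (n := ∞) (by norm_cast)
  have hy : (extChartAt (𝓡 7) x).symm z ∈ (chartAt E7 x).source := by
    rw [← extChartAt_source (𝓡 7)]
    exact (extChartAt (𝓡 7) x).map_target hz
  have h := TangentBundle.symmL_trivializationAt (I := 𝓡 7) hy
  rw [(extChartAt (𝓡 7) x).right_inv hz, ModelWithCorners.range_eq_univ,
    mfderivWithin_univ] at h
  rw [← h]
  -- At its own base point the chart has derivative the identity.
  have h1 : (trivializationAt E7 (TangentSpace (𝓡 7)) x ⟨x, v⟩).2 = v := by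
    have h2 := TangentBundle.continuousLinearMapAt_trivializationAt (I := 𝓡 7)
      (mem_chart_source E7 x)
    rw [mfderiv_extChartAt_self] at h2
    have h3 := Trivialization.continuousLinearMapAt_apply_of_mem ℝ
      (trivializationAt E7 (TangentSpace (𝓡 7)) x)
      (FiberBundle.mem_baseSet_trivializationAt' (F := E7) x) v
    exact h3.symm.trans (DFunLike.congr_fun h2 v)
  change (trivializationAt E7 (TangentSpace (𝓡 7)) x).symm _
    (trivializationAt E7 (TangentSpace (𝓡 7)) x ⟨x, v⟩).2 = _
  rw [h1]
  refine (Trivialization.symmL_apply _ ?_ v).symm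
  rw [TangentBundle.trivializationAt_baseSet]
  exact hy

/-- Pulled back to the chart, both fields are constant near the base point. -/
theorem mlieBracket_coordField (x : M) (v w : TangentSpace (𝓡 7) x) :
    mlieBracket (𝓡 7) (coordField x v) (coordField x w) x = 0 := by
  have : IsManifold (𝓡 7) 1 M := .of_le (n := ∞) (by norm_cast)
  have h : ∀ v : TangentSpace (𝓡 7) x,
      mpullbackWithin 𝓘(ℝ, E7) (𝓡 7) (extChartAt (𝓡 7) x).symm (coordField x v)
        (Set.range (𝓡 7)) =ᶠ[𝓝 (extChartAt (𝓡 7) x x)] fun _ => v := by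
    intro v
    filter_upwards [extChartAt_target_mem_nhds x] with z hz
    refine (isInvertible_mfderivWithin_extChartAt_symm hz).inverse_apply_eq.2 ?_
    rw [ModelWithCorners.range_eq_univ, mfderivWithin_univ]
    exact coordField_symm x v hz
  have h0 : ∀ (A B : E7 → E7) (a b : E7) (s : Set E7) (z : E7), A =ᶠ[𝓝 z] (fun _ => a) →
      B =ᶠ[𝓝 z] (fun _ => b) → lieBracketWithin ℝ A B s z = 0 := by
    intro A B a b s z hA hB
    rw [lieBracketWithin, (hA.filter_mono nhdsWithin_le_nhds).fderivWithin_eq hA.self_of_nhds,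
      (hB.filter_mono nhdsWithin_le_nhds).fderivWithin_eq hB.self_of_nhds]
    simp
  have h1 := h0 _ _ _ _ ((extChartAt (𝓡 7) x).symm ⁻¹' Set.univ ∩ Set.range (𝓡 7)) _ (h v) (h w)
  exact (congrArg (mfderiv (𝓡 7) 𝓘(ℝ, E7) (extChartAt (𝓡 7) x) x).inverse h1).trans
    (map_zero _)

/-- A torsion-free connection is symmetric on coordinate vector fields. -/
theorem connection_coordField_comm {D : Connection M}
    (hD : haveI : IsManifold (𝓡 7) 2 M := .of_le (n := ∞) (by norm_cast); D.torsion = 0)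
    (x : M) (v w : TangentSpace (𝓡 7) x) :
    D (coordField x w) x v = D (coordField x v) x w := by
  have : IsManifold (𝓡 7) 2 M := .of_le (n := ∞) (by norm_cast)
  have h := D.torsion_eq_zero_iff.1 hD (mdifferentiableAt_coordField x v)
    (mdifferentiableAt_coordField x w)
  rw [mlieBracket_coordField, coordField_self, coordField_self] at h
  exact sub_eq_zero.1 h

/-- The difference of two connections, evaluated on a vector field. -/
theorem connectionDifference_apply (D' D : Connection M) {x : M}
    {Y : ∀ y : M, TangentSpace (𝓡 7) y}
    (hY : MDifferentiableAt (𝓡 7) (𝓡 7).tangent (fun y => (⟨y, Y y⟩ : TangentBundle (𝓡 7) M)) x)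
    (X : TangentSpace (𝓡 7) x) :
    connectionDifference D' D x X (Y x) = D' Y x X - D Y x X := by
  have : IsManifold (𝓡 7) 1 M := .of_le (n := ∞) (by norm_cast)
  exact DFunLike.congr_fun (IsCovariantDerivativeOn.difference_apply
    D'.isCovariantDerivativeOnUniv D.isCovariantDerivativeOnUniv (Set.mem_univ x) hY) X

end CoordField

/-! ### Differentiation of forms -/

section Calculus

/-- The derivative of a multilinear form on linear combinations of fixed vectors with variable
coefficients. -/
theorem hasFDerivAt_multilinear_combination {E W : Type*} [NormedAddCommGroup E]
    [NormedSpace ℝ E] [AddCommGroup W] [Module ℝ W] {p n : ℕ}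
    (μ : MultilinearMap ℝ (fun _ : Fin p => W) ℝ) (s : Fin n → W) {m : Fin p → Fin n → E → ℝ}
    {m' : Fin p → Fin n → E →L[ℝ] ℝ} {z : E} (hm : ∀ k i, HasFDerivAt (m k i) (m' k i) z) :
    ∃ L : E →L[ℝ] ℝ, HasFDerivAt (fun y => μ fun k => ∑ i, m k i y • s i) L z ∧
      ∀ h, L h = ∑ k, μ (Function.update (fun k => ∑ i, m k i z • s i) k
        (∑ i, m' k i h • s i)) := by
  let ν : MultilinearMap ℝ (fun _ : Fin p => Fin n → ℝ) ℝ :=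
    μ.compLinearMap fun _ => Fintype.linearCombination ℝ s
  have hν : Continuous ν := by
    have h : (ν : (Fin p → Fin n → ℝ) → ℝ) = fun v => ∑ f : Fin p → Fin n,
        (∏ k, v k (f k)) * μ (fun k => s (f k)) := by
      funext v
      change μ (fun k => ∑ i, v k i • s i) = _
      rw [MultilinearMap.map_sum]
      exact Finset.sum_congr rfl fun f _ => MultilinearMap.map_smul_univ ..
    rw [h]
    fun_prop
  let N : ContinuousMultilinearMap ℝ (fun _ : Fin p => Fin n → ℝ) ℝ := { ν with cont := hν }
  have hc : HasFDerivAt (fun y k i => m k i y)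
      (ContinuousLinearMap.pi fun k => ContinuousLinearMap.pi fun i => m' k i) z :=
    hasFDerivAt_pi.2 fun k => hasFDerivAt_pi.2 fun i => hm k i
  have hd : HasFDerivAt (fun y => N fun k i => m k i y) _ z :=
    (N.hasFDerivAt fun k i => m k i z).comp z hc
  refine ⟨_, hd, fun h => ?_⟩
  rw [ContinuousLinearMap.comp_apply, ContinuousMultilinearMap.linearDeriv_apply]
  refine Finset.sum_congr rfl fun k _ => ?_
  change μ (fun l => ∑ i, Function.update (fun k i => m k i z) k (fun i => m' k i h) l i • s i) = _
  congr 1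
  funext l
  by_cases hl : l = k
  · subst hl
    simp
  · simp [hl]

/-- Evaluation on basis tuples embeds the forms linearly in a finite-dimensional coordinate space,
and a left inverse transports differentiability back. -/
theorem differentiableAt_of_forall_apply {p : ℕ} {η : E7 → E7 [⋀^Fin p]→L[ℝ] ℝ} {z : E7}
    (h : ∀ w : Fin p → E7, DifferentiableAt ℝ (fun y => η y w) z) : DifferentiableAt ℝ η z := by
  let b := EuclideanSpace.basisFun (Fin 7) ℝ
  let Λ : (E7 [⋀^Fin p]→L[ℝ] ℝ) →ₗ[ℝ] ((Fin p → Fin 7) → ℝ) :=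
    { toFun := fun α f => α fun k => b (f k)
      map_add' := fun _ _ => rfl
      map_smul' := fun _ _ => rfl }
  have hΛ : LinearMap.ker Λ = ⊥ := by
    refine LinearMap.ker_eq_bot'.2 fun α hα => ?_
    refine ContinuousAlternatingMap.toAlternatingMap_injective ?_
    exact form_eq_zero_of_basis b fun f => congrFun hα f
  obtain ⟨g, hg⟩ := Λ.exists_leftInverse_of_injective hΛ
  have h1 : DifferentiableAt ℝ (fun y => Λ (η y)) z :=
    differentiableAt_pi.2 fun f => h fun k => b (f k)
  have h2 := (LinearMap.toContinuousLinearMap g).differentiableAt.comp z h1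
  refine h2.congr_of_eventuallyEq (.of_forall fun y => ?_)
  exact (LinearMap.congr_fun hg (η y)).symm

/-- If differentiating the coefficients in the direction `X` is the action of `K X`, the exterior
derivative is the alternation of that action. -/
theorem extDeriv_eq_of_hasFDerivAt {p : ℕ} {η : E7 → E7 [⋀^Fin p]→L[ℝ] ℝ} {z : E7}
    (α : E7 [⋀^Fin p]→ₗ[ℝ] ℝ) (K : E7 →ₗ[ℝ] E7 →ₗ[ℝ] E7)
    (h : ∀ w : Fin p → E7, ∃ L : E7 →L[ℝ] ℝ, HasFDerivAt (fun y => η y w) L z ∧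
      ∀ X, L X = derivAction (K X) α w) :
    (extDeriv η z).toAlternatingMap
      = AlternatingMap.alternatizeUncurryFin (derivActionL α ∘ₗ K) := by
  choose L hL hL' using h
  have hd : DifferentiableAt ℝ η z :=
    differentiableAt_of_forall_apply fun w => (hL w).differentiableAt
  ext v
  refine (extDeriv_apply hd v).trans ?_
  rw [AlternatingMap.alternatizeUncurryFin_apply]
  refine Finset.sum_congr rfl fun i _ => ?_
  rw [(hL _).fderiv, hL']
  rfl

end Calculus

/-! ### Derivatives of functions in a chart, and the Leibniz rule for connections -/

section Frame

variable {M : Type*} [TopologicalSpace M] [ChartedSpace E7 M]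

open Filter Topology

theorem hasFDerivAt_comp_extChartAt_symm {f : M → ℝ} {x : M}
    (hf : MDifferentiableAt (𝓡 7) 𝓘(ℝ, ℝ) f x) :
    ∃ L : E7 →L[ℝ] ℝ, HasFDerivAt (fun z => f ((extChartAt (𝓡 7) x).symm z)) L
      (extChartAt (𝓡 7) x x) ∧ ∀ X : TangentSpace (𝓡 7) x,
        L X = mvfderiv (𝓡 7) f x X := by
  have h := hf.hasMFDerivAt.2
  rw [ModelWithCorners.range_eq_univ] at h
  exact ⟨_, h.hasFDerivAt_of_univ, fun X => rfl⟩

variable [IsManifold (𝓡 7) ∞ M]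

/-- Differentiability of the chart expression gives that of `f`, so the manifold derivative is not
the default value zero. This is needed because the condition for a `G₂`-connection mentions only the
derivative. -/
theorem mvfderiv_eq_of_hasFDerivAt {f : M → ℝ} {x : M} {L : E7 →L[ℝ] ℝ}
    (hL : HasFDerivAt (fun z => f ((extChartAt (𝓡 7) x).symm z)) L (extChartAt (𝓡 7) x x))
    (X : TangentSpace (𝓡 7) x) : mvfderiv (𝓡 7) f x X = L X := by
  have : IsManifold (𝓡 7) 1 M := .of_le (n := ∞) (by norm_cast)
  have hf : MDifferentiableAt (𝓡 7) 𝓘(ℝ, ℝ) f x := by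
    have h := hL.differentiableAt.mdifferentiableAt.comp x
      (mdifferentiableAt_extChartAt (I := 𝓡 7) (mem_chart_source E7 x))
    refine h.congr_of_eventuallyEq ?_
    filter_upwards [extChartAt_source_mem_nhds (I := 𝓡 7) x] with y hy
    exact congrArg f ((extChartAt (𝓡 7) x).left_inv hy).symm
  obtain ⟨L', hL', h⟩ := hasFDerivAt_comp_extChartAt_symm hf
  rw [← h, hL'.unique hL]

/-- A connection on a linear combination of vector fields. -/
theorem connection_sum_smul (D : Connection M) {x : M} {n : ℕ} {m : Fin n → M → ℝ}
    {s : Fin n → ∀ y : M, TangentSpace (𝓡 7) y}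
    (hm : ∀ i, MDifferentiableAt (𝓡 7) 𝓘(ℝ, ℝ) (m i) x)
    (hs : ∀ i, MDifferentiableAt (𝓡 7) (𝓡 7).tangent
      (fun y => (⟨y, s i y⟩ : TangentBundle (𝓡 7) M)) x) (X : TangentSpace (𝓡 7) x) :
    MDifferentiableAt (𝓡 7) (𝓡 7).tangent
      (fun y => (⟨y, ∑ i, m i y • s i y⟩ : TangentBundle (𝓡 7) M)) x ∧
    D (fun y => ∑ i, m i y • s i y) x X
      = ∑ i, (m i x • D (s i) x X + mvfderiv (𝓡 7) (m i) x X • s i x) := by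
  have : IsManifold (𝓡 7) 1 M := .of_le (n := ∞) (by norm_cast)
  have hsm : ∀ i, MDifferentiableAt (𝓡 7) (𝓡 7).tangent
      (fun y => (⟨y, m i y • s i y⟩ : TangentBundle (𝓡 7) M)) x :=
    fun i => (hm i).smul_section (hs i)
  have key : ∀ S : Finset (Fin n), MDifferentiableAt (𝓡 7) (𝓡 7).tangent
      (fun y => (⟨y, ∑ i ∈ S, m i y • s i y⟩ : TangentBundle (𝓡 7) M)) x ∧
    D (fun y => ∑ i ∈ S, m i y • s i y) x X
      = ∑ i ∈ S, (m i x • D (s i) x X + mvfderiv (𝓡 7) (m i) x X • s i x) := by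
    intro S
    refine ⟨.sum_section fun i _ => hsm i, ?_⟩
    induction S using Finset.induction_on with
    | empty =>
      have h := DFunLike.congr_fun (congrFun D.zero x) X
      exact h
    | insert a S ha ih =>
      have h1 : (fun y => ∑ i ∈ insert a S, m i y • s i y)
          = (m a • s a) + fun y => ∑ i ∈ S, m i y • s i y := by
        funext y
        rw [Finset.sum_insert ha]
        rfl
      have h2 : D ((m a • s a) + fun y => ∑ i ∈ S, m i y • s i y) x
          = D (m a • s a) x + D (fun y => ∑ i ∈ S, m i y • s i y) x :=
        D.isCovariantDerivativeOnUniv.add (hsm a)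
          (MDifferentiableAt.sum_section fun i _ => hsm i)
      have h3 := D.isCovariantDerivativeOnUniv.leibniz (hs a) (hm a)
      rw [h1, h2, Finset.sum_insert ha, ← ih]
      refine congrArg₂ (fun a b : TangentSpace (𝓡 7) x => a + b) ?_ rfl
      exact DFunLike.congr_fun h3 X
  exact key Finset.univ

end Frame

/-! ### Connections and forms in an orthonormal frame -/

section LocalFrame

open Filter Topology

variable {M : Type*} [TopologicalSpace M] [ChartedSpace E7 M] [IsManifold (𝓡 7) ∞ M]
  [RiemannianBundle (fun x : M => TangentSpace (𝓡 7) x)]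

/-- The connection coefficients of a frame `s`, as the endomorphism `∑ᵢ (∇_X sᵢ) ⊗ sᵢ*`. -/
def frameConnection (D : Connection M) (s : Fin 7 → ∀ y : M, TangentSpace (𝓡 7) y) (x : M)
    (X : TangentSpace (𝓡 7) x) : TangentSpace (𝓡 7) x →ₗ[ℝ] TangentSpace (𝓡 7) x :=
  ∑ i, tensor (D (s i) x X) (s i x)

theorem entry_frameConnection (D : Connection M) {s : Fin 7 → ∀ y : M, TangentSpace (𝓡 7) y}
    {x : M} (e : OrthonormalBasis (Fin 7) ℝ (TangentSpace (𝓡 7) x)) (he : ∀ i, e i = s i x)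
    (X : TangentSpace (𝓡 7) x) (i j : Fin 7) :
    entry e (frameConnection D s x X) i j = inner ℝ (e i) (D (s j) x X) := by
  rw [entry, frameConnection, LinearMap.sum_apply]
  congr 1
  rw [Finset.sum_eq_single j]
  · simp [tensor, ← he]
  · intro k _ hk
    simp [tensor, ← he, hk]
  · simp

variable [IsContMDiffRiemannianBundle (𝓡 7) ∞ E7 (fun x : M => TangentSpace (𝓡 7) x)]

theorem mdifferentiableAt_inner {Y Z : ∀ y : M, TangentSpace (𝓡 7) y} {x : M}
    (hY : MDifferentiableAt (𝓡 7) (𝓡 7).tangent (fun y => (⟨y, Y y⟩ : TangentBundle (𝓡 7) M)) x)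
    (hZ : MDifferentiableAt (𝓡 7) (𝓡 7).tangent (fun y => (⟨y, Z y⟩ : TangentBundle (𝓡 7) M)) x) :
    MDifferentiableAt (𝓡 7) 𝓘(ℝ, ℝ) (fun y => inner ℝ (Y y) (Z y)) x := by
  have : IsManifold (𝓡 7) 1 M := .of_le (n := ∞) (by norm_cast)
  have : IsContMDiffRiemannianBundle (𝓡 7) 1 E7 (fun x : M => TangentSpace (𝓡 7) x) :=
    IsContMDiffRiemannianBundle.of_le (n := ∞) (by norm_cast)
  exact hY.inner_bundle hZ

variable {x : M} {s : Fin 7 → ∀ y : M, TangentSpace (𝓡 7) y}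

/-- A connection in terms of its coefficients in an orthonormal frame. -/
theorem connection_eq_frameConnection_add
    (hs : ∀ i, MDifferentiableAt (𝓡 7) (𝓡 7).tangent
      (fun y => (⟨y, s i y⟩ : TangentBundle (𝓡 7) M)) x)
    (he : ∀ᶠ y in 𝓝 x, ∃ e : OrthonormalBasis (Fin 7) ℝ (TangentSpace (𝓡 7) y), ∀ i, e i = s i y)
    (D : Connection M) {Y : ∀ y : M, TangentSpace (𝓡 7) y}
    (hY : MDifferentiableAt (𝓡 7) (𝓡 7).tangent (fun y => (⟨y, Y y⟩ : TangentBundle (𝓡 7) M)) x)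
    (X : TangentSpace (𝓡 7) x) :
    D Y x X = frameConnection D s x X (Y x)
      + ∑ i, mvfderiv (𝓡 7) (fun y => inner ℝ (s i y) (Y y)) x X • s i x := by
  have : IsManifold (𝓡 7) 1 M := .of_le (n := ∞) (by norm_cast)
  obtain ⟨h1, h2⟩ := connection_sum_smul D (fun i => mdifferentiableAt_inner (hs i) hY) hs X
  have h3 : D Y x = D (fun y => ∑ i, inner ℝ (s i y) (Y y) • s i y) x := by
    refine D.isCovariantDerivativeOnUniv.congr_of_eventuallyEq hY h1 univ_mem ?_
    filter_upwards [he] with y ⟨e, hey⟩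
    simp only [← hey]
    exact (e.sum_repr' (Y y)).symm
  rw [h3, h2, Finset.sum_add_distrib, frameConnection, LinearMap.sum_apply]
  rfl

/-- The derivative of a form with constant components in an orthonormal frame. -/
theorem hasFDerivAt_form_apply
    (hs : ∀ i, MDifferentiableAt (𝓡 7) (𝓡 7).tangent
      (fun y => (⟨y, s i y⟩ : TangentBundle (𝓡 7) M)) x)
    (he : ∀ᶠ y in 𝓝 x, ∃ e : OrthonormalBasis (Fin 7) ℝ (TangentSpace (𝓡 7) y), ∀ i, e i = s i y)
    (D : Connection M) {p : ℕ}
    {α : ∀ y : M, TangentSpace (𝓡 7) y [⋀^Fin p]→ₗ[ℝ] ℝ}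
    (hα : ∀ᶠ y in 𝓝 x, ∀ f : Fin p → Fin 7,
      α y (fun k => s (f k) y) = α x (fun k => s (f k) x))
    {Y : Fin p → ∀ y : M, TangentSpace (𝓡 7) y}
    (hY : ∀ k, MDifferentiableAt (𝓡 7) (𝓡 7).tangent
      (fun y => (⟨y, Y k y⟩ : TangentBundle (𝓡 7) M)) x) :
    ∃ L : E7 →L[ℝ] ℝ, HasFDerivAt
      (fun z => α ((extChartAt (𝓡 7) x).symm z) fun k => Y k ((extChartAt (𝓡 7) x).symm z)) L
      (extChartAt (𝓡 7) x x) ∧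
      ∀ X : TangentSpace (𝓡 7) x, L X
        = ∑ k, α x (Function.update (fun l => Y l x) k
            (D (Y k) x X - frameConnection D s x X (Y k x))) := by
  choose m' hm' hm'' using fun k i =>
    hasFDerivAt_comp_extChartAt_symm (mdifferentiableAt_inner (hs i) (hY k))
  obtain ⟨L, hL, hL'⟩ := hasFDerivAt_multilinear_combination (α x).toMultilinearMap
    (fun i => s i x) hm'
  have hx : (extChartAt (𝓡 7) x).symm (extChartAt (𝓡 7) x x) = x := extChartAt_to_inv x
  refine ⟨L, hL.congr_of_eventuallyEq ?_, fun X => ?_⟩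
  · have hc : Tendsto (extChartAt (𝓡 7) x).symm (𝓝 (extChartAt (𝓡 7) x x)) (𝓝 x) := by
      have h := continuousAt_extChartAt_symm (I := 𝓡 7) x
      rwa [ContinuousAt, hx] at h
    filter_upwards [hc.eventually he, hc.eventually hα] with z ⟨e, hez⟩ hαz
    generalize (extChartAt (𝓡 7) x).symm z = y at *
    have h : ∀ k, Y k y = ∑ i, inner ℝ (s i y) (Y k y) • s i y := by
      intro k
      simp only [← hez]
      exact (e.sum_repr' (Y k y)).symm
    conv_lhs => rw [show (fun k => Y k y) = fun k => ∑ i, inner ℝ (s i y) (Y k y) • s i y from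
      funext h]
    change (α y).toMultilinearMap _ = _
    rw [MultilinearMap.map_sum, MultilinearMap.map_sum]
    refine Finset.sum_congr rfl fun f _ => ?_
    rw [MultilinearMap.map_smul_univ, MultilinearMap.map_smul_univ]
    exact congrArg _ (hαz f)
  · refine (hL' X).trans ?_
    obtain ⟨e, hex⟩ := he.self_of_nhds
    have h : ∀ k, ∑ i, inner ℝ (s i ((extChartAt (𝓡 7) x).symm (extChartAt (𝓡 7) x x)))
        (Y k ((extChartAt (𝓡 7) x).symm (extChartAt (𝓡 7) x x))) • s i x = Y k x := by
      intro k
      rw [hx]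
      simp only [← hex]
      exact e.sum_repr' (Y k x)
    simp only [h]
    refine Finset.sum_congr rfl fun k _ => ?_
    change α x _ = _
    congr 2
    -- The derivative of the coefficients of `Y k` is the covariant derivative minus the
    -- contribution of the frame.
    rw [connection_eq_frameConnection_add hs he D (hY k), add_sub_cancel_left]
    exact Finset.sum_congr rfl fun i _ => congrArg (· • s i x) (hm'' k i X)

end LocalFrame

/-! ### Exterior derivatives of `φ` and `⋆φ` through the intrinsic torsion -/

section Geometry

open Filter Topology

variable {M : Type*} [TopologicalSpace M] [ChartedSpace E7 M] [IsManifold (𝓡 7) ∞ M]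
  [RiemannianBundle (fun x : M => TangentSpace (𝓡 7) x)]

namespace G2Structure

variable (G : G2Structure M)

theorem exists_frame (x : M) : ∃ s : Fin 7 → ∀ y : M, TangentSpace (𝓡 7) y,
    (∀ i, MDifferentiableAt (𝓡 7) (𝓡 7).tangent
      (fun y => (⟨y, s i y⟩ : TangentBundle (𝓡 7) M)) x) ∧
    ∀ᶠ y in 𝓝 x, ∃ e : OrthonormalBasis (Fin 7) ℝ (TangentSpace (𝓡 7) y),
      (∀ i, e i = s i y) ∧ G.IsCayleyBasis y e := by
  obtain ⟨U, hU, hx, s, hs, he⟩ := G.exists_cayley_frame x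
  refine ⟨s, fun i => ((hs i).contMDiffAt (hU.mem_nhds hx)).mdifferentiableAt (by simp), ?_⟩
  filter_upwards [hU.mem_nhds hx] with y hy
  obtain ⟨e, h1, h2⟩ := he y hy
  exact ⟨e, h1, h2⟩

theorem starφ_eq {x : M} {e : OrthonormalBasis (Fin 7) ℝ (TangentSpace (𝓡 7) x)}
    (he : G.IsCayleyBasis x e) : G.starφ x = cayleyFourForm e := by
  rw [starφ, he.2, cayleyFourForm]
  refine hodge_eq_of_orientation_eq _ _ ?_ _ _
  rw [Orientation.finOrthonormalBasis_orientation, he.1]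

end G2Structure

/-- The pointwise formula for the exterior derivative of a parallel form. -/
theorem extDerivAt_eq_torsionDeriv
    {D D' : Connection M}
    (hD : haveI : IsManifold (𝓡 7) 2 M := .of_le (n := ∞) (by norm_cast); D.torsion = 0)
    {x : M} {p : ℕ} {α : ∀ y : M, TangentSpace (𝓡 7) y [⋀^Fin p]→ₗ[ℝ] ℝ}
    (hα : ∀ Y : Fin p → ∀ y : M, TangentSpace (𝓡 7) y,
      (∀ k, MDifferentiableAt (𝓡 7) (𝓡 7).tangent
        (fun y => (⟨y, Y k y⟩ : TangentBundle (𝓡 7) M)) x) →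
      ∃ L : E7 →L[ℝ] ℝ, HasFDerivAt
        (fun z => α ((extChartAt (𝓡 7) x).symm z) fun k => Y k ((extChartAt (𝓡 7) x).symm z)) L
        (extChartAt (𝓡 7) x x) ∧
        ∀ X : TangentSpace (𝓡 7) x, L X
          = ∑ k, α x (Function.update (fun l => Y l x) k (D' (Y k) x X))) :
    extDerivAt α x = torsionDeriv (α x) (connectionDifference D' D x) := by
  have : IsManifold (𝓡 7) 1 M := .of_le (n := ∞) (by norm_cast)
  -- The Christoffel symbols of `D` in the coordinate fields; linearity in `w` follows from that in
  -- `v` by symmetry.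
  let N : TangentSpace (𝓡 7) x →ₗ[ℝ] TangentSpace (𝓡 7) x →ₗ[ℝ] TangentSpace (𝓡 7) x :=
    LinearMap.mk₂ ℝ (fun v w => D (coordField x w) x v)
      (fun v v' w => map_add _ _ _) (fun c v w => map_smul _ _ _)
      (fun v w w' => by
        simp only [connection_coordField_comm hD x v]
        exact map_add _ _ _)
      (fun c v w => by
        simp only [connection_coordField_comm hD x v]
        exact map_smul _ _ _)
  have hN : ∀ v w, N v w = N w v := connection_coordField_comm hD x
  have hK : ∀ v w, D' (coordField x w) x v = (N + connectionDifference D' D x) v w := by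
    intro v w
    have h := connectionDifference_apply D' D (mdifferentiableAt_coordField x w) v
    rw [coordField_self] at h
    rw [LinearMap.add_apply, LinearMap.add_apply, h]
    change _ = D (coordField x w) x v + _
    abel
  have h1 := extDeriv_eq_of_hasFDerivAt (η := chartForm α x) (z := extChartAt (𝓡 7) x x)
    (α x) (N + connectionDifference D' D x) (fun w => by
      obtain ⟨L, hL, hL'⟩ := hα (fun k => coordField x (w k))
        (fun k => mdifferentiableAt_coordField x (w k))
      refine ⟨L, hL.congr_of_eventuallyEq ?_, fun X => (hL' X).trans ?_⟩
      · filter_upwards [extChartAt_target_mem_nhds x] with z hz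
        exact congrArg (α ((extChartAt (𝓡 7) x).symm z))
          (funext fun k => (coordField_symm x (w k) hz).symm)
      · refine Eq.trans ?_ (derivAction_apply _ _ _).symm
        exact Finset.sum_congr rfl fun k _ => congrArg (α x) (congrArg₂
          (fun a b => Function.update a k b) (funext fun l => coordField_self x (w l))
          (hK X (w k))))
  have h2 : torsionDeriv (α x) (connectionDifference D' D x) = AlternatingMap.alternatizeUncurryFin
      (derivActionL (α x) ∘ₗ (N + connectionDifference D' D x)) := by
    have h3 : AlternatingMap.alternatizeUncurryFin (derivActionL (α x) ∘ₗ N) = 0 := by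
      -- Degree zero is separate, as the symmetric cancellation needs an argument to act on; the
      -- action on constants is zero.
      cases p with
      | zero =>
        ext v
        simp [AlternatingMap.alternatizeUncurryFin_apply, derivActionL, derivAction_apply]
      | succ p => exact alternatizeUncurryFin_derivAction_of_symm (α x) N hN
    rw [LinearMap.comp_add, AlternatingMap.alternatizeUncurryFin_add, h3, zero_add]
    rfl
  rw [h2]
  refine Eq.trans ?_ h1
  rw [extDerivAt, mfderiv_extChartAt_self]
  rfl

variable [IsContMDiffRiemannianBundle (𝓡 7) ∞ E7 (fun x : M => TangentSpace (𝓡 7) x)]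

/-- The connection coefficients of a metric connection are skew-symmetric. -/
theorem inner_connection_skew {D : Connection M} (hD : IsLeviCivita D) {x : M}
    {s : Fin 7 → ∀ y : M, TangentSpace (𝓡 7) y}
    (hs : ∀ i, MDifferentiableAt (𝓡 7) (𝓡 7).tangent
      (fun y => (⟨y, s i y⟩ : TangentBundle (𝓡 7) M)) x)
    (he : ∀ᶠ y in 𝓝 x, ∃ e : OrthonormalBasis (Fin 7) ℝ (TangentSpace (𝓡 7) y),
      ∀ i, e i = s i y) (X : TangentSpace (𝓡 7) x) (i j : Fin 7) :
    inner ℝ (s i x) (D (s j) x X) = - inner ℝ (s j x) (D (s i) x X) := by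
  have : IsManifold (𝓡 7) 1 M := .of_le (n := ∞) (by norm_cast)
  have : IsContMDiffRiemannianBundle (𝓡 7) 1 E7 (fun x : M => TangentSpace (𝓡 7) x) :=
    IsContMDiffRiemannianBundle.of_le (n := ∞) (by norm_cast)
  have h := CovariantDerivative.IsMetricCompatible.mvfderiv_inner_eq hD.2
    (fun y => coordField x X y) (hs i) (hs j)
  -- The inner products of an orthonormal frame are locally constant.
  have h0 : mvfderiv (𝓡 7) (fun y => inner ℝ (s i y) (s j y)) x (coordField x X x) = 0 := by
    have h1 : (fun y => inner ℝ (s i y) (s j y)) =ᶠ[𝓝 x] fun _ => if i = j then (1 : ℝ) else 0 := by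
      filter_upwards [he] with y ⟨e, hey⟩
      rw [← hey, ← hey, inner_basis]
    have h2 := h1.mfderiv_eq (I := 𝓡 7) (I' := 𝓘(ℝ, ℝ))
    exact DFunLike.congr_fun (h2.trans mfderiv_const) (coordField x X x)
  have h3 := h0.symm.trans h
  simp only [coordField_self] at h3
  have h4 : inner ℝ (D (s i) x X) (s j x) + inner ℝ (s i x) (D (s j) x X) = (0 : ℝ) := h3.symm
  rw [real_inner_comm] at h4
  linarith

/-- The data of the exterior derivatives at a point. -/
theorem G2Structure.extDerivAt_eq (G : G2Structure M) {D D' : Connection M}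
    (hD : IsLeviCivita D) (hD' : G.IsMinimalConnection D D') (x : M) :
    G.dφ x = torsionDeriv (G.φ x) (connectionDifference D' D x) ∧
    G.dstarφ x = torsionDeriv (G.starφ x) (connectionDifference D' D x) := by
  obtain ⟨s, hs, hG⟩ := G.exists_frame x
  have he : ∀ᶠ y in 𝓝 x, ∃ e : OrthonormalBasis (Fin 7) ℝ (TangentSpace (𝓡 7) y),
      ∀ i, e i = s i y := hG.mono fun y ⟨e, h, _⟩ => ⟨e, h⟩
  obtain ⟨e, hes, hex⟩ := hG.self_of_nhds
  have hφ : ∀ᶠ y in 𝓝 x, ∀ f : Fin 3 → Fin 7,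
      G.φ y (fun k => s (f k) y) = G.φ x (fun k => s (f k) x) := by
    filter_upwards [hG] with y ⟨b, hbs, hby⟩ f
    simp only [← hes, ← hbs]
    rw [hex.2, hby.2, cayleyForm_apply_basis, cayleyForm_apply_basis]
  have hψ : ∀ᶠ y in 𝓝 x, ∀ f : Fin 4 → Fin 7,
      G.starφ y (fun k => s (f k) y) = G.starφ x (fun k => s (f k) x) := by
    filter_upwards [hG] with y ⟨b, hbs, hby⟩ f
    simp only [← hes, ← hbs]
    rw [G.starφ_eq hex, G.starφ_eq hby, cayleyFourForm_apply_basis, cayleyFourForm_apply_basis]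
  have hsub : ∀ {p : ℕ} (α : TangentSpace (𝓡 7) x [⋀^Fin p]→ₗ[ℝ] ℝ)
      (Y : Fin p → ∀ y : M, TangentSpace (𝓡 7) y) (X : TangentSpace (𝓡 7) x),
      ∑ k, α (Function.update (fun l => Y l x) k
        (D' (Y k) x X - frameConnection D' s x X (Y k x)))
      = ∑ k, α (Function.update (fun l => Y l x) k (D' (Y k) x X))
        - derivAction (frameConnection D' s x X) α (fun l => Y l x) := by
    intro p α Y X
    rw [derivAction_apply, ← Finset.sum_sub_distrib]
    exact Finset.sum_congr rfl fun k _ => α.map_update_sub _ _ _ _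
  -- In a Cayley frame `φ` has constant components. Comparing the resulting derivative with
  -- parallelism shows that the connection matrix of `D'` annihilates `φ`.
  have hB : ∀ X, derivAction (frameConnection D' s x X) (G.φ x) = 0 := by
    intro X
    ext v
    obtain ⟨L, hL, hL'⟩ := hasFDerivAt_form_apply hs he D' hφ
      (fun k => mdifferentiableAt_coordField x (v k))
    have h1 := hD'.1 x X (fun k => coordField x (v k))
      (fun k => mdifferentiableAt_coordField x (v k))
    have h2 := (mvfderiv_eq_of_hasFDerivAt
      (f := fun y => G.φ y fun k => coordField x (v k) y) hL X).trans
      ((hL' X).trans (hsub _ _ X))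
    have h3 := h1.symm.trans h2
    simp only [coordField_self] at h3
    have h4 : ∀ {a b : ℝ}, a = a - b → b = 0 := fun h => by linarith
    exact h4 h3
  -- The connection matrix of `D'` is that of the metric connection `D` plus `ξ_X`, and both are
  -- skew.
  have hskew : ∀ X i j, entry e (frameConnection D' s x X) i j
      = - entry e (frameConnection D' s x X) j i := by
    intro X i j
    have h1 : ∀ k l, entry e (connectionDifference D' D x X) k l
        = inner ℝ (e k) (D' (s l) x X) - inner ℝ (e k) (D (s l) x X) := by
      intro k l
      rw [entry, hes l, connectionDifference_apply D' D (hs l) X, inner_sub_right]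
    have h2 := (hD'.2 x e hex X).1 i j
    have h3 := inner_connection_skew hD hs he X i j
    rw [← hes, ← hes] at h3
    rw [h1, h1] at h2
    rw [entry_frameConnection D' e hes, entry_frameConnection D' e hes]
    linarith
  -- Hence the matrix lies in `𝔤₂` and annihilates `⋆φ`; since `⋆φ` has constant components too, it
  -- is `D'`-parallel.
  have hB' : ∀ X, derivAction (frameConnection D' s x X) (G.starφ x) = 0 := by
    intro X
    rw [G.starφ_eq hex]
    refine derivAction_cayleyFourForm_eq_zero e
      (mem_lieG2_of_derivAction_cayleyForm e (hskew X) ?_)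
    rw [← hex.2, hB X]
  constructor
  · refine extDerivAt_eq_torsionDeriv hD.1 fun Y hY => ?_
    obtain ⟨L, hL, hL'⟩ := hasFDerivAt_form_apply hs he D' hφ hY
    refine ⟨L, hL, fun X => (hL' X).trans ?_⟩
    rw [hsub, hB, AlternatingMap.zero_apply, sub_zero]
  · refine extDerivAt_eq_torsionDeriv hD.1 fun Y hY => ?_
    obtain ⟨L, hL, hL'⟩ := hasFDerivAt_form_apply hs he D' hψ hY
    refine ⟨L, hL, fun X => (hL' X).trans ?_⟩
    rw [hsub, hB', AlternatingMap.zero_apply, sub_zero]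

end Geometry

end G2

end

theorem mainTheorem9 {M : Type*} [TopologicalSpace M] [ChartedSpace E7 M]
    [IsManifold (𝓡 7) ∞ M] [RiemannianBundle (fun x : M => TangentSpace (𝓡 7) x)]
    [IsContMDiffRiemannianBundle (𝓡 7) ∞ E7 (fun x : M => TangentSpace (𝓡 7) x)]
    (G : G2Structure M) (D D' : Connection M) (hD : IsLeviCivita D)
    (hD' : G.IsMinimalConnection D D') (x : M)
    (e : OrthonormalBasis (Fin 7) ℝ (TangentSpace (𝓡 7) x)) (he : G.IsCayleyBasis x e) :
    G.starφ x = cayleyFourForm e ∧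
    (∀ a : TangentSpace (𝓡 7) x →ₗ[ℝ] TangentSpace (𝓡 7) x,
      ∃! c, IsSplitting (endModule e) a c) ∧
    (∀ β : TangentSpace (𝓡 7) x [⋀^Fin 4]→ₗ[ℝ] ℝ, ∃! c, IsSplitting (fourFormModule e) β c) ∧
    (∀ γ : TangentSpace (𝓡 7) x [⋀^Fin 5]→ₗ[ℝ] ℝ, ∃! c, IsSplitting (fiveFormModule e) γ c) ∧
    (∃! c, IsSplitting (torsionModule e) (connectionDifference D' D x) c) ∧
    pdStar e (G.dφ x) =
      - hodge e (p := 2 + 4) (by norm_num)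
          (wedge (hodge e (q := 2) (by norm_num) (G.dstarφ x)) (G.starφ x)) ∧
    ∃ T : TangentSpace (𝓡 7) x →ₗ[ℝ] TangentSpace (𝓡 7) x,
      (∀ X Y, connectionDifference D' D x X Y = cross e Y (T X)) ∧
      (∀ T' : TangentSpace (𝓡 7) x →ₗ[ℝ] TangentSpace (𝓡 7) x,
        (∀ X Y, connectionDifference D' D x X Y = cross e Y (T' X)) → T' = T) ∧
      -- the first components
      component (endModule e) T 0
        = (1 / 84 * formInner e (G.dφ x) (G.starφ x)) • LinearMap.id ∧
      (∀ X Y, component (torsionModule e) (connectionDifference D' D x) 0 X Y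
        = (1 / 84 * formInner e (G.dφ x) (G.starφ x)) • cross e Y X) ∧
      -- the second components
      component (endModule e) T 1
        = (1 / 12 : ℝ) • ∑ i : Fin 7, ∑ j ∈ Finset.univ.erase i,
            formInner e
              (G.dstarφ x + (1 / 3 : ℝ) • wedge (pdStar e (G.dφ x)) (G.starφ x))
              (hodge e (p := 1 + 1) (by norm_num) (wedge (flat (e i)) (flat (e j)))) •
            (tensor (e i) (e j) - tensor (e j) (e i)) ∧
      (∀ X Y, component (torsionModule e) (connectionDifference D' D x) 1 X Y
        = cross e Y (component (endModule e) T 1 X)) ∧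
      -- the third components
      component (endModule e) T 2
        = (1 / 6 : ℝ) • ∑ i : Fin 7,
            formInner e (G.dφ x)
              (wedge (flat (e i)) (interiorProd (e i) (G.starφ x)) - (4 / 7 : ℝ) • G.starφ x) •
            tensor (e i) (e i)
          + (1 / 24 : ℝ) • ∑ i : Fin 7, ∑ j ∈ Finset.univ.erase i,
            formInner e (G.dφ x)
              (wedge (flat (e i)) (interiorProd (e j) (G.starφ x))
                + wedge (flat (e j)) (interiorProd (e i) (G.starφ x))) •
            (tensor (e i) (e j) + tensor (e j) (e i)) ∧
      (∀ X Y, component (torsionModule e) (connectionDifference D' D x) 2 X Y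
        = cross e Y (component (endModule e) T 2 X)) ∧
      -- the fourth components
      component (endModule e) T 3 = (1 / 36 : ℝ) • crossRight e (sharp e (pdStar e (G.dφ x))) ∧
      (∀ X Y, component (torsionModule e) (connectionDifference D' D x) 3 X Y
        = (1 / 36 : ℝ) • cross e Y (cross e X (sharp e (pdStar e (G.dφ x))))) ∧
      sharp e (pdStar e (G.dφ x)) = (6 : ℝ) • pVector e T ∧
      (∀ i : Fin 7,
        inner ℝ (e i) (sharp e (pdStar e (G.dφ x)))
          = -(kPairing e (G.dφ x) (i + 1) (i + 3) - kPairing e (G.dφ x) (i + 3) (i + 1)) ∧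
        inner ℝ (e i) (sharp e (pdStar e (G.dφ x)))
          = -(kPairing e (G.dφ x) (i + 4) (i + 5) - kPairing e (G.dφ x) (i + 5) (i + 4)) ∧
        inner ℝ (e i) (sharp e (pdStar e (G.dφ x)))
          = -(kPairing e (G.dφ x) (i + 2) (i + 6) - kPairing e (G.dφ x) (i + 6) (i + 2))) ∧
      -- the components of the exterior derivatives
      component (fourFormModule e) (G.dφ x) 0
        = (3 : ℝ) • kMap e (component (endModule e) T 0) ∧
      component (fourFormModule e) (G.dφ x) 2
        = (3 : ℝ) • kMap e (component (endModule e) T 2) ∧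
      component (fourFormModule e) (G.dφ x) 3
        = (-3 : ℝ) • kMap e (component (endModule e) T 3) ∧
      kMap e (component (endModule e) T 1) = 0 ∧
      component (fiveFormModule e) (G.dstarφ x) 1
        = (3 : ℝ) • mMap e (component (endModule e) T 1) ∧
      component (fiveFormModule e) (G.dstarφ x) 3
        = (-6 : ℝ) • mMap e (component (endModule e) T 3) ∧
      mMap e (component (endModule e) T 0) = 0 ∧
      mMap e (component (endModule e) T 2) = 0 := by
  have hstar := G.starφ_eq he
  obtain ⟨hφ, hψ⟩ := G.extDerivAt_eq hD hD' x
  -- At `x` both forms are the standard ones of the given Cayley basis, so the pointwise theorem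
  -- applies.
  rw [he.2] at hφ
  rw [hstar] at hψ
  obtain ⟨h₁, h₂, h₃, h₄, h₅, h₆⟩ := torsion_components e hstar (hD'.2 x e he) hφ hψ
  exact ⟨hstar, h₁, h₂, h₃, h₄, h₅.trans (congrArg Neg.neg (by with_reducible rfl)), h₆⟩
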